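/- **Setting.** Let $\Omega\subset\mathbb R^3$ be a connected open set with a polyhedral mesh, i.e. finite collections of: pairwise disjoint bounded open elements $T$ with $\overline\Omega=\bigcup_T\overline T$; pairwise disjoint bounded relatively open planar faces $F$, each contained in $\partial T\cap\partial T'$ for two distinct elements or in $\partial T\cap\partial\Omega$ for one element, such that each $\partial T$ is the union of the closures of the set $\mathcal F_T$ of faces contained in $\partial T$; pairwise disjoint open segments (edges) $E$, with distinct vertices as endpoints and containing no vertex, such that the relative boundary of each $F$ is the union of the closures of the set $\mathcal E_F$ of edges contained in it; and vertices $V$ with coordinates $x_V$. Every edge lies on the boundary of a face and every vertex is an endpoint of an edge. Fix points $x_T\in T$, $x_F\in F$, unit normals $n_F$ to the faces, unit tangents $t_E$ to the edges; $V_1,V_2$ are the endpoints of $E$, $t_E$ pointing from $V_1$ to $V_2$. Let $n_{FE}$ be the unit vector such that $(t_E,n_{FE},n_F)$ is right-handed orthonormal, and let $\omega_{TF},\omega_{FE}\in\{\pm1\}$ ($F\in\mathcal F_T$, $E\in\mathcal E_F$) be such that $\omega_{TF}n_F$ points out of $T$ and $\omega_{FE}n_{FE}$ points out of $F$. For a mesh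 entity $P$, $\mathcal P^\ell(P)$ is the space of restrictions to $P$ of polynomials of degree $\le\ell$ ($\{0\}$ if $\ell=-1$), $\mathcal P^{0,\ell}(P)$ its subspace of functions with zero integral; $\boldsymbol{\mathcal P}^\ell(T)=\mathcal P^\ell(T)^3$, and $\boldsymbol{\mathcal P}^\ell(F)$ is the space of tangent fields of degree $\le\ell$. With $\perp$ the rotation of angle $-\pi/2$ in the plane of $F$ oriented by $n_F$, and $\mathbf{rot}_F r=(\nabla_F r)^\perp$, put $\mathcal R^\ell(F)=\mathbf{rot}_F\mathcal P^{\ell+1}(F)$, $\mathcal R^{c,\ell}(F)=(x-x_F)\mathcal P^{\ell-1}(F)$, $\mathcal R^\ell(T)=\mathrm{curl}\,\boldsymbol{\mathcal P}^{\ell+1}(T)$, $\mathcal R^{c,\ell}(T)=(x-x_T)\mathcal P^{\ell-1}(T)$, $\mathcal G^\ell(T)=\nabla\mathcal P^{\ell+1}(T)$, $\mathcal G^{c,\ell}(T)=(x-x_T)\times\boldsymbol{\mathcal P}^{\ell-1}(T)$. $L^2$-orthogonal projectors on these spaces are denoted $\pi^\ell_{\mathcal P,P}$, $\pi^\ell_{\mathcal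 R,P}$, $\pi^{c,\ell}_{\mathcal R,P}$, etc. **Spaces** ($k\ge0$). $X^k_{\rm grad}$: families $q=((q_T),(q_F),(q_E),(q_V))$ with $q_P\in\mathcal P^{k-1}(P)$ for $P=T,F,E$ and $q_V\in\mathbb R$. $X^k_{\rm curl}$: families $v=((v_T,v_T^c),(v_F,v_F^c),(v_E))$ with $v_P\in\mathcal R^{k-1}(P)$, $v_P^c\in\mathcal R^{c,k}(P)$ for $P=T,F$ and $v_E\in\mathcal P^k(E)$. $X^k_{\rm div}$: families $w=((w_T,w_T^c),(w_F))$ with $w_T\in\mathcal G^{k-1}(T)$, $w_T^c\in\mathcal G^{c,k}(T)$, $w_F\in\mathcal P^k(F)$. $\mathcal P^k(\mathcal T_h)$: families $(r_T)$ with $r_T\in\mathcal P^k(T)$. **Operators.** All unknowns below are polynomials in the indicated spaces. - $\gamma_E^{k+1}q\in\mathcal P^{k+1}(E)$: equals $q_V$ at the endpoints $V$ of $E$ and $\pi^{k-1}_{\mathcal P,E}\gamma_E^{k+1}q=q_E$. - $G_E^kq\in\mathcal P^k(E)$: $\int_E G_E^kq\,r=-\int_E q_Er'+q_{V_2}r(x_{V_2})-q_{V_1}r(x_{V_1})$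 for all $r\in\mathcal P^k(E)$ (derivative along $t_E$). - $\mathsf G_F^kq\in\boldsymbol{\mathcal P}^k(F)$: $\int_F\mathsf G_F^kq\cdot v=-\int_Fq_F\,\mathrm{div}_Fv+\sum_{E\in\mathcal E_F}\omega_{FE}\int_E\gamma_E^{k+1}q\,(v\cdot n_{FE})$ for all $v\in\boldsymbol{\mathcal P}^k(F)$. - $\gamma_F^{k+1}q\in\mathcal P^{k+1}(F)$: $\int_F\gamma_F^{k+1}q\,\mathrm{div}_Fv=-\int_F\mathsf G_F^kq\cdot v+\sum_{E\in\mathcal E_F}\omega_{FE}\int_E\gamma_E^{k+1}q\,(v\cdot n_{FE})$ for all $v\in\mathcal R^{c,k+2}(F)$. - $\mathsf G_T^kq\in\boldsymbol{\mathcal P}^k(T)$: $\int_T\mathsf G_T^kq\cdot v=-\int_Tq_T\,\mathrm{div}\,v+\sum_{F\in\mathcal F_T}\omega_{TF}\int_F\gamma_F^{k+1}q\,(v\cdot n_F)$ for all $v\in\boldsymbol{\mathcal P}^k(T)$. - $G_h^kq=\big((\pi^{k-1}_{\mathcal R,T}\mathsf G_T^kq,\pi^{c,k}_{\mathcal R,T}\mathsf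 G_T^kq)_T,(\pi^{k-1}_{\mathcal R,F}\mathsf G_F^kq,\pi^{c,k}_{\mathcal R,F}\mathsf G_F^kq)_F,(G_E^kq)_E\big)\in X^k_{\rm curl}$. - $C_F^kv\in\mathcal P^k(F)$: $\int_FC_F^kv\,r=\int_Fv_F\cdot\mathbf{rot}_Fr-\sum_{E\in\mathcal E_F}\omega_{FE}\int_Ev_Er$ for all $r\in\mathcal P^k(F)$. - $\gamma_{t,F}^kv\in\boldsymbol{\mathcal P}^k(F)$: $\int_F\gamma_{t,F}^kv\cdot(\mathbf{rot}_Fr+w)=\int_FC_F^kv\,r+\sum_{E\in\mathcal E_F}\omega_{FE}\int_Ev_Er+\int_Fv_F^c\cdot w$ for all $(r,w)\in\mathcal P^{0,k+1}(F)\times\mathcal R^{c,k}(F)$. - $\mathsf C_T^kv\in\boldsymbol{\mathcal P}^k(T)$: $\int_T\mathsf C_T^kv\cdot w=\int_Tv_T\cdot\mathrm{curl}\,w+\sum_{F\in\mathcal F_T}\omega_{TF}\int_F\gamma_{t,F}^kv\cdot(w\times n_F)$ for all $w\in\boldsymbol{\mathcal P}^k(T)$. - $P_{{\rm curl},T}^kv\in\boldsymbol{\mathcal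 P}^k(T)$: $\int_TP_{{\rm curl},T}^kv\cdot(\mathrm{curl}\,w+z)=\int_T\mathsf C_T^kv\cdot w-\sum_{F\in\mathcal F_T}\omega_{TF}\int_F\gamma_{t,F}^kv\cdot(w\times n_F)+\int_Tv_T^c\cdot z$ for all $(w,z)\in\mathcal G^{c,k+1}(T)\times\mathcal R^{c,k}(T)$. - $C_h^kv=\big((\pi^{k-1}_{\mathcal G,T}\mathsf C_T^kv,\pi^{c,k}_{\mathcal G,T}\mathsf C_T^kv)_T,(C_F^kv)_F\big)\in X^k_{\rm div}$. - $D_T^kw\in\mathcal P^k(T)$: $\int_TD_T^kw\,r=-\int_Tw_T\cdot\nabla r+\sum_{F\in\mathcal F_T}\omega_{TF}\int_Fw_Fr$ for all $r\in\mathcal P^k(T)$; $D_h^kw=(D_T^kw)_T$. - $P_{{\rm div},T}^kw\in\boldsymbol{\mathcal P}^k(T)$: $\int_TP_{{\rm div},T}^kw\cdot(\nabla r+z)=-\int_TD_T^kw\,r+\sum_{F\in\mathcal F_T}\omega_{TF}\int_Fw_Fr+\int_Tw_T^c\cdot z$ for all $(r,z)\in\mathcal P^{0,k+1}(T)\times\mathcal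 G^{c,k}(T)$. - $I_h^kq=\big((\pi^{k-1}_{\mathcal P,T}q)_T,(\pi^{k-1}_{\mathcal P,F}q)_F,(\pi^{k-1}_{\mathcal P,E}q)_E,(q(x_V))_V\big)$ for continuous $q$; real numbers are identified with constant functions. **Extensions.** - $\mathcal E_{\rm grad}:X^0_{\rm grad}\to X^k_{\rm grad}$ maps $q$ to $\hat q=((\hat q_T),(\hat q_F),(\hat q_E),(q_V))$ with $\hat q_P\in\mathcal P^{k-1}(P)$ such that $\int_E\hat q_Er'=-\int_EG_E^0q\,r+q_{V_2}r(x_{V_2})-q_{V_1}r(x_{V_1})$ for all $r\in\mathcal P^k(E)$; $\int_F\hat q_F\,\mathrm{div}_Fv=-\int_F\mathsf G_F^0q\cdot v+\sum_{E\in\mathcal E_F}\omega_{FE}\int_E\gamma_E^{k+1}\hat q\,(v\cdot n_{FE})$ for all $v\in\mathcal R^{c,k}(F)$; $\int_T\hat q_T\,\mathrm{div}\,v=-\int_T\mathsf G_T^0q\cdot v+\sum_{F\in\mathcal F_T}\omega_{TF}\int_F\gamma_F^{k+1}\hat q\,(v\cdot n_F)$ for all $v\in\mathcal R^{c,k}(T)$.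 - $\mathcal E_{\rm curl}:X^0_{\rm curl}\to X^k_{\rm curl}$ maps $v$ to $\hat v=\big((\hat v_T,\pi^{c,k}_{\mathcal R,T}P^0_{{\rm curl},T}v)_T,(\hat v_F,\pi^{c,k}_{\mathcal R,F}\gamma_{t,F}^0v)_F,(v_E)_E\big)$ with $\hat v_F\in\mathcal R^{k-1}(F)$, $\hat v_T\in\mathcal R^{k-1}(T)$ such that $\int_F\hat v_F\cdot\mathbf{rot}_Fr=\int_FC_F^0v\,r+\sum_{E\in\mathcal E_F}\omega_{FE}\int_Ev_Er$ for all $r\in\mathcal P^k(F)$; $\int_T\hat v_T\cdot\mathrm{curl}\,w=\int_T\mathsf C_T^0v\cdot w-\sum_{F\in\mathcal F_T}\omega_{TF}\int_F\gamma_{t,F}^k\hat v\cdot(w\times n_F)$ for all $w\in\mathcal G^{c,k}(T)$. - $\mathcal E_{\rm div}:X^0_{\rm div}\to X^k_{\rm div}$ maps $w$ to $\big((\hat w_T,\pi^{c,k}_{\mathcal G,T}P^0_{{\rm div},T}w)_T,(w_F)_F\big)$ with $\hat w_T\in\mathcal G^{k-1}(T)$ such that $\int_T\hat w_T\cdot\nabla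 r=-\int_TD_T^0w\,r+\sum_{F\in\mathcal F_T}\omega_{TF}\int_Fw_Fr$ for all $r\in\mathcal P^k(T)$. **Lemma (cochain map properties for the extensions).** For every $k\ge0$, the problems above that define the projectors, the traces, the discrete operators of degrees $0$ and $k$, the two potentials $P^0_{{\rm curl},T}$, $P^0_{{\rm div},T}$ and the extensions have exactly one solution, and $$I_h^kC=\mathcal E_{\rm grad}I_h^0C\quad\forall C\in\mathbb R,\qquad G_h^k\mathcal E_{\rm grad}q=\mathcal E_{\rm curl}G_h^0q\quad\forall q\in X^0_{\rm grad},$$ $$C_h^k\mathcal E_{\rm curl}v=\mathcal E_{\rm div}C_h^0v\quad\forall v\in X^0_{\rm curl},\qquad D_h^k\mathcal E_{\rm div}w=D_h^0w\quad\forall w\in X^0_{\rm div},$$ the last equality being in $\mathcal P^k(\mathcal T_h)\supseteq\mathcal P^0(\mathcal T_h)$. -/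

import Mathlib

open MeasureTheory
open scoped Matrix

namespace DDR

noncomputable section

/-! # Polynomials

Points are elements of `Fin d → ℝ`; only its topology and Lebesgue measure are used, and Euclidean
lengths and scalar products are always written through `⬝ᵥ`.

A polynomial on an element is a polynomial in the Cartesian coordinates of `ℝ³`. A polynomial on a
face is a polynomial in two orthonormal coordinates of its plane, and a polynomial on an edge is a
polynomial in the arc length. Mesh entities are relatively open and non-empty, so these are
in bijection with the restrictions to the entity of three-variate polynomial functions, degree by
degree. -/

/-- Coordinates in the plane of a face. -/
abbrev R2 := Fin 2 → ℝ

/-- Points of the physical space. -/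
abbrev R3 := Fin 3 → ℝ

/-- Scalar polynomials in `d` variables. -/
abbrev SPol (d : ℕ) := MvPolynomial (Fin d) ℝ

/-- Vector-valued polynomials in `d` variables with `d` components. -/
abbrev VPol (d : ℕ) := Fin d → SPol d

/-- Value of a vector-valued polynomial at a point. -/
def ev {d : ℕ} (v : VPol d) (x : Fin d → ℝ) : Fin d → ℝ := fun i => MvPolynomial.eval x (v i)

/-- `P^l` in `d` variables: scalar polynomials of total degree at most `l`. For `l = -1` this
is the zero space. -/
def PolS (d : ℕ) (l : ℤ) : Submodule ℝ (SPol d) :=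
  MvPolynomial.restrictSupport ℝ {m | (m.degree : ℤ) ≤ l}

/-- Vector-valued polynomials all of whose components have degree at most `l`. -/
def PolV (d : ℕ) (l : ℤ) : Submodule ℝ (VPol d) := Submodule.pi Set.univ fun _ => PolS d l

/-- Polynomials of degree at most `l` on an edge (zero space for `l = -1`). -/
def PolE (l : ℤ) : Submodule ℝ (Polynomial ℝ) := Polynomial.degreeLT ℝ (l + 1).toNat

/-- Gradient. -/
def grad (d : ℕ) : SPol d →ₗ[ℝ] VPol d where
  toFun p := fun i => MvPolynomial.pderiv i p
  map_add' p q := by ext1 i; simp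
  map_smul' c p := by ext1 i; simp

/-- Divergence. -/
def vdiv {d : ℕ} (v : VPol d) : SPol d := ∑ i, MvPolynomial.pderiv i (v i)

/-- Rotation of angle `-π/2` in the oriented plane. -/
def perp (v : VPol 2) : VPol 2 := ![v 1, - v 0]

/-- Vector rotational of a scalar polynomial: the rotated gradient. -/
def vrot : SPol 2 →ₗ[ℝ] VPol 2 where
  toFun p := perp (grad 2 p)
  map_add' p q := by ext1 i; fin_cases i <;> simp [perp, add_comm]
  map_smul' c p := by ext1 i; fin_cases i <;> simp [perp]

/-- Curl. -/
def curl : VPol 3 →ₗ[ℝ] VPol 3 where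
  toFun v := ![MvPolynomial.pderiv 1 (v 2) - MvPolynomial.pderiv 2 (v 1),
    MvPolynomial.pderiv 2 (v 0) - MvPolynomial.pderiv 0 (v 2),
    MvPolynomial.pderiv 0 (v 1) - MvPolynomial.pderiv 1 (v 0)]
  map_add' v w := by ext1 i; fin_cases i <;> simp <;> ring
  map_smul' c v := by ext1 i; fin_cases i <;> simp [smul_sub]

/-- The vector field `x - c`. -/
def posVec {d : ℕ} (c : Fin d → ℝ) : VPol d := fun i => MvPolynomial.X i - MvPolynomial.C (c i)

/-- Multiplication of a scalar polynomial by the vector field `x - c`. -/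
def posMul {d : ℕ} (c : Fin d → ℝ) : SPol d →ₗ[ℝ] VPol d where
  toFun p := p • posVec c
  map_add' p q := by rw [add_smul]
  map_smul' a p := by simp [smul_assoc]

/-- Cross product of the vector field `x - c` with a vector-valued polynomial. -/
def posCross (c : R3) : VPol 3 →ₗ[ℝ] VPol 3 :=
  (crossProduct (posVec c)).restrictScalars ℝ

/-- `R^l(F) = rot_F P^{l+1}(F)`. -/
def RolyF (l : ℤ) : Submodule ℝ (VPol 2) := (PolS 2 (l + 1)).map vrot

/-- `R^{c,l}(F) = (x - x_F) P^{l-1}(F)`, in face coordinates with origin `x_F`. -/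
def RolyFc (l : ℤ) : Submodule ℝ (VPol 2) := (PolS 2 (l - 1)).map (posMul 0)

/-- `G^l(T) = grad P^{l+1}(T)`. -/
def GolyT (l : ℤ) : Submodule ℝ (VPol 3) := (PolS 3 (l + 1)).map (grad 3)

/-- `G^{c,l}(T) = (x - x_T) × P^{l-1}(T)^3`. -/
def GolyTc (c : R3) (l : ℤ) : Submodule ℝ (VPol 3) := (PolV 3 (l - 1)).map (posCross c)

/-- `R^l(T) = curl P^{l+1}(T)^3`. -/
def RolyT (l : ℤ) : Submodule ℝ (VPol 3) := (PolV 3 (l + 1)).map curl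

/-- `R^{c,l}(T) = (x - x_T) P^{l-1}(T)`. -/
def RolyTc (c : R3) (l : ℤ) : Submodule ℝ (VPol 3) := (PolS 3 (l - 1)).map (posMul c)

theorem PolS_mono (d : ℕ) {l m : ℤ} (h : l ≤ m) : PolS d l ≤ PolS d m := by
  intro p hp i hi
  exact le_trans (hp hi) h

theorem PolE_mono {l m : ℤ} (h : l ≤ m) : PolE l ≤ PolE m :=
  Polynomial.degreeLT_mono (by omega)

/-- The unique solution of the problem `P` (and `0` if `P` does not have exactly one solution). -/
def theSol {α : Type*} [Zero α] (P : α → Prop) : α :=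
  open Classical in if h : ∃! x, P x then h.choose else 0

/-! # Polyhedral meshes -/

/-- The data of a mesh: finitely many elements, faces, edges and vertices. -/
structure MeshData where
  /-- number of elements -/
  nT : ℕ
  /-- number of faces -/
  nF : ℕ
  /-- number of edges -/
  nE : ℕ
  /-- number of vertices -/
  nV : ℕ
  /-- the (open) elements -/
  cell : Fin nT → Set R3
  /-- the point `x_T` -/
  ctrT : Fin nT → R3
  /-- the point `x_F` -/
  ctrF : Fin nF → R3
  /-- first vector of an oriented orthonormal basis of the plane of a face -/
  e₁ : Fin nF → R3
  /-- second vector of an oriented orthonormal basis of the plane of a face -/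
  e₂ : Fin nF → R3
  /-- the (relatively open) face, in the coordinates given by `x_F` and the basis -/
  dom : Fin nF → Set R2
  /-- first endpoint `V₁` of an edge -/
  tail : Fin nE → Fin nV
  /-- second endpoint `V₂` of an edge -/
  head : Fin nE → Fin nV
  /-- coordinates of the vertices -/
  pos : Fin nV → R3
  /-- the sign `ω_TF` -/
  ωTF : Fin nT → Fin nF → ℝ
  /-- the sign `ω_FE` -/
  ωFE : Fin nF → Fin nE → ℝ

namespace MeshData

section

variable (M : MeshData)

/-- Length of an edge. -/
def len (E : Fin M.nE) : ℝ :=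
  √((M.pos (M.head E) - M.pos (M.tail E)) ⬝ᵥ (M.pos (M.head E) - M.pos (M.tail E)))

/-- Unit tangent `t_E`, pointing from `V₁` to `V₂`. -/
def tangent (E : Fin M.nE) : R3 := (M.len E)⁻¹ • (M.pos (M.head E) - M.pos (M.tail E))

/-- Arc-length parametrisation of an edge, on `[0, |E|]`. -/
def edgePt (E : Fin M.nE) (s : ℝ) : R3 := M.pos (M.tail E) + s • M.tangent E

/-- The open edge. -/
def edgeSet (E : Fin M.nE) : Set R3 := openSegment ℝ (M.pos (M.tail E)) (M.pos (M.head E))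

/-- The closed edge. -/
def edgeClosure (E : Fin M.nE) : Set R3 := segment ℝ (M.pos (M.tail E)) (M.pos (M.head E))

/-- The vector of `ℝ³` with given coordinates in the basis of the plane of a face. -/
def lift (F : Fin M.nF) (u : R2) : R3 := u 0 • M.e₁ F + u 1 • M.e₂ F

/-- Isometric parametrisation of the plane of a face. -/
def chart (F : Fin M.nF) (y : R2) : R3 := M.ctrF F + M.lift F y

/-- Coordinates of (the orthogonal projection of) a point in the plane of a face. -/
def coord (F : Fin M.nF) (x : R3) : R2 := ![M.e₁ F ⬝ᵥ (x - M.ctrF F), M.e₂ F ⬝ᵥ (x - M.ctrF F)]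

/-- The (relatively open) face. -/
def faceSet (F : Fin M.nF) : Set R3 := M.chart F '' M.dom F

/-- The relative boundary of a face. -/
def faceFrontier (F : Fin M.nF) : Set R3 := M.chart F '' frontier (M.dom F)

/-- Unit normal `n_F`. -/
def normalF (F : Fin M.nF) : R3 := M.e₁ F ⨯₃ M.e₂ F

/-- The unit normal `n_FE` to `E` in the plane of `F`: the one for which `(t_E, n_FE, n_F)` is
right-handed. -/
def normalFE (F : Fin M.nF) (E : Fin M.nE) : R3 := M.normalF F ⨯₃ M.tangent E

/-- The faces on the boundary of an element. -/
def facesOf (T : Fin M.nT) : Finset (Fin M.nF) :=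
  open Classical in Finset.univ.filter fun F => M.faceSet F ⊆ frontier (M.cell T)

/-- The edges on the boundary of a face. -/
def edgesOf (F : Fin M.nF) : Finset (Fin M.nE) :=
  open Classical in Finset.univ.filter fun E => M.edgeSet E ⊆ M.faceFrontier F

/-- At every point of `S`, the vector `n` points out of `A`. -/
def PointsOut (n : R3) (S A : Set R3) : Prop :=
  ∀ x ∈ S, ∃ ε > 0, ∀ t ∈ Set.Ioo (0 : ℝ) ε, x + t • n ∉ A ∧ x - t • n ∈ A

/-- `M` is a polyhedral mesh of the connected domain `Ω`. -/
structure IsPolyhedralMesh (M : MeshData) (Ω : Set R3) : Prop where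
  isOpen_domain : IsOpen Ω
  isConnected_domain : IsConnected Ω
  /- elements -/
  isOpen_cell : ∀ T, IsOpen (M.cell T)
  isBounded_cell : ∀ T, Bornology.IsBounded (M.cell T)
  ctrT_mem : ∀ T, M.ctrT T ∈ M.cell T
  disjoint_cell : Pairwise fun T T' => Disjoint (M.cell T) (M.cell T')
  closure_domain : closure Ω = ⋃ T, closure (M.cell T)
  /- faces -/
  e₁_unit : ∀ F, M.e₁ F ⬝ᵥ M.e₁ F = 1
  e₂_unit : ∀ F, M.e₂ F ⬝ᵥ M.e₂ F = 1
  e₁_orth_e₂ : ∀ F, M.e₁ F ⬝ᵥ M.e₂ F = 0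
  isOpen_dom : ∀ F, IsOpen (M.dom F)
  isBounded_dom : ∀ F, Bornology.IsBounded (M.dom F)
  /-- `x_F` (the origin of the coordinates) lies in the face -/
  ctrF_mem : ∀ F, 0 ∈ M.dom F
  disjoint_face : Pairwise fun F F' => Disjoint (M.faceSet F) (M.faceSet F')
  /-- each face is an interface or a boundary face -/
  face_cases : ∀ F,
    (∃ T T', T ≠ T' ∧ M.faceSet F ⊆ frontier (M.cell T) ∩ frontier (M.cell T')) ∨
    (∃ T, M.faceSet F ⊆ frontier (M.cell T) ∩ frontier Ω)
  /-- the boundary of an element is covered by the closures of its faces -/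
  frontier_cell : ∀ T, frontier (M.cell T) = ⋃ F ∈ M.facesOf T, closure (M.faceSet F)
  /- edges and vertices -/
  tail_ne_head : ∀ E, M.tail E ≠ M.head E
  pos_injective : Function.Injective M.pos
  disjoint_edge : Pairwise fun E E' => Disjoint (M.edgeSet E) (M.edgeSet E')
  vertex_not_mem_edge : ∀ V E, M.pos V ∉ M.edgeSet E
  /-- the boundary of a face is covered by its closed edges -/
  frontier_face : ∀ F, M.faceFrontier F = ⋃ E ∈ M.edgesOf F, M.edgeClosure E
  edge_mem_face : ∀ E, ∃ F, E ∈ M.edgesOf F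
  vertex_mem_edge : ∀ V, ∃ E, M.tail E = V ∨ M.head E = V
  /- relative orientations -/
  ωTF_sign : ∀ T, ∀ F ∈ M.facesOf T, M.ωTF T F = 1 ∨ M.ωTF T F = -1
  ωTF_out : ∀ T, ∀ F ∈ M.facesOf T,
    PointsOut (M.ωTF T F • M.normalF F) (M.faceSet F) (M.cell T)
  ωFE_sign : ∀ F, ∀ E ∈ M.edgesOf F, M.ωFE F E = 1 ∨ M.ωFE F E = -1
  ωFE_out : ∀ F, ∀ E ∈ M.edgesOf F,
    PointsOut (M.ωFE F E • M.normalFE F E) (M.edgeSet E) (M.faceSet F)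

/-! # Integrals and projectors -/

/-- Integral over an element. -/
def intT (T : Fin M.nT) (f : R3 → ℝ) : ℝ := ∫ x in M.cell T, f x

/-- Integral over a face of a function of the face coordinates. -/
def intF (F : Fin M.nF) (f : R2 → ℝ) : ℝ := ∫ y in M.dom F, f y

/-- Integral over an edge of a function of the arc length. -/
def intE (E : Fin M.nE) (f : ℝ → ℝ) : ℝ := ∫ s in (0 : ℝ)..(M.len E), f s

/-- `p` is the `L²`-orthogonal projection of `f` on the scalar space `S`, on an element. -/
def IsProjT (T : Fin M.nT) (S : Submodule ℝ (SPol 3)) (f : R3 → ℝ) (p : S) : Prop :=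
  ∀ r : S, M.intT T (fun x => MvPolynomial.eval x p.1 * MvPolynomial.eval x r.1)
    = M.intT T (fun x => f x * MvPolynomial.eval x r.1)

/-- `p` is the `L²`-orthogonal projection of `f` on the scalar space `S`, on a face. -/
def IsProjF (F : Fin M.nF) (S : Submodule ℝ (SPol 2)) (f : R2 → ℝ) (p : S) : Prop :=
  ∀ r : S, M.intF F (fun y => MvPolynomial.eval y p.1 * MvPolynomial.eval y r.1)
    = M.intF F (fun y => f y * MvPolynomial.eval y r.1)

/-- `p` is the `L²`-orthogonal projection of `f` on the scalar space `S`, on an edge. -/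
def IsProjE (E : Fin M.nE) (S : Submodule ℝ (Polynomial ℝ)) (f : ℝ → ℝ) (p : S) : Prop :=
  ∀ r : S, M.intE E (fun s => p.1.eval s * r.1.eval s) = M.intE E (fun s => f s * r.1.eval s)

/-- `p` is the `L²`-orthogonal projection of `f` on the vector space `S`, on an element. -/
def IsVProjT (T : Fin M.nT) (S : Submodule ℝ (VPol 3)) (f : R3 → R3) (p : S) : Prop :=
  ∀ v : S, M.intT T (fun x => ev p.1 x ⬝ᵥ ev v.1 x) = M.intT T (fun x => f x ⬝ᵥ ev v.1 x)

/-- `p` is the `L²`-orthogonal projection of `f` on the vector space `S`, on a face. -/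
def IsVProjF (F : Fin M.nF) (S : Submodule ℝ (VPol 2)) (f : R2 → R2) (p : S) : Prop :=
  ∀ v : S, M.intF F (fun y => ev p.1 y ⬝ᵥ ev v.1 y) = M.intF F (fun y => f y ⬝ᵥ ev v.1 y)

/-- `L²`-orthogonal projector on a scalar space, on an element. -/
def projT (T : Fin M.nT) (S : Submodule ℝ (SPol 3)) (f : R3 → ℝ) : S := theSol (M.IsProjT T S f)

/-- `L²`-orthogonal projector on a scalar space, on a face. -/
def projF (F : Fin M.nF) (S : Submodule ℝ (SPol 2)) (f : R2 → ℝ) : S := theSol (M.IsProjF F S f)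

/-- `L²`-orthogonal projector on a scalar space, on an edge. -/
def projE (E : Fin M.nE) (S : Submodule ℝ (Polynomial ℝ)) (f : ℝ → ℝ) : S :=
  theSol (M.IsProjE E S f)

/-- `L²`-orthogonal projector on a vector space, on an element. -/
def vprojT (T : Fin M.nT) (S : Submodule ℝ (VPol 3)) (f : R3 → R3) : S :=
  theSol (M.IsVProjT T S f)

/-- `L²`-orthogonal projector on a vector space, on a face. -/
def vprojF (F : Fin M.nF) (S : Submodule ℝ (VPol 2)) (f : R2 → R2) : S :=
  theSol (M.IsVProjF F S f)

/-- `P^{0,l}(F)`: polynomials of degree at most `l` with zero integral over the face. -/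
def PolF0 (F : Fin M.nF) (l : ℤ) : Set (SPol 2) :=
  {p | p ∈ PolS 2 l ∧ M.intF F (fun y => MvPolynomial.eval y p) = 0}

/-- `P^{0,l}(T)`: polynomials of degree at most `l` with zero integral over the element. -/
def PolT0 (T : Fin M.nT) (l : ℤ) : Set (SPol 3) :=
  {p | p ∈ PolS 3 l ∧ M.intT T (fun x => MvPolynomial.eval x p) = 0}

/-! # Spaces -/

/-- The discrete counterpart of `H¹`. -/
@[ext] structure XGrad (k : ℕ) where
  /-- element components -/
  qT : Fin M.nT → PolS 3 ((k : ℤ) - 1)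
  /-- face components -/
  qF : Fin M.nF → PolS 2 ((k : ℤ) - 1)
  /-- edge components -/
  qE : Fin M.nE → PolE ((k : ℤ) - 1)
  /-- vertex components -/
  qV : Fin M.nV → ℝ

/-- The discrete counterpart of `H(curl)`. -/
@[ext] structure XCurl (k : ℕ) where
  /-- element components in `R^{k-1}(T)` -/
  vT : Fin M.nT → RolyT ((k : ℤ) - 1)
  /-- element components in `R^{c,k}(T)` -/
  vTc : (T : Fin M.nT) → RolyTc (M.ctrT T) k
  /-- face components in `R^{k-1}(F)` -/
  vF : Fin M.nF → RolyF ((k : ℤ) - 1)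
  /-- face components in `R^{c,k}(F)` -/
  vFc : Fin M.nF → RolyFc k
  /-- edge components -/
  vE : Fin M.nE → PolE k

/-- The discrete counterpart of `H(div)`. -/
@[ext] structure XDiv (k : ℕ) where
  /-- element components in `G^{k-1}(T)` -/
  wT : Fin M.nT → GolyT ((k : ℤ) - 1)
  /-- element components in `G^{c,k}(T)` -/
  wTc : (T : Fin M.nT) → GolyTc (M.ctrT T) k
  /-- face components -/
  wF : Fin M.nF → PolS 2 k

/-- The discrete counterpart of `L²`: broken polynomials of degree at most `k` on the elements. -/
abbrev PolTh (k : ℕ) := Fin M.nT → PolS 3 (k : ℤ)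

/-! # Gradient -/

/-- Boundary sum `∑_{E ⊂ ∂F} ω_FE ∫_E f_E g|_E`, with `f_E` a function of the arc length on `E`
and `g` a function of the face coordinates. -/
def bdryF (F : Fin M.nF) (f : Fin M.nE → ℝ → ℝ) (g : Fin M.nE → R2 → ℝ) : ℝ :=
  ∑ E ∈ M.edgesOf F, M.ωFE F E * M.intE E (fun s => f E s * g E (M.coord F (M.edgePt E s)))

/-- Boundary sum `∑_{F ⊂ ∂T} ω_TF ∫_F f_F(y, x)`, with `y` the face coordinates of the point `x`. -/
def bdryT (T : Fin M.nT) (f : Fin M.nF → R2 → R3 → ℝ) : ℝ :=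
  ∑ F ∈ M.facesOf T, M.ωTF T F * M.intF F (fun y => f F y (M.chart F y))

/-- Normal component `v_F · n_FE` of a tangent field on a face. -/
def normalComp (F : Fin M.nF) (v : VPol 2) (E : Fin M.nE) (y : R2) : ℝ :=
  M.lift F (ev v y) ⬝ᵥ M.normalFE F E

/-- Defining property of the edge scalar trace `γ_E^{k+1}`. -/
def IsEdgeTrace (k : ℕ) (E : Fin M.nE) (qE : PolE ((k : ℤ) - 1)) (qV : Fin M.nV → ℝ)
    (p : PolE ((k : ℤ) + 1)) : Prop :=
  p.1.eval 0 = qV (M.tail E) ∧ p.1.eval (M.len E) = qV (M.head E) ∧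
    M.IsProjE E (PolE ((k : ℤ) - 1)) (fun s => p.1.eval s) qE

/-- The edge scalar trace `γ_E^{k+1}`. -/
def edgeTrace (k : ℕ) (E : Fin M.nE) (qE : PolE ((k : ℤ) - 1)) (qV : Fin M.nV → ℝ) :
    PolE ((k : ℤ) + 1) :=
  theSol (M.IsEdgeTrace k E qE qV)

/-- Defining property of the edge gradient. -/
def IsEdgeGrad (k : ℕ) (E : Fin M.nE) (qE : PolE ((k : ℤ) - 1)) (qV : Fin M.nV → ℝ)
    (g : PolE (k : ℤ)) : Prop :=
  ∀ r : PolE (k : ℤ), M.intE E (fun s => g.1.eval s * r.1.eval s) =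
    - M.intE E (fun s => qE.1.eval s * (Polynomial.derivative r.1).eval s)
    + qV (M.head E) * r.1.eval (M.len E) - qV (M.tail E) * r.1.eval 0

/-- The edge gradient `G_E^k`. -/
def edgeGrad (k : ℕ) (E : Fin M.nE) (qE : PolE ((k : ℤ) - 1)) (qV : Fin M.nV → ℝ) : PolE (k : ℤ) :=
  theSol (M.IsEdgeGrad k E qE qV)

/-- Defining property of the face gradient. -/
def IsFaceGrad (k : ℕ) (F : Fin M.nF) (qF : PolS 2 ((k : ℤ) - 1))
    (qE : Fin M.nE → PolE ((k : ℤ) - 1)) (qV : Fin M.nV → ℝ) (g : PolV 2 (k : ℤ)) : Prop :=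
  ∀ v : PolV 2 (k : ℤ), M.intF F (fun y => ev g.1 y ⬝ᵥ ev v.1 y) =
    - M.intF F (fun y => MvPolynomial.eval y qF.1 * MvPolynomial.eval y (vdiv v.1))
    + M.bdryF F (fun E s => (M.edgeTrace k E (qE E) qV).1.eval s) (M.normalComp F v.1)

/-- The face gradient `G_F^k`. -/
def faceGrad (k : ℕ) (F : Fin M.nF) (qF : PolS 2 ((k : ℤ) - 1))
    (qE : Fin M.nE → PolE ((k : ℤ) - 1)) (qV : Fin M.nV → ℝ) : PolV 2 (k : ℤ) :=
  theSol (M.IsFaceGrad k F qF qE qV)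

/-- Defining property of the face scalar trace. -/
def IsFaceTrace (k : ℕ) (F : Fin M.nF) (qF : PolS 2 ((k : ℤ) - 1))
    (qE : Fin M.nE → PolE ((k : ℤ) - 1)) (qV : Fin M.nV → ℝ) (p : PolS 2 ((k : ℤ) + 1)) : Prop :=
  ∀ v : RolyFc ((k : ℤ) + 2),
    M.intF F (fun y => MvPolynomial.eval y p.1 * MvPolynomial.eval y (vdiv v.1)) =
    - M.intF F (fun y => ev (M.faceGrad k F qF qE qV).1 y ⬝ᵥ ev v.1 y)
    + M.bdryF F (fun E s => (M.edgeTrace k E (qE E) qV).1.eval s) (M.normalComp F v.1)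

/-- The face scalar trace `γ_F^{k+1}`. -/
def faceTrace (k : ℕ) (F : Fin M.nF) (qF : PolS 2 ((k : ℤ) - 1))
    (qE : Fin M.nE → PolE ((k : ℤ) - 1)) (qV : Fin M.nV → ℝ) : PolS 2 ((k : ℤ) + 1) :=
  theSol (M.IsFaceTrace k F qF qE qV)

/-- Defining property of the element gradient. -/
def IsElemGrad (k : ℕ) (T : Fin M.nT) (qT : PolS 3 ((k : ℤ) - 1))
    (qF : Fin M.nF → PolS 2 ((k : ℤ) - 1)) (qE : Fin M.nE → PolE ((k : ℤ) - 1))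
    (qV : Fin M.nV → ℝ) (g : PolV 3 (k : ℤ)) : Prop :=
  ∀ v : PolV 3 (k : ℤ), M.intT T (fun x => ev g.1 x ⬝ᵥ ev v.1 x) =
    - M.intT T (fun x => MvPolynomial.eval x qT.1 * MvPolynomial.eval x (vdiv v.1))
    + M.bdryT T (fun F y x =>
        MvPolynomial.eval y (M.faceTrace k F (qF F) qE qV).1 * (ev v.1 x ⬝ᵥ M.normalF F))

/-- The element gradient `G_T^k`. -/
def elemGrad (k : ℕ) (T : Fin M.nT) (qT : PolS 3 ((k : ℤ) - 1))
    (qF : Fin M.nF → PolS 2 ((k : ℤ) - 1)) (qE : Fin M.nE → PolE ((k : ℤ) - 1))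
    (qV : Fin M.nV → ℝ) : PolV 3 (k : ℤ) :=
  theSol (M.IsElemGrad k T qT qF qE qV)

/-- The global discrete gradient. -/
def gradh (k : ℕ) (q : M.XGrad k) : M.XCurl k where
  vT T := M.vprojT T (RolyT ((k : ℤ) - 1)) (ev (M.elemGrad k T (q.qT T) q.qF q.qE q.qV).1)
  vTc T := M.vprojT T (RolyTc (M.ctrT T) k) (ev (M.elemGrad k T (q.qT T) q.qF q.qE q.qV).1)
  vF F := M.vprojF F (RolyF ((k : ℤ) - 1)) (ev (M.faceGrad k F (q.qF F) q.qE q.qV).1)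
  vFc F := M.vprojF F (RolyFc k) (ev (M.faceGrad k F (q.qF F) q.qE q.qV).1)
  vE E := M.edgeGrad k E (q.qE E) q.qV

/-! # Curl -/

/-- Defining property of the face curl. -/
def IsFaceCurl (k : ℕ) (F : Fin M.nF) (vF : RolyF ((k : ℤ) - 1)) (vE : Fin M.nE → PolE (k : ℤ))
    (c : PolS 2 (k : ℤ)) : Prop :=
  ∀ r : PolS 2 (k : ℤ),
    M.intF F (fun y => MvPolynomial.eval y c.1 * MvPolynomial.eval y r.1) =
    M.intF F (fun y => ev vF.1 y ⬝ᵥ ev (vrot r.1) y)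
    - M.bdryF F (fun E s => (vE E).1.eval s) (fun _ y => MvPolynomial.eval y r.1)

/-- The face curl `C_F^k`. -/
def faceCurl (k : ℕ) (F : Fin M.nF) (vF : RolyF ((k : ℤ) - 1)) (vE : Fin M.nE → PolE (k : ℤ)) :
    PolS 2 (k : ℤ) :=
  theSol (M.IsFaceCurl k F vF vE)

/-- Defining property of the face tangential trace. -/
def IsTanTrace (k : ℕ) (F : Fin M.nF) (vF : RolyF ((k : ℤ) - 1)) (vFc : RolyFc k)
    (vE : Fin M.nE → PolE (k : ℤ)) (u : PolV 2 (k : ℤ)) : Prop :=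
  ∀ r ∈ M.PolF0 F ((k : ℤ) + 1), ∀ w ∈ RolyFc k,
    M.intF F (fun y => ev u.1 y ⬝ᵥ ev (vrot r + w) y) =
    M.intF F (fun y => MvPolynomial.eval y (M.faceCurl k F vF vE).1 * MvPolynomial.eval y r)
    + M.bdryF F (fun E s => (vE E).1.eval s) (fun _ y => MvPolynomial.eval y r)
    + M.intF F (fun y => ev vFc.1 y ⬝ᵥ ev w y)

/-- The face tangential trace `γ_{t,F}^k`. -/
def tanTrace (k : ℕ) (F : Fin M.nF) (vF : RolyF ((k : ℤ) - 1)) (vFc : RolyFc k)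
    (vE : Fin M.nE → PolE (k : ℤ)) : PolV 2 (k : ℤ) :=
  theSol (M.IsTanTrace k F vF vFc vE)

/-- The boundary sum `∑_{F ⊂ ∂T} ω_TF ∫_F γ_{t,F}^k v_F · (w × n_F)`. -/
def tanBdry (k : ℕ) (T : Fin M.nT) (vF : Fin M.nF → RolyF ((k : ℤ) - 1))
    (vFc : Fin M.nF → RolyFc k) (vE : Fin M.nE → PolE (k : ℤ)) (w : VPol 3) : ℝ :=
  M.bdryT T (fun F y x =>
    M.lift F (ev (M.tanTrace k F (vF F) (vFc F) vE).1 y) ⬝ᵥ (ev w x ⨯₃ M.normalF F))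

/-- Defining property of the element curl. -/
def IsElemCurl (k : ℕ) (T : Fin M.nT) (vT : RolyT ((k : ℤ) - 1))
    (vF : Fin M.nF → RolyF ((k : ℤ) - 1)) (vFc : Fin M.nF → RolyFc k)
    (vE : Fin M.nE → PolE (k : ℤ)) (c : PolV 3 (k : ℤ)) : Prop :=
  ∀ w : PolV 3 (k : ℤ), M.intT T (fun x => ev c.1 x ⬝ᵥ ev w.1 x) =
    M.intT T (fun x => ev vT.1 x ⬝ᵥ ev (curl w.1) x) + M.tanBdry k T vF vFc vE w.1

/-- The element curl `C_T^k`. -/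
def elemCurl (k : ℕ) (T : Fin M.nT) (vT : RolyT ((k : ℤ) - 1))
    (vF : Fin M.nF → RolyF ((k : ℤ) - 1)) (vFc : Fin M.nF → RolyFc k)
    (vE : Fin M.nE → PolE (k : ℤ)) : PolV 3 (k : ℤ) :=
  theSol (M.IsElemCurl k T vT vF vFc vE)

/-- Defining property of the vector potential reconstruction on the discrete curl space. -/
def IsPotCurl (k : ℕ) (T : Fin M.nT) (vT : RolyT ((k : ℤ) - 1)) (vTc : RolyTc (M.ctrT T) k)
    (vF : Fin M.nF → RolyF ((k : ℤ) - 1)) (vFc : Fin M.nF → RolyFc k)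
    (vE : Fin M.nE → PolE (k : ℤ)) (p : PolV 3 (k : ℤ)) : Prop :=
  ∀ w ∈ GolyTc (M.ctrT T) ((k : ℤ) + 1), ∀ z ∈ RolyTc (M.ctrT T) k,
    M.intT T (fun x => ev p.1 x ⬝ᵥ ev (curl w + z) x) =
    M.intT T (fun x => ev (M.elemCurl k T vT vF vFc vE).1 x ⬝ᵥ ev w x)
    - M.tanBdry k T vF vFc vE w
    + M.intT T (fun x => ev vTc.1 x ⬝ᵥ ev z x)

/-- The vector potential reconstruction on the discrete curl space. -/
def potCurl (k : ℕ) (T : Fin M.nT) (vT : RolyT ((k : ℤ) - 1)) (vTc : RolyTc (M.ctrT T) k)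
    (vF : Fin M.nF → RolyF ((k : ℤ) - 1)) (vFc : Fin M.nF → RolyFc k)
    (vE : Fin M.nE → PolE (k : ℤ)) : PolV 3 (k : ℤ) :=
  theSol (M.IsPotCurl k T vT vTc vF vFc vE)

/-- The global discrete curl. -/
def curlh (k : ℕ) (v : M.XCurl k) : M.XDiv k where
  wT T := M.vprojT T (GolyT ((k : ℤ) - 1)) (ev (M.elemCurl k T (v.vT T) v.vF v.vFc v.vE).1)
  wTc T := M.vprojT T (GolyTc (M.ctrT T) k) (ev (M.elemCurl k T (v.vT T) v.vF v.vFc v.vE).1)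
  wF F := M.faceCurl k F (v.vF F) v.vE

/-! # Divergence -/

/-- The boundary sum `∑_{F ⊂ ∂T} ω_TF ∫_F w_F r`. -/
def divBdry (k : ℕ) (T : Fin M.nT) (wF : Fin M.nF → PolS 2 (k : ℤ)) (r : SPol 3) : ℝ :=
  M.bdryT T (fun F y x => MvPolynomial.eval y (wF F).1 * MvPolynomial.eval x r)

/-- Defining property of the element divergence. -/
def IsElemDiv (k : ℕ) (T : Fin M.nT) (wT : GolyT ((k : ℤ) - 1))
    (wF : Fin M.nF → PolS 2 (k : ℤ)) (d : PolS 3 (k : ℤ)) : Prop :=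
  ∀ r : PolS 3 (k : ℤ),
    M.intT T (fun x => MvPolynomial.eval x d.1 * MvPolynomial.eval x r.1) =
    - M.intT T (fun x => ev wT.1 x ⬝ᵥ ev (grad 3 r.1) x) + M.divBdry k T wF r.1

/-- The element divergence `D_T^k`. -/
def elemDiv (k : ℕ) (T : Fin M.nT) (wT : GolyT ((k : ℤ) - 1))
    (wF : Fin M.nF → PolS 2 (k : ℤ)) : PolS 3 (k : ℤ) :=
  theSol (M.IsElemDiv k T wT wF)

/-- Defining property of the vector potential reconstruction on the discrete divergence space. -/
def IsPotDiv (k : ℕ) (T : Fin M.nT) (wT : GolyT ((k : ℤ) - 1)) (wTc : GolyTc (M.ctrT T) k)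
    (wF : Fin M.nF → PolS 2 (k : ℤ)) (p : PolV 3 (k : ℤ)) : Prop :=
  ∀ r ∈ M.PolT0 T ((k : ℤ) + 1), ∀ z ∈ GolyTc (M.ctrT T) k,
    M.intT T (fun x => ev p.1 x ⬝ᵥ ev (grad 3 r + z) x) =
    - M.intT T (fun x => MvPolynomial.eval x (M.elemDiv k T wT wF).1 * MvPolynomial.eval x r)
    + M.divBdry k T wF r
    + M.intT T (fun x => ev wTc.1 x ⬝ᵥ ev z x)

/-- The vector potential reconstruction on the discrete divergence space. -/
def potDiv (k : ℕ) (T : Fin M.nT) (wT : GolyT ((k : ℤ) - 1)) (wTc : GolyTc (M.ctrT T) k)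
    (wF : Fin M.nF → PolS 2 (k : ℤ)) : PolV 3 (k : ℤ) :=
  theSol (M.IsPotDiv k T wT wTc wF)

/-- The global discrete divergence. -/
def divh (k : ℕ) (w : M.XDiv k) : M.PolTh k := fun T => M.elemDiv k T (w.wT T) w.wF

/-! # Interpolator -/

/-- The interpolator on the discrete `H¹` space. -/
def interp (k : ℕ) (q : R3 → ℝ) : M.XGrad k where
  qT T := M.projT T (PolS 3 ((k : ℤ) - 1)) q
  qF F := M.projF F (PolS 2 ((k : ℤ) - 1)) (fun y => q (M.chart F y))
  qE E := M.projE E (PolE ((k : ℤ) - 1)) (fun s => q (M.edgePt E s))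
  qV V := q (M.pos V)

/-! # Extensions -/

/-- Defining property of the edge component of the extension on the discrete `H¹` space. -/
def IsExtPolE (k : ℕ) (q : M.XGrad 0) (E : Fin M.nE) (p : PolE ((k : ℤ) - 1)) : Prop :=
  ∀ r : PolE (k : ℤ),
    M.intE E (fun s => p.1.eval s * (Polynomial.derivative r.1).eval s) =
    - M.intE E (fun s => (M.edgeGrad 0 E (q.qE E) q.qV).1.eval s * r.1.eval s)
    + q.qV (M.head E) * r.1.eval (M.len E) - q.qV (M.tail E) * r.1.eval 0

/-- Edge component of the extension on the discrete `H¹` space. -/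
def extPolE (k : ℕ) (q : M.XGrad 0) (E : Fin M.nE) : PolE ((k : ℤ) - 1) :=
  theSol (M.IsExtPolE k q E)

/-- Defining property of the face component of the extension on the discrete `H¹` space. -/
def IsExtPolF (k : ℕ) (q : M.XGrad 0) (F : Fin M.nF) (p : PolS 2 ((k : ℤ) - 1)) : Prop :=
  ∀ v : RolyFc k,
    M.intF F (fun y => MvPolynomial.eval y p.1 * MvPolynomial.eval y (vdiv v.1)) =
    - M.intF F (fun y => ev (M.faceGrad 0 F (q.qF F) q.qE q.qV).1 y ⬝ᵥ ev v.1 y)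
    + M.bdryF F (fun E s => (M.edgeTrace k E (M.extPolE k q E) q.qV).1.eval s)
        (M.normalComp F v.1)

/-- Face component of the extension on the discrete `H¹` space. -/
def extPolF (k : ℕ) (q : M.XGrad 0) (F : Fin M.nF) : PolS 2 ((k : ℤ) - 1) :=
  theSol (M.IsExtPolF k q F)

/-- Defining property of the element component of the extension on the discrete `H¹` space. -/
def IsExtPolT (k : ℕ) (q : M.XGrad 0) (T : Fin M.nT) (p : PolS 3 ((k : ℤ) - 1)) : Prop :=
  ∀ v : RolyTc (M.ctrT T) k,
    M.intT T (fun x => MvPolynomial.eval x p.1 * MvPolynomial.eval x (vdiv v.1)) =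
    - M.intT T (fun x => ev (M.elemGrad 0 T (q.qT T) q.qF q.qE q.qV).1 x ⬝ᵥ ev v.1 x)
    + M.bdryT T (fun F y x =>
        MvPolynomial.eval y (M.faceTrace k F (M.extPolF k q F) (M.extPolE k q) q.qV).1
          * (ev v.1 x ⬝ᵥ M.normalF F))

/-- Element component of the extension on the discrete `H¹` space. -/
def extPolT (k : ℕ) (q : M.XGrad 0) (T : Fin M.nT) : PolS 3 ((k : ℤ) - 1) :=
  theSol (M.IsExtPolT k q T)

/-- The extension of the discrete `H¹` space. -/
def extGrad (k : ℕ) (q : M.XGrad 0) : M.XGrad k where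
  qT := M.extPolT k q
  qF := M.extPolF k q
  qE := M.extPolE k q
  qV := q.qV

/-- Inclusion of the edge components of the lowest-order discrete curl space. -/
def inclE (k : ℕ) (v : M.XCurl 0) (E : Fin M.nE) : PolE (k : ℤ) :=
  Submodule.inclusion (PolE_mono (by simp)) (v.vE E)

/-- Defining property of the face component in `R^{k-1}(F)` of the extension on the discrete curl
space. -/
def IsExtRolyF (k : ℕ) (v : M.XCurl 0) (F : Fin M.nF) (u : RolyF ((k : ℤ) - 1)) : Prop :=
  ∀ r : PolS 2 (k : ℤ),
    M.intF F (fun y => ev u.1 y ⬝ᵥ ev (vrot r.1) y) =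
    M.intF F (fun y =>
      MvPolynomial.eval y (M.faceCurl 0 F (v.vF F) v.vE).1 * MvPolynomial.eval y r.1)
    + M.bdryF F (fun E s => (v.vE E).1.eval s) (fun _ y => MvPolynomial.eval y r.1)

/-- Face component in `R^{k-1}(F)` of the extension on the discrete curl space. -/
def extRolyF (k : ℕ) (v : M.XCurl 0) (F : Fin M.nF) : RolyF ((k : ℤ) - 1) :=
  theSol (M.IsExtRolyF k v F)

/-- Face component in `R^{c,k}(F)` of the extension on the discrete curl space. -/
def extRolyFc (k : ℕ) (v : M.XCurl 0) (F : Fin M.nF) : RolyFc k :=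
  M.vprojF F (RolyFc k) (ev (M.tanTrace 0 F (v.vF F) (v.vFc F) v.vE).1)

/-- Defining property of the element component in `R^{k-1}(T)` of the extension on the discrete
curl space. -/
def IsExtRolyT (k : ℕ) (v : M.XCurl 0) (T : Fin M.nT) (u : RolyT ((k : ℤ) - 1)) : Prop :=
  ∀ w : GolyTc (M.ctrT T) k,
    M.intT T (fun x => ev u.1 x ⬝ᵥ ev (curl w.1) x) =
    M.intT T (fun x => ev (M.elemCurl 0 T (v.vT T) v.vF v.vFc v.vE).1 x ⬝ᵥ ev w.1 x)
    - M.tanBdry k T (M.extRolyF k v) (M.extRolyFc k v) (M.inclE k v) w.1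

/-- Element component in `R^{k-1}(T)` of the extension on the discrete curl space. -/
def extRolyT (k : ℕ) (v : M.XCurl 0) (T : Fin M.nT) : RolyT ((k : ℤ) - 1) :=
  theSol (M.IsExtRolyT k v T)

/-- Element component in `R^{c,k}(T)` of the extension on the discrete curl space. -/
def extRolyTc (k : ℕ) (v : M.XCurl 0) (T : Fin M.nT) : RolyTc (M.ctrT T) k :=
  M.vprojT T (RolyTc (M.ctrT T) k) (ev (M.potCurl 0 T (v.vT T) (v.vTc T) v.vF v.vFc v.vE).1)

/-- The extension of the discrete curl space. -/
def extCurl (k : ℕ) (v : M.XCurl 0) : M.XCurl k where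
  vT := M.extRolyT k v
  vTc := M.extRolyTc k v
  vF := M.extRolyF k v
  vFc := M.extRolyFc k v
  vE := M.inclE k v

/-- Defining property of the element component in `G^{k-1}(T)` of the extension on the discrete
divergence space. -/
def IsExtGolyT (k : ℕ) (w : M.XDiv 0) (T : Fin M.nT) (u : GolyT ((k : ℤ) - 1)) : Prop :=
  ∀ r : PolS 3 (k : ℤ),
    M.intT T (fun x => ev u.1 x ⬝ᵥ ev (grad 3 r.1) x) =
    - M.intT T (fun x =>
        MvPolynomial.eval x (M.elemDiv 0 T (w.wT T) w.wF).1 * MvPolynomial.eval x r.1)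
    + M.divBdry 0 T w.wF r.1

/-- Element component in `G^{k-1}(T)` of the extension on the discrete divergence space. -/
def extGolyT (k : ℕ) (w : M.XDiv 0) (T : Fin M.nT) : GolyT ((k : ℤ) - 1) :=
  theSol (M.IsExtGolyT k w T)

/-- Element component in `G^{c,k}(T)` of the extension on the discrete divergence space. -/
def extGolyTc (k : ℕ) (w : M.XDiv 0) (T : Fin M.nT) : GolyTc (M.ctrT T) k :=
  M.vprojT T (GolyTc (M.ctrT T) k) (ev (M.potDiv 0 T (w.wT T) (w.wTc T) w.wF).1)

/-- The extension of the discrete divergence space. -/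
def extDiv (k : ℕ) (w : M.XDiv 0) : M.XDiv k where
  wT := M.extGolyT k w
  wTc := M.extGolyTc k w
  wF F := Submodule.inclusion (PolS_mono 2 (by simp)) (w.wF F)

/-- The natural inclusion of broken constants into broken polynomials of degree at most `k`. -/
def inclT (k : ℕ) (r : M.PolTh 0) : M.PolTh k := fun T =>
  Submodule.inclusion (PolS_mono 3 (by simp)) (r T)

/-! # Well-posedness -/

/-- The variational problems that define the projectors and the operators of the complex of
degree `k` have exactly one solution. -/
structure OperatorsWellPosed (k : ℕ) : Prop where
  projT : ∀ T (f : R3 → ℝ), Continuous f → ∃! p, M.IsProjT T (PolS 3 ((k : ℤ) - 1)) f p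
  projF : ∀ F (f : R2 → ℝ), Continuous f → ∃! p, M.IsProjF F (PolS 2 ((k : ℤ) - 1)) f p
  projE : ∀ E (f : ℝ → ℝ), Continuous f → ∃! p, M.IsProjE E (PolE ((k : ℤ) - 1)) f p
  vprojRF : ∀ F (f : VPol 2), ∃! p, M.IsVProjF F (RolyF ((k : ℤ) - 1)) (ev f) p
  vprojRFc : ∀ F (f : VPol 2), ∃! p, M.IsVProjF F (RolyFc k) (ev f) p
  vprojRT : ∀ T (f : VPol 3), ∃! p, M.IsVProjT T (RolyT ((k : ℤ) - 1)) (ev f) p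
  vprojRTc : ∀ T (f : VPol 3), ∃! p, M.IsVProjT T (RolyTc (M.ctrT T) k) (ev f) p
  vprojGT : ∀ T (f : VPol 3), ∃! p, M.IsVProjT T (GolyT ((k : ℤ) - 1)) (ev f) p
  vprojGTc : ∀ T (f : VPol 3), ∃! p, M.IsVProjT T (GolyTc (M.ctrT T) k) (ev f) p
  edgeTrace : ∀ E qE qV, ∃! p, M.IsEdgeTrace k E qE qV p
  edgeGrad : ∀ E qE qV, ∃! g, M.IsEdgeGrad k E qE qV g
  faceGrad : ∀ F qF qE qV, ∃! g, M.IsFaceGrad k F qF qE qV g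
  faceTrace : ∀ F qF qE qV, ∃! p, M.IsFaceTrace k F qF qE qV p
  elemGrad : ∀ T qT qF qE qV, ∃! g, M.IsElemGrad k T qT qF qE qV g
  faceCurl : ∀ F vF vE, ∃! c, M.IsFaceCurl k F vF vE c
  tanTrace : ∀ F vF vFc vE, ∃! u, M.IsTanTrace k F vF vFc vE u
  elemCurl : ∀ T vT vF vFc vE, ∃! c, M.IsElemCurl k T vT vF vFc vE c
  elemDiv : ∀ T wT wF, ∃! d, M.IsElemDiv k T wT wF d

/-- The variational problems that define the extensions to degree `k` (including the lowest-order
potentials that enter them) have exactly one solution. -/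
structure ExtensionsWellPosed (k : ℕ) : Prop where
  potCurl : ∀ T vT vTc vF vFc vE, ∃! p, M.IsPotCurl 0 T vT vTc vF vFc vE p
  potDiv : ∀ T wT wTc wF, ∃! p, M.IsPotDiv 0 T wT wTc wF p
  extPolE : ∀ q E, ∃! p, M.IsExtPolE k q E p
  extPolF : ∀ q F, ∃! p, M.IsExtPolF k q F p
  extPolT : ∀ q T, ∃! p, M.IsExtPolT k q T p
  extRolyF : ∀ v F, ∃! u, M.IsExtRolyF k v F u
  extRolyT : ∀ v T, ∃! u, M.IsExtRolyT k v T u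
  extGolyT : ∀ w T, ∃! u, M.IsExtGolyT k w T u

end

end MeshData

end

end DDR

/-! Every component of an extension is defined by an integration by parts in which a degree-0
operator stands where the degree-`k` operator would stand. Hence a degree-`k` operator applied to an
extension has, on the test space of that definition, the moments of the degree-0 operator. This
alone gives the divergence identity, the edge part of the gradient identity and the face part of the
curl identity.

The other components use that the discrete sequence is a complex at each degree. Tested against
rotationals, curls or gradients, the interior unknown drops out (`vdiv_vrot`, `vdiv_curl`,
`curl_grad`) and only boundary terms remain. Integrating these by parts again produces vertex or
edge terms whose oriented sums vanish (`sum_vertices`, `sum_edges`). So curls of gradients and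
divergences of curls are zero (`faceCurl_gradh`, `elemCurl_gradh`, `elemDiv_curlh`), while traces
and potentials of discrete gradients and curls return the full operators (`tanTrace_gradh`,
`potCurl_gradh`, `potDiv_curlh`). Substituted at degree 0 in the extensions, these facts leave the
degree-`k` identities. For constants, `green` and `gauss` show that all gradients vanish.

Well-posedness rests on a Riesz lemma (`existsUnique_riesz`) with test functions parametrised by a
linear map `A`: the functional must vanish on the kernel of `A`. Kernels and ranges come from the
Koszul homotopy formulas, in which a positive number plus the Euler operator `E = (x - c) · ∇` is
bijective on polynomials of bounded degree. Where constants lie in the kernel, the degree-0 equation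
tested with a constant gives the compatibility.

The geometric input is the divergence theorem for bounded open sets whose frontier is covered by
flat pieces, proved by slicing along the coordinate axes. The vanishing of the boundary of a
boundary is deduced from it by testing with polynomials: interpolation at the vertices, and
Weierstrass approximation of a bump on one edge. No combinatorial analysis of how faces meet is
needed. -/

namespace DDR

/-! ### The fundamental theorem of calculus on open sets of the line with finite frontier -/

open Filter Topology Set

/-- Indicator of an open set of the line minus the signed count of the boundary points to the right
of the current point. -/
noncomputable def signedDefect {ι : Type*} (U : Set ℝ) (s : Finset ι) (h σ : ι → ℝ) (t : ℝ) : ℝ :=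
  U.indicator 1 t - ∑ j ∈ s, σ j * (if t < h j then 1 else 0)

theorem eventually_lt_iff_lt {a t : ℝ} (h : t ≠ a) : ∀ᶠ y in 𝓝 t, (y < a ↔ t < a) := by
  rcases lt_or_gt_of_ne h with h | h
  · filter_upwards [Iio_mem_nhds h] with y hy
    exact ⟨fun _ => h, fun _ => hy⟩
  · filter_upwards [Ioi_mem_nhds h] with y hy
    exact ⟨fun h' => absurd h' (not_lt.2 (le_of_lt hy)), fun h' => absurd h' (not_lt.2 h.le)⟩

theorem eventually_mem_iff_of_notMem_frontier {X : Type*} [TopologicalSpace X] {U : Set X} {t : X}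
    (ht : t ∉ frontier U) : ∀ᶠ y in 𝓝 t, (y ∈ U ↔ t ∈ U) := by
  by_cases h : t ∈ closure U
  · have h1 : t ∈ interior U := by
      by_contra h2
      exact ht ⟨h, h2⟩
    filter_upwards [isOpen_interior.mem_nhds h1] with y hy
    exact ⟨fun _ => interior_subset h1, fun _ => interior_subset hy⟩
  · filter_upwards [isClosed_closure.isOpen_compl.mem_nhds h] with y hy
    exact ⟨fun h' => absurd (subset_closure h') hy, fun h' => absurd (subset_closure h') h⟩

theorem signedDefect_eventually_eq {ι : Type*} {U : Set ℝ} {s : Finset ι} {h : ι → ℝ} (σ : ι → ℝ)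
    (hfr : frontier U ⊆ h '' s) {t : ℝ} (ht : t ∉ h '' s) :
    ∀ᶠ y in 𝓝 t, signedDefect U s h σ y = signedDefect U s h σ t := by
  classical
  have h1 : ∀ᶠ y in 𝓝 t, ∀ j ∈ s, (y < h j ↔ t < h j) :=
    (Finset.eventually_all s).2 fun j hj =>
      eventually_lt_iff_lt fun h' => ht ⟨j, hj, h'.symm⟩
  filter_upwards [h1, eventually_mem_iff_of_notMem_frontier fun h' => ht (hfr h')] with y hy hU
  unfold signedDefect
  congr 1
  · simp only [indicator, hU, Pi.one_apply]
  · exact Finset.sum_congr rfl fun j hj => by simp only [hy j hj]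

/-- Crossing `h j` upwards leaves `U` if `σ j = 1` and enters it if `σ j = -1`. The indicator
therefore jumps by `-σ j`, exactly as the signed count does, and the two jumps cancel. -/
theorem signedDefect_punctured {ι : Type*} {U : Set ℝ} {s : Finset ι} {h σ : ι → ℝ}
    (hinj : InjOn h s)
    (hσ : ∀ j ∈ s, σ j = 1 ∨ σ j = -1)
    (hside : ∀ j ∈ s, ∃ ε > 0, ∀ t ∈ Ioo (0 : ℝ) ε, h j + σ j * t ∉ U ∧ h j - σ j * t ∈ U)
    {j : ι} (hj : j ∈ s) :
    ∃ c, ∀ᶠ y in 𝓝[≠] (h j), signedDefect U s h σ y = c := by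
  classical
  obtain ⟨ε, hε, hs⟩ := hside j hj
  have h1 : ∀ᶠ y in 𝓝 (h j), ∀ i ∈ s.erase j, (y < h i ↔ h j < h i) :=
    (Finset.eventually_all _).2 fun i hi =>
      eventually_lt_iff_lt fun h' =>
        (Finset.mem_erase.1 hi).1 (hinj (Finset.mem_erase.1 hi).2 hj h'.symm)
  -- The indicator minus the term of index `j` is `1 - 1` on the left and `0 - 0` on the right if `σ
  -- j = 1`, and `0 + 1` and `1 - 0` if `σ j = -1`.
  refine ⟨(if σ j = 1 then 0 else 1) - ∑ i ∈ s.erase j, σ i * (if h j < h i then 1 else 0), ?_⟩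
  have h2 : ∀ᶠ y in 𝓝[≠] (h j), y ∈ Ioo (h j - ε) (h j + ε) :=
    nhdsWithin_le_nhds (Ioo_mem_nhds (by linarith) (by linarith))
  filter_upwards [nhdsWithin_le_nhds h1, h2, self_mem_nhdsWithin] with y hy hyε hne
  unfold signedDefect
  rw [← Finset.add_sum_erase s _ hj, ← sub_sub]
  congr 1
  · rcases lt_or_gt_of_ne hne with hlt | hgt
    · have := hs (h j - y) ⟨by linarith, by linarith [hyε.1]⟩
      rcases hσ j hj with h3 | h3
      · simp only [h3, one_mul, sub_sub_cancel] at this ⊢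
        simp [hlt, this.2]
      · simp only [h3] at this ⊢
        have h4 : y ∉ U := by
          rw [show y = h j + -1 * (h j - y) by ring]
          exact this.1
        norm_num [hlt, h4]
    · have := hs (y - h j) ⟨by linarith, by linarith [hyε.2]⟩
      rcases hσ j hj with h3 | h3
      · simp only [h3, one_mul, add_sub_cancel] at this ⊢
        simp [not_lt.2 hgt.le, this.1]
      · simp only [h3] at this ⊢
        have h4 : y ∈ U := by
          rw [show y = h j - -1 * (y - h j) by ring]
          exact this.2
        norm_num [not_lt.2 (le_of_lt hgt), h4]
  · exact Finset.sum_congr rfl fun i hi => by simp only [hy i hi]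

/-- The punctured limits form a locally constant function on the connected line, and this function
is zero far to the right. The points `h j` are excluded, since the defect itself may take another
value there. -/
theorem signedDefect_eq_zero {ι : Type*} {U : Set ℝ} (hU : Bornology.IsBounded U) {s : Finset ι}
    {h σ : ι → ℝ} (hinj : InjOn h s) (hfr : frontier U ⊆ h '' s)
    (hσ : ∀ j ∈ s, σ j = 1 ∨ σ j = -1)
    (hside : ∀ j ∈ s, ∃ ε > 0, ∀ t ∈ Ioo (0 : ℝ) ε, h j + σ j * t ∉ U ∧ h j - σ j * t ∈ U)
    {t : ℝ} (ht : t ∉ h '' s) : signedDefect U s h σ t = 0 := by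
  have key : ∀ t, ∃ c, ∀ᶠ y in 𝓝[≠] t, signedDefect U s h σ y = c := by
    intro t
    by_cases ht : t ∈ h '' s
    · obtain ⟨j, hj, rfl⟩ := ht
      exact signedDefect_punctured hinj hσ hside hj
    · exact ⟨_, nhdsWithin_le_nhds (signedDefect_eventually_eq σ hfr ht)⟩
  choose c hc using key
  have hloc : IsLocallyConstant c := by
    rw [IsLocallyConstant.iff_eventually_eq]
    intro t
    have := hc t
    rw [eventually_nhdsWithin_iff, ← eventually_eventually_nhds] at this
    filter_upwards [this] with y hy
    by_cases hyt : y = t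
    · rw [hyt]
    · have h1 : ∀ᶠ z in 𝓝[≠] y, signedDefect U s h σ z = c t := by
        filter_upwards [nhdsWithin_le_nhds hy, nhdsWithin_le_nhds (isOpen_ne.mem_nhds hyt)]
          with z hz hz2 using hz hz2
      obtain ⟨z, h2, h3⟩ := ((hc y).and h1).exists
      exact h2.symm.trans h3
  obtain ⟨R, hR⟩ := (hU.union (s.finite_toSet.image h).isBounded).subset_closedBall 0
  have hfar : c (R + 1) = 0 := by
    obtain ⟨z, h2, h3⟩ := ((hc (R + 1)).and (nhdsWithin_le_nhds (Ioi_mem_nhds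
      (show R < R + 1 by linarith)))).exists
    have hz : ∀ x ∈ U ∪ h '' s, x < z := fun x hx => by
      have := hR hx
      rw [Metric.mem_closedBall, dist_zero_right, Real.norm_eq_abs] at this
      exact lt_of_le_of_lt ((le_abs_self x).trans this) h3
    rw [← h2]
    have h4 : z ∉ U := fun hzU => lt_irrefl _ (hz z (Or.inl hzU))
    unfold signedDefect
    rw [indicator_of_notMem h4, Finset.sum_eq_zero, sub_zero]
    intro j hj
    simp [not_lt.2 (hz (h j) (Or.inr ⟨j, hj, rfl⟩)).le]
  obtain ⟨z, h2, h3⟩ := ((hc t).and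
    (nhdsWithin_le_nhds (signedDefect_eventually_eq σ hfr ht))).exists
  rw [← h3, h2, hloc.apply_eq_of_isPreconnected isPreconnected_univ (mem_univ t)
    (mem_univ (R + 1)), hfar]

/-- Fundamental theorem of calculus on a bounded open set of the line with finite frontier. -/
theorem integral_deriv_of_frontier {ι : Type*} {U : Set ℝ} (hUo : IsOpen U)
    (hU : Bornology.IsBounded U) {s : Finset ι}
    {h σ : ι → ℝ} (hinj : InjOn h s) (hfr : frontier U ⊆ h '' s)
    (hσ : ∀ j ∈ s, σ j = 1 ∨ σ j = -1)
    (hside : ∀ j ∈ s, ∃ ε > 0, ∀ t ∈ Ioo (0 : ℝ) ε, h j + σ j * t ∉ U ∧ h j - σ j * t ∈ U)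
    {g g' : ℝ → ℝ} (hg : ∀ t, HasDerivAt g (g' t) t) (hg' : Continuous g') :
    ∫ t in U, g' t = ∑ j ∈ s, σ j * g (h j) := by
  obtain ⟨R, hR⟩ := (hU.union (s.finite_toSet.image h).isBounded).subset_closedBall 0
  set a := -(|R| + 1)
  set b := |R| + 1
  have hab : ∀ x ∈ U ∪ h '' s, x ∈ Ioo a b := fun x hx => by
    have := hR hx
    rw [Metric.mem_closedBall, dist_zero_right, Real.norm_eq_abs] at this
    have h2 := le_abs_self R
    rw [abs_le] at this
    constructor <;> simp only [a, b] <;> linarith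
  have haU : a ∉ U ∪ h '' s := fun h' => lt_irrefl _ (hab a h').1
  have hψ : ∀ t, t ∉ h '' s → U.indicator (1 : ℝ → ℝ) t =
      ∑ j ∈ s, σ j * (if t < h j then 1 else 0) := fun t ht =>
    sub_eq_zero.1 (signedDefect_eq_zero hU hinj hfr hσ hside ht)
  -- At `a`, to the left of everything, the defect is `-∑ σ j`. This balance of signs removes the
  -- terms `g a` at the end.
  have hsum : ∑ j ∈ s, σ j = 0 := by
    have := hψ a (fun h' => haU (Or.inr h'))
    rw [indicator_of_notMem (fun h' => haU (Or.inl h'))] at this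
    rw [this]
    refine Finset.sum_congr rfl fun j hj => ?_
    rw [if_pos (hab _ (Or.inr ⟨j, hj, rfl⟩)).1, mul_one]
  have hae : ∀ᵐ t, t ∉ h '' s := by
    rw [ae_iff]
    simpa only [not_not, ofPred_mem_eq] using (s.finite_toSet.image h).measure_zero volume
  have hint : ∀ S : Set ℝ, MeasurableSet S → Bornology.IsBounded S → IntegrableOn g' S :=
    fun S hS hSb => by
      obtain ⟨r, hr⟩ := hSb.subset_closedBall 0
      exact (hg'.continuousOn.integrableOn_compact (isCompact_closedBall 0 r)).mono_set hr
  calc ∫ t in U, g' t = ∫ t, U.indicator g' t := (integral_indicator hUo.measurableSet).symm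
    -- Vanishing of the defect expresses the indicator of `U`, almost everywhere, as the signed sum
    -- of the indicators of the intervals `(a, h j)`.
    _ = ∫ t, ∑ j ∈ s, σ j * (Ioo a (h j)).indicator g' t := by
        refine integral_congr_ae ?_
        filter_upwards [hae, (measure_eq_zero_iff_ae_notMem.1 (measure_singleton a) :
          ∀ᵐ t ∂volume, t ∉ ({a} : Set ℝ))] with t ht hta
        rcases lt_or_gt_of_ne (show t ≠ a from hta) with hlt | hgt
        · rw [indicator_of_notMem (fun h' => absurd (hab t (Or.inl h')).1 (not_lt.2 hlt.le))]
          refine (Finset.sum_eq_zero fun j hj => ?_).symm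
          rw [indicator_of_notMem (fun h' => absurd h'.1 (not_lt.2 hlt.le)), mul_zero]
        · have : U.indicator g' t = U.indicator (1 : ℝ → ℝ) t * g' t := by
            by_cases h' : t ∈ U <;> simp [h']
          rw [this, hψ t ht, Finset.sum_mul]
          refine Finset.sum_congr rfl fun j hj => ?_
          by_cases h' : t < h j
          · simp [h', show t ∈ Ioo a (h j) from ⟨hgt, h'⟩]
          · simp [h']
    _ = ∑ j ∈ s, σ j * ∫ t in Ioo a (h j), g' t := by
        rw [integral_finsetSum]
        · refine Finset.sum_congr rfl fun j _ => ?_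
          rw [integral_const_mul, integral_indicator measurableSet_Ioo]
        · intro j _
          exact ((hint _ measurableSet_Ioo (Metric.isBounded_Ioo _ _)).integrable_indicator
            measurableSet_Ioo).const_mul _
    _ = ∑ j ∈ s, σ j * (g (h j) - g a) := by
        refine Finset.sum_congr rfl fun j hj => ?_
        rw [← integral_Ioc_eq_integral_Ioo,
          ← intervalIntegral.integral_of_le (hab _ (Or.inr ⟨j, hj, rfl⟩)).1.le,
          intervalIntegral.integral_eq_sub_of_hasDerivAt (fun t _ => hg t)
            (hg'.intervalIntegrable _ _)]
    _ = _ := by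
        simp only [mul_sub, Finset.sum_sub_distrib]
        rw [← Finset.sum_mul, hsum, zero_mul, sub_zero]

end DDR

/-! ### Flat pieces of hypersurfaces and their projections along coordinate axes -/

namespace DDR

open Filter Topology Set

/-- Off the frontier, the space is the disjoint union of the open sets `interior U` and `(closure
U)ᶜ`, so a preconnected set lies in one of them. -/
theorem mem_iff_mem_of_disjoint_frontier {X : Type*} [TopologicalSpace X] {U s : Set X}
    (hs : IsPreconnected s) (h : Disjoint s (frontier U)) {x y : X} (hx : x ∈ s) (hy : y ∈ s) :
    x ∈ U ↔ y ∈ U := by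
  suffices H : ∀ x ∈ s, ∀ y ∈ s, x ∈ U → y ∈ U from ⟨H x hx y hy, H y hy x hx⟩
  intro x hx y hy hxU
  have hint : ∀ z ∈ s, z ∈ U → z ∈ interior U := fun z hz hzU => by
    by_contra hn
    exact disjoint_left.1 h hz ⟨subset_closure hzU, hn⟩
  have hcov : s ⊆ interior U ∪ (closure U)ᶜ := fun z hz => by
    by_cases hzU : z ∈ closure U
    · left
      by_contra hn
      exact disjoint_left.1 h hz ⟨hzU, hn⟩
    · exact Or.inr hzU
  have hempty : s ∩ (interior U ∩ (closure U)ᶜ) = ∅ := by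
    ext z
    simp only [mem_inter_iff, mem_compl_iff, mem_empty_iff_false, iff_false]
    rintro ⟨_, h1, h2⟩
    exact h2 (subset_closure (interior_subset h1))
  rcases isPreconnected_iff_subset_of_disjoint.1 hs _ _ isOpen_interior
    isClosed_closure.isOpen_compl hcov hempty with h1 | h1
  · exact interior_subset (h1 hy)
  · exact absurd (subset_closure hxU) (h1 hx)

/-- An oriented flat hypersurface piece of `ℝⁿ⁺¹`, parametrised over `ℝⁿ`. -/
structure FlatPiece (n : ℕ) where
  base : Fin (n + 1) → ℝ
  mat : Matrix (Fin (n + 1)) (Fin n) ℝ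
  nrm : Fin (n + 1) → ℝ
  dom : Set (Fin n → ℝ)
  sgn : ℝ
  -- Up to sign, the maximal minors of the parametrisation are the components of the unit normal, so
  -- `|nrm i|` is the Jacobian of the projection along axis `i`.
  det_eq : ∀ i, |(mat.submatrix (Fin.succAbove i) id).det| = |nrm i|
  orth : nrm ᵥ* mat = 0
  unit : nrm ⬝ᵥ nrm = 1
  bounded : Bornology.IsBounded dom
  measurable : MeasurableSet dom
  null : volume (frontier dom) = 0
  sign : sgn = 1 ∨ sgn = -1

namespace FlatPiece

variable {n : ℕ} (P : FlatPiece n)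

/-- The affine parametrisation. -/
def param (y : Fin n → ℝ) : Fin (n + 1) → ℝ := P.base + P.mat *ᵥ y

/-- The parametrisation followed by the projection along a coordinate axis. -/
def proj (i : Fin (n + 1)) (y : Fin n → ℝ) : Fin n → ℝ := fun a => P.param y (i.succAbove a)

/-- The `i`-th coordinate of the point of the hyperplane above a point of the coordinate
hyperplane. -/
noncomputable def height (i : Fin (n + 1)) (z : Fin n → ℝ) : ℝ :=
  P.base i - (∑ a, P.nrm (i.succAbove a) * (z a - P.base (i.succAbove a))) / P.nrm i

theorem continuous_param : Continuous P.param := by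
  unfold param; fun_prop

theorem continuous_height (i : Fin (n + 1)) : Continuous (P.height i) := by
  unfold height; fun_prop

theorem nrm_dot (y : Fin n → ℝ) : P.nrm ⬝ᵥ (P.param y - P.base) = 0 := by
  rw [param, add_sub_cancel_left, Matrix.dotProduct_mulVec, P.orth, zero_dotProduct]

theorem height_proj {i : Fin (n + 1)} (hi : P.nrm i ≠ 0) (y : Fin n → ℝ) :
    P.height i (P.proj i y) = P.param y i := by
  have h := P.nrm_dot y
  rw [dotProduct, Fin.sum_univ_succAbove _ i] at h
  have h2 : P.nrm i * (P.param y i - P.base i) =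
    -∑ a, P.nrm (i.succAbove a) * (P.proj i y a - P.base (i.succAbove a)) := by
    simp only [Pi.sub_apply] at h
    simp only [proj]
    linarith
  rw [height, sub_eq_iff_eq_add, ← sub_eq_iff_eq_add', eq_div_iff hi]
  linarith

theorem insertNth_height_proj {i : Fin (n + 1)} (hi : P.nrm i ≠ 0) (y : Fin n → ℝ) :
    (i.insertNth (P.height i (P.proj i y)) (P.proj i y) : Fin (n + 1) → ℝ) = P.param y := by
  rw [Fin.insertNth_eq_iff]
  exact ⟨P.height_proj hi y, rfl⟩

theorem proj_eq (i : Fin (n + 1)) (y : Fin n → ℝ) :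
    P.proj i y = (fun a => P.base (i.succAbove a)) +
      (P.mat.submatrix i.succAbove id).toLin' y := by
  ext a
  simp [proj, param, Matrix.mulVec, dotProduct]

-- The case `nrm i = 0` is included: the whole hyperplane then projects onto a null set, which
-- allows pieces parallel to the axis to be discarded.
open scoped Pointwise in
theorem volume_proj_image (i : Fin (n + 1)) (s : Set (Fin n → ℝ)) :
    volume (P.proj i '' s) = ENNReal.ofReal |P.nrm i| * volume s := by
  have : P.proj i '' s = (fun a => P.base (i.succAbove a)) +ᵥ
      ((P.mat.submatrix i.succAbove id).toLin' '' s) := by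
    rw [← image_vadd, image_image]
    exact image_congr fun y _ => P.proj_eq i y
  rw [this, measure_vadd, Measure.addHaar_image_linearMap, LinearMap.det_toLin', P.det_eq]

theorem proj_injective {i : Fin (n + 1)} (hi : P.nrm i ≠ 0) : Function.Injective (P.proj i) := by
  intro y y' h
  rw [proj_eq, proj_eq, add_right_inj] at h
  have hdet : IsUnit (P.mat.submatrix i.succAbove id).det := by
    rw [isUnit_iff_ne_zero, ← abs_ne_zero, P.det_eq]
    exact abs_ne_zero.2 hi
  have := Matrix.mulVec_injective_of_isUnit ((Matrix.isUnit_iff_isUnit_det _).2 hdet)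
  exact this (by simpa only [Matrix.toLin'_apply] using h)

theorem hasFDerivAt_proj (i : Fin (n + 1)) (y : Fin n → ℝ) :
    HasFDerivAt (P.proj i)
      (LinearMap.toContinuousLinearMap (P.mat.submatrix i.succAbove id).toLin') y := by
  have : P.proj i = fun y => (fun a => P.base (i.succAbove a)) +
      (LinearMap.toContinuousLinearMap (P.mat.submatrix i.succAbove id).toLin') y :=
    funext fun y => P.proj_eq i y
  rw [this]
  exact (ContinuousLinearMap.hasFDerivAt _).const_add _

theorem continuous_proj (i : Fin (n + 1)) : Continuous (P.proj i) :=
  continuous_pi fun _ => (continuous_apply _).comp P.continuous_param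

theorem measurableSet_proj_image {i : Fin (n + 1)} (hi : P.nrm i ≠ 0) :
    MeasurableSet (P.proj i '' P.dom) :=
  P.measurable.image_of_continuousOn_injOn (P.continuous_proj i).continuousOn
    (P.proj_injective hi).injOn

theorem integral_proj_image {i : Fin (n + 1)} (hi : P.nrm i ≠ 0) (f : (Fin (n + 1) → ℝ) → ℝ) :
    ∫ z in P.proj i '' P.dom, f (i.insertNth (P.height i z) z) =
      |P.nrm i| * ∫ y in P.dom, f (P.param y) := by
  rw [integral_image_eq_integral_abs_det_fderiv_smul volume P.measurable
    (fun y _ => (P.hasFDerivAt_proj i y).hasFDerivWithinAt) (P.proj_injective hi).injOn,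
    ← integral_const_mul]
  congr 1
  ext y
  rw [P.insertNth_height_proj hi, ContinuousLinearMap.det]
  simp only [LinearMap.coe_toContinuousLinearMap, LinearMap.det_toLin', P.det_eq, smul_eq_mul]

/-- Sign of the jump across the piece in the direction of a coordinate axis. -/
noncomputable def axisSign (i : Fin (n + 1)) : ℝ := P.sgn * SignType.sign (P.nrm i)

theorem axisSign_mul_abs (i : Fin (n + 1)) : P.axisSign i * |P.nrm i| = P.sgn * P.nrm i := by
  rw [axisSign, mul_assoc, sign_mul_abs]

theorem axisSign_eq {i : Fin (n + 1)} (hi : P.nrm i ≠ 0) :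
    P.axisSign i = 1 ∨ P.axisSign i = -1 := by
  unfold axisSign
  rcases P.sign with h | h <;> rcases lt_or_gt_of_ne hi with h' | h' <;> simp [h, h']

theorem sgn_mul_self : P.sgn * P.sgn = 1 := by
  rcases P.sign with h | h <;> norm_num [h]

theorem norm_nrm_le : ‖P.nrm‖ ≤ 1 := by
  refine (pi_norm_le_iff_of_nonneg zero_le_one).2 fun i => ?_
  rw [Real.norm_eq_abs]
  have h := P.unit
  have h2 : P.nrm i * P.nrm i ≤ P.nrm ⬝ᵥ P.nrm :=
    Finset.single_le_sum (f := fun i => P.nrm i * P.nrm i) (fun j _ => mul_self_nonneg _)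
      (Finset.mem_univ i)
  rw [h] at h2
  nlinarith [abs_mul_abs_self (P.nrm i), abs_nonneg (P.nrm i)]

/-- Near a point where the frontier of `U` lies in one hyperplane, the outward property along the
normal gives the outward property along a transversal coordinate axis. -/
theorem out_axis {U : Set (Fin (n + 1) → ℝ)} {i : Fin (n + 1)} (hi : P.nrm i ≠ 0)
    {y : Fin n → ℝ} {r : ℝ} (hr : 0 < r)
    (hfr : ∀ x ∈ Metric.ball (P.param y) r, x ∈ frontier U → P.nrm ⬝ᵥ (x - P.base) = 0)
    (hout : ∃ ε > 0, ∀ t ∈ Ioo (0 : ℝ) ε,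
      P.param y + t • (P.sgn • P.nrm) ∉ U ∧ P.param y - t • (P.sgn • P.nrm) ∈ U) :
    ∃ ε > 0, ∀ t ∈ Ioo (0 : ℝ) ε,
      P.param y + (P.axisSign i * t) • Pi.single i (1 : ℝ) ∉ U ∧
      P.param y - (P.axisSign i * t) • Pi.single i (1 : ℝ) ∈ U := by
  obtain ⟨ε, hε, hs⟩ := hout
  have hsgn1 : |P.sgn| = 1 := by rcases P.sign with h | h <;> simp [h]
  -- A step along the oriented normal and a step along the axis, on the same side `δ`, end in the
  -- same open half `H` of a ball. That half ball is convex and misses the frontier, so both end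
  -- points are in `U` or both are outside.
  have key : ∀ δ : ℝ, δ = 1 ∨ δ = -1 → ∀ t ∈ Ioo (0 : ℝ) (min ε r),
      (P.param y + (δ * t) • (P.sgn • P.nrm) ∈ U ↔
        P.param y + (δ * (P.axisSign i * t)) • Pi.single i (1 : ℝ) ∈ U) := by
    intro δ hδ t ht
    have hδ1 : |δ| = 1 := by rcases hδ with h | h <;> simp [h]
    have hδδ : δ * δ = 1 := by rcases hδ with h | h <;> norm_num [h]
    set H : Set (Fin (n + 1) → ℝ) := {x | 0 < (δ * P.sgn) * (P.nrm ⬝ᵥ (x - P.base))}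
    have hconv : Convex ℝ (Metric.ball (P.param y) r ∩ H) := by
      refine (convex_ball _ _).inter ?_
      intro x hx x' hx' a b ha hb hab
      simp only [H, mem_ofPred_eq] at hx hx' ⊢
      have : a • x + b • x' - P.base = a • (x - P.base) + b • (x' - P.base) := by
        have : P.base = (a + b) • P.base := by rw [hab, one_smul]
        nth_rewrite 1 [this]
        module
      rw [this, dotProduct_add, dotProduct_smul, dotProduct_smul, smul_eq_mul, smul_eq_mul]
      rcases eq_or_lt_of_le ha with h | h
      · subst h
        simp only [zero_add] at hab
        subst hab
        simpa using hx'
      · nlinarith [mul_pos h hx, mul_nonneg hb hx'.le]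
    refine mem_iff_mem_of_disjoint_frontier hconv.isPreconnected ?_ ⟨?_, ?_⟩ ⟨?_, ?_⟩
    · rw [disjoint_left]
      rintro x ⟨hx, hxH⟩ hxf
      simp only [H, mem_ofPred_eq] at hxH
      rw [hfr x hx hxf, mul_zero] at hxH
      exact lt_irrefl _ hxH
    · rw [Metric.mem_ball, dist_eq_norm, add_sub_cancel_left, norm_smul, norm_smul,
        Real.norm_eq_abs, Real.norm_eq_abs, hsgn1, abs_mul, hδ1, abs_of_pos ht.1, one_mul, one_mul]
      have := P.norm_nrm_le
      have h3 : t < r := lt_of_lt_of_le ht.2 (min_le_right _ _)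
      nlinarith [ht.1]
    · simp only [H, mem_ofPred_eq]
      rw [add_sub_right_comm, dotProduct_add, P.nrm_dot, zero_add, dotProduct_smul,
        dotProduct_smul, P.unit, smul_eq_mul, smul_eq_mul]
      have : δ * P.sgn * (δ * t * (P.sgn * 1)) = (δ * δ) * (P.sgn * P.sgn) * t := by ring
      rw [this, hδδ, P.sgn_mul_self]
      linarith [ht.1]
    · have h4 : |P.axisSign i| = 1 := by
        rcases P.axisSign_eq hi with h | h <;> simp [h]
      rw [Metric.mem_ball, dist_eq_norm, add_sub_cancel_left, norm_smul,
        Real.norm_eq_abs, abs_mul, hδ1, abs_mul, h4, abs_of_pos ht.1, one_mul, one_mul,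
        Pi.norm_single, norm_one, mul_one]
      exact lt_of_lt_of_le ht.2 (min_le_right _ _)
    · simp only [H, mem_ofPred_eq]
      rw [add_sub_right_comm, dotProduct_add, P.nrm_dot, zero_add, dotProduct_smul,
        dotProduct_single, smul_eq_mul, mul_one]
      have : δ * P.sgn * (δ * (P.axisSign i * t) * P.nrm i) =
          (δ * δ) * (P.sgn * P.sgn) * (SignType.sign (P.nrm i) * P.nrm i) * t := by
        rw [axisSign]; ring
      rw [this, hδδ, P.sgn_mul_self, sign_mul_self]
      have := abs_pos.2 hi
      have := ht.1
      positivity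
  refine ⟨min ε r, lt_min hε hr, fun t ht => ?_⟩
  have h1 := hs t ⟨ht.1, lt_of_lt_of_le ht.2 (min_le_left _ _)⟩
  have h2 := key 1 (Or.inl rfl) t ht
  have h3 := key (-1) (Or.inr rfl) t ht
  simp only [one_mul, neg_mul, neg_smul, ← sub_eq_add_neg] at h2 h3
  exact ⟨fun h => h1.1 (h2.2 h), h3.1 h1.2⟩

end FlatPiece

end DDR

/-! ### The divergence theorem for open sets with flat boundary -/

namespace DDR

open Filter Topology Set

/-- The flat pieces `P j`, `j ∈ J`, are disjoint, cover the frontier of `U`, and their oriented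
normals point out of `U`. -/
structure IsFlatBoundary {n : ℕ} {ι : Type*} (U : Set (Fin (n + 1) → ℝ)) (J : Finset ι)
    (P : ι → FlatPiece n) : Prop where
  isOpen : IsOpen U
  bounded : Bornology.IsBounded U
  cover : frontier U ⊆ ⋃ j ∈ J, (P j).param '' closure (P j).dom
  disjoint : ∀ i ∈ J, ∀ j ∈ J, i ≠ j → Disjoint ((P i).param '' (P i).dom)
    ((P j).param '' (P j).dom)
  out : ∀ j ∈ J, ∀ y ∈ (P j).dom, ∃ ε > 0, ∀ t ∈ Ioo (0 : ℝ) ε,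
    (P j).param y + t • ((P j).sgn • (P j).nrm) ∉ U ∧
    (P j).param y - t • ((P j).sgn • (P j).nrm) ∈ U

namespace IsFlatBoundary

variable {n : ℕ} {ι : Type*} {U : Set (Fin (n + 1) → ℝ)} {J : Finset ι} {P : ι → FlatPiece n}

/-- Lines parallel to the `i`-th axis that meet the relative boundary of a piece, or a piece
parallel to the axis. -/
def badLines (J : Finset ι) (P : ι → FlatPiece n) (i : Fin (n + 1)) : Set (Fin n → ℝ) :=
  ⋃ j ∈ J, ((P j).proj i '' frontier (P j).dom ∪ {z | (P j).nrm i = 0 ∧ z ∈ range ((P j).proj i)})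

theorem volume_badLines (J : Finset ι) (P : ι → FlatPiece n) (i : Fin (n + 1)) :
    volume (badLines J P i) = 0 := by
  refine (measure_biUnion_null_iff J.countable_toSet).2 fun j _ => measure_union_null ?_ ?_
  · rw [(P j).volume_proj_image, (P j).null, mul_zero]
  · by_cases h : (P j).nrm i = 0
    · refine measure_mono_null (fun z hz => hz.2) ?_
      rw [← image_univ, (P j).volume_proj_image, h, abs_zero, ENNReal.ofReal_zero, zero_mul]
    · simp [h]

theorem mem_dom_of_proj_notMem {i : Fin (n + 1)} {j : ι} (hj : j ∈ J) {y : Fin n → ℝ}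
    (hy : y ∈ closure (P j).dom) (hz : (P j).proj i y ∉ badLines J P i) :
    (P j).nrm i ≠ 0 ∧ y ∈ (P j).dom := by
  simp only [badLines, mem_iUnion, mem_union, not_exists, not_or] at hz
  obtain ⟨h1, h2⟩ := hz j hj
  refine ⟨fun h => h2 ⟨h, mem_range_self y⟩, ?_⟩
  by_contra h
  exact h1 (mem_image_of_mem _ ⟨hy, fun h' => h (interior_subset h')⟩)

/-- A line that is not bad meets the closed pieces only at relatively interior points, and
transversally. Its trace on `U` is thus a bounded open set of the line whose frontier consists of
heights of the pieces that it crosses, with orientations `axisSign`, and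
`integral_deriv_of_frontier` applies. -/
theorem integral_slice (hB : IsFlatBoundary U J P) (i : Fin (n + 1)) {z : Fin n → ℝ}
    (hz : z ∉ badLines J P i) {f f' : (Fin (n + 1) → ℝ) → ℝ}
    (hf : ∀ t, HasDerivAt (fun t => f (i.insertNth t z)) (f' (i.insertNth t z)) t)
    (hf' : Continuous f') :
    ∫ t in (fun t : ℝ => (i.insertNth t z : Fin (n + 1) → ℝ)) ⁻¹' U, f' (i.insertNth t z) =
      ∑ j ∈ J, (P j).axisSign i *
        ((P j).proj i '' (P j).dom).indicator (fun z => f (i.insertNth ((P j).height i z) z)) z := by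
  classical
  have hins : Continuous fun t : ℝ => (i.insertNth t z : Fin (n + 1) → ℝ) :=
    Continuous.finInsertNth i continuous_id continuous_const
  set s := J.filter fun j => z ∈ (P j).proj i '' (P j).dom
  have hs : ∀ j ∈ s, j ∈ J ∧ ∃ y ∈ (P j).dom, (P j).nrm i ≠ 0 ∧ (P j).proj i y = z ∧
      (i.insertNth ((P j).height i z) z : Fin (n + 1) → ℝ) = (P j).param y := by
    intro j hj
    obtain ⟨hj', y, hy, hp⟩ := Finset.mem_filter.1 hj
    have h := mem_dom_of_proj_notMem hj' (subset_closure hy) (hp ▸ hz)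
    exact ⟨hj', y, hy, h.1, hp, hp ▸ (P j).insertNth_height_proj h.1 y⟩
  have hinj : InjOn (fun j => (P j).height i z) s := by
    intro j hj j' hj' h
    obtain ⟨hj, y, hy, _, _, h3⟩ := hs j hj
    obtain ⟨hj', y', hy', _, _, h3'⟩ := hs j' hj'
    by_contra hne
    refine disjoint_left.1 (hB.disjoint j hj j' hj' hne) (mem_image_of_mem _ hy) ⟨y', hy', ?_⟩
    rw [← h3, ← h3']
    simp only at h
    rw [h]
  rw [integral_deriv_of_frontier (s := s) (h := fun j => (P j).height i z)
    (σ := fun j => (P j).axisSign i) (g := fun t => f (i.insertNth t z))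
    (hB.isOpen.preimage hins) ?_ hinj ?_ ?_ ?_ hf (hf'.comp hins)]
  · rw [Finset.sum_filter]
    refine Finset.sum_congr rfl fun j _ => ?_
    by_cases h : z ∈ (P j).proj i '' (P j).dom
    · rw [if_pos h, indicator_of_mem h]
    · rw [if_neg h, indicator_of_notMem h, mul_zero]
  · refine Metric.isBounded_iff.2 ?_
    obtain ⟨C, hC⟩ := Metric.isBounded_iff.1 hB.bounded
    refine ⟨C, fun t ht t' ht' => le_trans ?_ (hC ht ht')⟩
    simpa only [Fin.insertNth_apply_same] using dist_le_pi_dist (i.insertNth t z : Fin (n + 1) → ℝ) (i.insertNth t' z) i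
  · intro t ht
    have := hB.cover (hins.frontier_preimage_subset U ht)
    simp only [mem_iUnion] at this
    obtain ⟨j, hj, y, hy, hyt⟩ := this
    have hp : (P j).proj i y = z := by
      ext a
      have := congrFun hyt (i.succAbove a)
      simpa [FlatPiece.proj] using this
    have h := mem_dom_of_proj_notMem hj hy (hp ▸ hz)
    refine ⟨j, Finset.mem_coe.2 (Finset.mem_filter.2 ⟨hj, y, h.2, hp⟩), ?_⟩
    simp only
    rw [← hp, (P j).height_proj h.1, hyt, Fin.insertNth_apply_same]
  · intro j hj
    obtain ⟨_, _, _, h, _⟩ := hs j hj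
    exact (P j).axisSign_eq h
  · intro j hj
    obtain ⟨hj, y, hy, hi, hp, hx⟩ := hs j hj
    -- The other closed pieces avoid the point: the line could meet them only in their relative
    -- interiors, which are disjoint from this piece. So near the point the frontier lies in one
    -- hyperplane, as `out_axis` requires.
    set K := ⋃ j' ∈ J.erase j, (P j').param '' closure (P j').dom
    have hK : IsClosed K := (J.erase j).finite_toSet.isClosed_biUnion fun j' _ =>
      ((P j').bounded.isCompact_closure.image (P j').continuous_param).isClosed
    have hxK : (P j).param y ∉ K := by
      intro h
      simp only [K, mem_iUnion] at h
      obtain ⟨j', hj', y', hy', h⟩ := h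
      have hp' : (P j').proj i y' = z := by
        rw [← hp]
        ext a
        exact congrFun h (i.succAbove a)
      have h2 := mem_dom_of_proj_notMem (Finset.mem_erase.1 hj').2 hy' (hp' ▸ hz)
      exact disjoint_left.1 (hB.disjoint j hj j' (Finset.mem_erase.1 hj').2
        (Finset.mem_erase.1 hj').1.symm) (mem_image_of_mem _ hy) ⟨y', h2.2, h⟩
    obtain ⟨r, hr, hball⟩ := Metric.isOpen_iff.1 hK.isOpen_compl _ hxK
    obtain ⟨ε, hε, hside⟩ := (P j).out_axis hi hr (U := U) (fun x hx hxf => by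
      have := hB.cover hxf
      simp only [mem_iUnion] at this
      obtain ⟨j', hj', y', hy', rfl⟩ := this
      by_cases h : j' = j
      · subst h
        exact (P j').nrm_dot y'
      · refine absurd ?_ (hball hx)
        simp only [K, mem_iUnion]
        exact ⟨j', Finset.mem_erase.2 ⟨h, hj'⟩, y', hy', rfl⟩) (hB.out j hj y hy)
    have hadd : ∀ a : ℝ, (P j).param y + a • Pi.single i (1 : ℝ) =
        i.insertNth ((P j).height i z + a) z := by
      intro a
      rw [← hx]
      symm
      rw [Fin.insertNth_eq_iff]
      constructor
      · simp
      · ext b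
        simp [Fin.removeNth]
    refine ⟨ε, hε, fun t ht => ?_⟩
    have := hside t ht
    rw [sub_eq_add_neg, ← neg_smul, hadd, hadd] at this
    exact this

/-- The divergence theorem for a field parallel to a coordinate axis. -/
theorem integral_deriv (hB : IsFlatBoundary U J P) (i : Fin (n + 1))
    {f f' : (Fin (n + 1) → ℝ) → ℝ} (hfc : Continuous f) (hf' : Continuous f')
    (hf : ∀ z t, HasDerivAt (fun t => f (i.insertNth t z)) (f' (i.insertNth t z)) t) :
    ∫ x in U, f' x =
      ∑ j ∈ J, (P j).sgn * (P j).nrm i * ∫ y in (P j).dom, f ((P j).param y) := by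
  have hint : Integrable (U.indicator f') := by
    rw [integrable_indicator_iff hB.isOpen.measurableSet]
    exact (hf'.continuousOn.integrableOn_compact hB.bounded.isCompact_closure).mono_set
      subset_closure
  have hmp := (volume_preserving_piFinSuccAbove (fun _ : Fin (n + 1) => ℝ) i).symm
  have hae : ∀ᵐ z : Fin n → ℝ, z ∉ badLines J P i :=
    measure_eq_zero_iff_ae_notMem.1 (volume_badLines J P i)
  calc ∫ x in U, f' x = ∫ x, U.indicator f' x :=
        (integral_indicator hB.isOpen.measurableSet).symm
    _ = ∫ tz : ℝ × (Fin n → ℝ), U.indicator f' (i.insertNth tz.1 tz.2) :=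
        (hmp.integral_comp' (U.indicator f')).symm
    _ = ∫ z : Fin n → ℝ, ∫ t : ℝ, U.indicator f' (i.insertNth t z) :=
        integral_prod_symm _ (hmp.integrable_comp_of_integrable hint)
    _ = ∫ z : Fin n → ℝ, ∑ j ∈ J, (P j).axisSign i *
        ((P j).proj i '' (P j).dom).indicator
          (fun z => f (i.insertNth ((P j).height i z) z)) z := by
        refine integral_congr_ae ?_
        filter_upwards [hae] with z hz
        rw [← hB.integral_slice i hz (hf z) hf', ← integral_indicator]
        · rfl
        · exact (hB.isOpen.preimage
            (Continuous.finInsertNth i continuous_id continuous_const)).measurableSet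
    _ = ∑ j ∈ J, (P j).axisSign i * ∫ z, ((P j).proj i '' (P j).dom).indicator
          (fun z => f (i.insertNth ((P j).height i z) z)) z := by
        refine (integral_finsetSum _ fun j _ => ?_).trans
          (Finset.sum_congr rfl fun j _ => integral_const_mul _ _)
        by_cases hi : (P j).nrm i = 0
        · simp [FlatPiece.axisSign, hi]
        · refine Integrable.const_mul ?_ _
          rw [integrable_indicator_iff ((P j).measurableSet_proj_image hi)]
          have hc : Continuous fun z => f (i.insertNth ((P j).height i z) z) :=
            hfc.comp (Continuous.finInsertNth i ((P j).continuous_height i) continuous_id)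
          exact (hc.continuousOn.integrableOn_compact
            ((P j).bounded.isCompact_closure.image ((P j).continuous_proj i))).mono_set
            (image_mono subset_closure)
    _ = _ := by
        refine Finset.sum_congr rfl fun j _ => ?_
        -- Pieces parallel to the axis contribute zero to both sides, because `axisSign` contains
        -- the sign of zero.
        by_cases hi : (P j).nrm i = 0
        · simp [FlatPiece.axisSign, hi]
        · rw [integral_indicator ((P j).measurableSet_proj_image hi),
            (P j).integral_proj_image hi, ← mul_assoc, (P j).axisSign_mul_abs]

end IsFlatBoundary

end DDR

/-! ### Polynomial spaces and the Euler operator -/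

namespace DDR

open MvPolynomial

section PolynomialSpaces

variable {d : ℕ} {l m : ℤ}

theorem C_mem_PolS (c : ℝ) (hl : 0 ≤ l) : (C c : SPol d) ∈ PolS d l := by
  rw [← monomial_zero', PolS, monomial_mem_restrictSupport]
  left
  simpa using hl

theorem X_mem_PolS (i : Fin d) (hl : 1 ≤ l) : (X i : SPol d) ∈ PolS d l := by
  rw [X, PolS, monomial_mem_restrictSupport]
  left
  simpa using hl

theorem mul_mem_PolS {p q : SPol d} (hp : p ∈ PolS d l) (hq : q ∈ PolS d m) :
    p * q ∈ PolS d (l + m) := by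
  classical
  intro a ha
  obtain ⟨b, hb, c, hc, rfl⟩ := Finset.mem_add.1 (support_mul p q ha)
  have h1 := hp hb
  have h2 := hq hc
  simp only [Set.mem_ofPred_eq, map_add, Nat.cast_add] at *
  exact add_le_add h1 h2

theorem pderiv_mem_PolS (i : Fin d) {p : SPol d} (hp : p ∈ PolS d l) :
    pderiv i p ∈ PolS d (l - 1) := by
  intro a ha
  replace ha : coeff a (pderiv i p) ≠ 0 := mem_support_iff.1 ha
  rw [coeff_pderiv] at ha
  have h1 : a + Finsupp.single i 1 ∈ p.support := mem_support_iff.2 (left_ne_zero_of_mul ha)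
  have h2 := hp h1
  simp only [Set.mem_ofPred_eq, map_add, Finsupp.degree_single, Nat.cast_add, Nat.cast_one] at *
  linarith

instance finite_PolS (d : ℕ) (l : ℤ) : Module.Finite ℝ (PolS d l) := by
  have : {a : Fin d →₀ ℕ | (a.degree : ℤ) ≤ l}.Finite :=
    (Finsupp.finite_of_degree_le l.toNat).subset fun a ha => by
      simp only [Set.mem_ofPred_eq] at *
      omega
  have := this.to_subtype
  exact Module.Finite.of_basis (basisRestrictSupport ℝ {a : Fin d →₀ ℕ | (a.degree : ℤ) ≤ l})

theorem mem_PolV_iff {v : VPol d} : v ∈ PolV d l ↔ ∀ i, v i ∈ PolS d l := by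
  simp [PolV, Submodule.mem_pi]

theorem PolV_mono (h : l ≤ m) : PolV d l ≤ PolV d m := fun _ hv =>
  mem_PolV_iff.2 fun i => PolS_mono d h (mem_PolV_iff.1 hv i)

instance finite_PolV (d : ℕ) (l : ℤ) : Module.Finite ℝ (PolV d l) := by
  let f : PolV d l →ₗ[ℝ] (Fin d → PolS d l) :=
    { toFun := fun v i => ⟨v.1 i, mem_PolV_iff.1 v.2 i⟩
      map_add' := fun _ _ => rfl
      map_smul' := fun _ _ => rfl }
  refine Module.Finite.of_injective f fun v w h => Subtype.ext (funext fun i => ?_)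
  exact congrArg Subtype.val (congrFun h i)

instance finite_PolE (l : ℤ) : Module.Finite ℝ (PolE l) :=
  Module.Finite.equiv (Polynomial.degreeLTEquiv ℝ (l + 1).toNat).symm

end PolynomialSpaces

section Calculus

variable {d : ℕ}

/-- The commutator of two derivations is a derivation, and this one kills the variables. -/
theorem pderiv_comm' (i j : Fin d) (p : SPol d) :
    pderiv i (pderiv j p) = pderiv j (pderiv i p) := by
  have : ⁅(pderiv i : Derivation ℝ (SPol d) (SPol d)), (pderiv j : Derivation ℝ (SPol d) (SPol d))⁆ = 0 := by
    apply derivation_ext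
    intro a
    rw [Derivation.commutator_apply]
    simp only [pderiv_X, Pi.single_apply, Derivation.zero_apply]
    split_ifs <;> simp
  have h := congrArg (fun D => D p) this
  simp only [Derivation.commutator_apply, Derivation.zero_apply] at h
  exact sub_eq_zero.1 h

theorem hasDerivAt_eval (p : SPol d) {x : ℝ → Fin d → ℝ} {x' : Fin d → ℝ} {t : ℝ}
    (hx : ∀ i, HasDerivAt (fun t => x t i) (x' i) t) :
    HasDerivAt (fun t => eval (x t) p) (∑ i, x' i * eval (x t) (pderiv i p)) t := by
  induction p using MvPolynomial.induction_on with
  | C a => simpa using hasDerivAt_const t a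
  | add p q hp hq =>
    simp only [map_add, mul_add, Finset.sum_add_distrib]
    exact hp.add hq
  | mul_X p i hp =>
    simp only [map_mul, eval_X, Derivation.leibniz, smul_eq_mul, map_add, pderiv_X]
    convert! hp.mul (hx i) using 1
    rw [Finset.sum_mul]
    simp only [mul_add, Finset.sum_add_distrib, Pi.single_apply, apply_ite (eval (x t)), map_one,
      map_zero]
    simp only [mul_ite, mul_one, mul_zero, Finset.sum_ite_eq, Finset.mem_univ,
      if_true]
    rw [add_comm]
    congr 1
    · exact Finset.sum_congr rfl fun j _ => by ring
    · ring

theorem continuous_eval' (p : SPol d) : Continuous fun x : Fin d → ℝ => eval x p :=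
  MvPolynomial.continuous_eval p

theorem ev_dotProduct (u v : VPol d) (x : Fin d → ℝ) : ev u x ⬝ᵥ ev v x = eval x (u ⬝ᵥ v) := by
  simp [dotProduct, ev]

/-- The Euler operator `(x - c) · ∇`. -/
noncomputable def euler (c : Fin d → ℝ) : SPol d →ₗ[ℝ] SPol d :=
  ∑ i, (LinearMap.mulLeft ℝ (posVec c i)).comp (pderiv i).toLinearMap

theorem euler_apply (c : Fin d → ℝ) (p : SPol d) :
    euler c p = ∑ i, (X i - C (c i)) * pderiv i p := by
  simp [euler, posVec]

theorem posVec_mem (c : Fin d → ℝ) (i : Fin d) : posVec c i ∈ PolS d 1 :=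
  sub_mem (X_mem_PolS i le_rfl) (C_mem_PolS _ zero_le_one)

theorem euler_mem {c : Fin d → ℝ} {l : ℤ} {p : SPol d} (hp : p ∈ PolS d l) :
    euler c p ∈ PolS d l := by
  rw [euler_apply]
  refine sum_mem fun i _ => ?_
  have := mul_mem_PolS (posVec_mem c i) (pderiv_mem_PolS i hp)
  rwa [add_sub_cancel] at this

theorem hasDerivAt_ray (c x : Fin d → ℝ) (p : SPol d) (t : ℝ) :
    HasDerivAt (fun t : ℝ => eval (c + t • (x - c)) p)
      (∑ i, (x i - c i) * eval (c + t • (x - c)) (pderiv i p)) t := by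
  refine hasDerivAt_eval p (x := fun t : ℝ => c + t • (x - c)) (x' := fun i => x i - c i)
    fun i => ?_
  simpa using ((hasDerivAt_id t).mul_const (x i - c i)).const_add (c i)

/-- On a ray from `c` the Euler operator is `t d/dt`, so equations for it become ordinary
differential equations. -/
theorem eval_euler_ray (c x : Fin d → ℝ) (p : SPol d) (t : ℝ) :
    eval (c + t • (x - c)) (euler c p) =
      t * ∑ i, (x i - c i) * eval (c + t • (x - c)) (pderiv i p) := by
  rw [euler_apply, map_sum, Finset.mul_sum]
  refine Finset.sum_congr rfl fun i _ => ?_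
  simp [mul_assoc]

/-- On each ray, `t ^ a * p` has derivative `t ^ (a - 1) * (a p + E p) = 0`, and it vanishes at `t =
0` because `a ≠ 0`. -/
theorem eq_zero_of_euler {c : Fin d → ℝ} {a : ℕ} (ha : a ≠ 0) {p : SPol d}
    (h : (a : ℝ) • p + euler c p = 0) : p = 0 := by
  refine MvPolynomial.funext fun x => ?_
  have hder : ∀ t : ℝ, HasDerivAt (fun t : ℝ => t ^ a * eval (c + t • (x - c)) p) 0 t := by
    intro t
    have h1 := (hasDerivAt_pow a t).mul (hasDerivAt_ray c x p t)
    convert! h1 using 1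
    have h2 := congrArg (eval (c + t • (x - c))) h
    rw [map_add, smul_eval, eval_euler_ray, map_zero] at h2
    obtain ⟨b, rfl⟩ := Nat.exists_eq_succ_of_ne_zero ha
    rw [Nat.succ_eq_add_one, Nat.add_sub_cancel, pow_succ]
    rw [Nat.succ_eq_add_one] at h2
    linear_combination (-(t ^ b)) * h2
  have hconst := is_const_of_deriv_eq_zero (fun t => (hder t).differentiableAt)
    (fun t => (hder t).deriv) 1 0
  simpa [ha] using hconst

theorem eq_C_of_euler {c : Fin d → ℝ} {p : SPol d} (h : euler c p = 0) : p = C (eval c p) := by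
  refine MvPolynomial.funext fun x => ?_
  -- The hypothesis gives only `t` times the radial derivative, hence nothing at `t = 0`. Running
  -- along the ray as `t ^ 2` supplies a factor `2 t` that covers this point.
  have hder : ∀ t : ℝ, HasDerivAt (fun t : ℝ => eval (c + (t ^ 2) • (x - c)) p) 0 t := by
    intro t
    have h1 := (hasDerivAt_ray c x p (t ^ 2)).scomp t (hasDerivAt_pow 2 t)
    convert! h1 using 1
    have h2 := congrArg (eval (c + (t ^ 2) • (x - c))) h
    rw [eval_euler_ray, map_zero] at h2
    rcases eq_or_ne t 0 with rfl | ht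
    · simp
    · rw [(mul_eq_zero.1 h2).resolve_left (pow_ne_zero 2 ht), smul_zero]
  have hconst := is_const_of_deriv_eq_zero (fun t => (hder t).differentiableAt)
    (fun t => (hder t).deriv) 1 0
  simpa using hconst

/-- `a + E` is an injective endomorphism of the finite-dimensional space `PolS d l`, hence
surjective. -/
theorem exists_euler_eq {c : Fin d → ℝ} {l : ℤ} {a : ℕ} (ha : a ≠ 0) {p : SPol d}
    (hp : p ∈ PolS d l) : ∃ q ∈ PolS d l, (a : ℝ) • q + euler c q = p := by
  let f : PolS d l →ₗ[ℝ] PolS d l :=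
    ((a : ℝ) • LinearMap.id + euler c).restrict fun q hq =>
      add_mem (Submodule.smul_mem _ _ hq) (euler_mem hq)
  have hf : Function.Injective f := by
    rw [injective_iff_map_eq_zero]
    intro q hq
    exact Subtype.ext (eq_zero_of_euler (c := c) ha (congrArg Subtype.val hq))
  obtain ⟨q, hq⟩ := (LinearMap.injective_iff_surjective.1 hf) ⟨p, hp⟩
  exact ⟨q.1, q.2, congrArg Subtype.val hq⟩

end Calculus

end DDR

/-! ### Koszul homotopies and decompositions of polynomial vector fields -/

namespace DDR

open MvPolynomial

section VectorCalculus

variable {d : ℕ} {l : ℤ}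

theorem grad_mem {p : SPol d} (hp : p ∈ PolS d l) : grad d p ∈ PolV d (l - 1) :=
  mem_PolV_iff.2 fun i => pderiv_mem_PolS i hp

theorem vdiv_mem {v : VPol d} (hv : v ∈ PolV d l) : vdiv v ∈ PolS d (l - 1) :=
  sum_mem fun i _ => pderiv_mem_PolS i (mem_PolV_iff.1 hv i)

theorem perp_mem {v : VPol 2} (hv : v ∈ PolV 2 l) : perp v ∈ PolV 2 l := by
  rw [mem_PolV_iff] at *
  intro i
  fin_cases i
  · exact hv 1
  · exact neg_mem (hv 0)

theorem vrot_mem {p : SPol 2} (hp : p ∈ PolS 2 l) : vrot p ∈ PolV 2 (l - 1) :=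
  perp_mem (grad_mem hp)

theorem curl_mem {v : VPol 3} (hv : v ∈ PolV 3 l) : curl v ∈ PolV 3 (l - 1) := by
  rw [mem_PolV_iff] at *
  intro i
  fin_cases i <;> exact sub_mem (pderiv_mem_PolS _ (hv _)) (pderiv_mem_PolS _ (hv _))

theorem posMul_mem (c : Fin d → ℝ) {p : SPol d} (hp : p ∈ PolS d (l - 1)) :
    posMul c p ∈ PolV d l := by
  rw [mem_PolV_iff]
  intro i
  have := mul_mem_PolS hp (posVec_mem c i)
  rwa [sub_add_cancel] at this

theorem cross_mem {m : ℤ} {u v : VPol 3} (hu : u ∈ PolV 3 m) (hv : v ∈ PolV 3 l) :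
    u ⨯₃ v ∈ PolV 3 (m + l) := by
  rw [mem_PolV_iff] at *
  intro i
  rw [cross_apply]
  fin_cases i <;> exact sub_mem (mul_mem_PolS (hu _) (hv _)) (mul_mem_PolS (hu _) (hv _))

theorem posCross_mem (c : R3) {v : VPol 3} (hv : v ∈ PolV 3 (l - 1)) : posCross c v ∈ PolV 3 l := by
  have := cross_mem (mem_PolV_iff.2 (posVec_mem c)) hv
  rwa [add_sub_cancel] at this

theorem vdiv_vrot (p : SPol 2) : vdiv (vrot p) = 0 := by
  simp [vdiv, vrot, perp, grad, Fin.sum_univ_two, pderiv_comm' 0 1 p]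

theorem vdiv_curl (v : VPol 3) : vdiv (curl v) = 0 := by
  simp [vdiv, curl, Fin.sum_univ_three, pderiv_comm' 1 0, pderiv_comm' 2 0, pderiv_comm' 2 1]

theorem curl_grad (p : SPol 3) : curl (grad 3 p) = 0 := by
  ext1 i
  fin_cases i <;> simp [curl, grad, pderiv_comm' 1 0, pderiv_comm' 2 0, pderiv_comm' 2 1]

theorem vdiv_add (u v : VPol d) : vdiv (u + v) = vdiv u + vdiv v := by
  simp [vdiv, Finset.sum_add_distrib]

theorem vdiv_smul (a : ℝ) (v : VPol d) : vdiv (a • v) = a • vdiv v := by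
  simp [vdiv, Finset.smul_sum]

/-- The divergence as a linear map. -/
noncomputable def vdivL (d : ℕ) : VPol d →ₗ[ℝ] SPol d where
  toFun := vdiv
  map_add' := vdiv_add
  map_smul' := vdiv_smul

theorem vdivL_apply (v : VPol d) : vdivL d v = vdiv v := rfl

theorem vdiv_posMul (c : Fin d → ℝ) (p : SPol d) :
    vdiv (posMul c p) = (d : ℝ) • p + euler c p := by
  simp only [vdiv, posMul, posVec, LinearMap.coe_mk, AddHom.coe_mk, Pi.smul_apply, smul_eq_mul,
    Derivation.leibniz, map_sub, pderiv_X_self, pderiv_C, sub_zero, mul_one, euler_apply,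
    Finset.sum_add_distrib, Finset.sum_const, Finset.card_univ, Fintype.card_fin]
  rw [← Nat.cast_smul_eq_nsmul ℝ]

theorem posVec_dot_grad (c : Fin d → ℝ) (p : SPol d) : posVec c ⬝ᵥ grad d p = euler c p := by
  rw [euler_apply]; rfl

/-- This and the next two identities are Cartan's formula for contraction with `x - c`, on forms
written as vector fields. As the left-hand operators are bijective in each degree, the right-hand
sides provide all the decompositions below. -/
theorem homotopy_rot (v : VPol 2) :
    v + (fun i => euler 0 (v i)) = vrot (X 1 * v 0 - X 0 * v 1) + posMul 0 (vdiv v) := by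
  ext1 i
  fin_cases i <;>
    simp [vrot, perp, grad, posMul, posVec, vdiv, euler_apply, Fin.sum_univ_two, pderiv_X] <;> ring

theorem homotopy_curl (c : R3) (v : VPol 3) :
    (2 : ℝ) • v + (fun i => euler c (v i)) = - curl (posCross c v) + posMul c (vdiv v) := by
  ext1 i
  fin_cases i <;>
    simp [curl, posCross, cross_apply, posMul, posVec, vdiv, euler_apply, Fin.sum_univ_three,
      pderiv_X, MvPolynomial.smul_eq_C_mul, map_ofNat] <;> ring

theorem homotopy_grad (c : R3) (v : VPol 3) :
    v + (fun i => euler c (v i)) = grad 3 (posVec c ⬝ᵥ v) - posCross c (curl v) := by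
  ext1 i
  fin_cases i <;>
    simp [curl, posCross, cross_apply, grad, posVec, dotProduct, euler_apply, Fin.sum_univ_three,
      pderiv_X] <;> ring

theorem exists_euler_eq_vec (c : Fin d → ℝ) {a : ℕ} (ha : a ≠ 0) {v : VPol d}
    (hv : v ∈ PolV d l) : ∃ u ∈ PolV d l, (a : ℝ) • u + (fun i => euler c (u i)) = v := by
  choose u hu hu2 using fun i => exists_euler_eq (c := c) ha (mem_PolV_iff.1 hv i)
  exact ⟨u, mem_PolV_iff.2 hu, funext hu2⟩

theorem eq_zero_of_euler_vec {c : Fin d → ℝ} {a : ℕ} (ha : a ≠ 0) {v : VPol d}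
    (h : (a : ℝ) • v + (fun i => euler c (v i)) = 0) : v = 0 :=
  funext fun i => eq_zero_of_euler ha (congrFun h i)

end VectorCalculus

section Subspaces

variable {l : ℤ}

theorem RolyFc_le : RolyFc l ≤ PolV 2 l := by
  rintro _ ⟨p, hp, rfl⟩
  exact posMul_mem 0 hp

theorem GolyTc_le (c : R3) : GolyTc c l ≤ PolV 3 l := by
  rintro _ ⟨p, hp, rfl⟩
  exact posCross_mem c hp

theorem RolyT_le : RolyT l ≤ PolV 3 l := by
  rintro _ ⟨p, hp, rfl⟩
  have := curl_mem hp
  rwa [add_sub_cancel_right] at this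

theorem RolyTc_le (c : R3) : RolyTc c l ≤ PolV 3 l := by
  rintro _ ⟨p, hp, rfl⟩
  exact posMul_mem c hp

theorem RolyFc_mono {m : ℤ} (h : l ≤ m) : RolyFc l ≤ RolyFc m :=
  Submodule.map_mono (PolS_mono 2 (by linarith))

/-- With `v = u + E u`, the splitting is `homotopy_rot` applied to `u`; the curl and gradient
splittings that follow arise in the same way. -/
theorem exists_vrot_add {v : VPol 2} (hv : v ∈ PolV 2 l) :
    ∃ r ∈ PolS 2 (l + 1), ∃ w ∈ RolyFc l, vrot r + w = v := by
  obtain ⟨u, hu, rfl⟩ := exists_euler_eq_vec (0 : Fin 2 → ℝ) one_ne_zero hv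
  refine ⟨_, ?_, _, ⟨vdiv u, vdiv_mem hu, rfl⟩,
    by rw [← homotopy_rot, Nat.cast_one, one_smul]⟩
  have hX : ∀ i j, X i * u j ∈ PolS 2 (l + 1) := fun i j => by
    rw [add_comm]
    exact mul_mem_PolS (X_mem_PolS i le_rfl) (mem_PolV_iff.1 hu j)
  exact sub_mem (hX _ _) (hX _ _)

theorem exists_curl_add (c : R3) {v : VPol 3} (hv : v ∈ PolV 3 l) :
    ∃ w ∈ GolyTc c (l + 1), ∃ z ∈ RolyTc c l, curl w + z = v := by
  obtain ⟨u, hu, rfl⟩ := exists_euler_eq_vec c two_ne_zero hv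
  refine ⟨- posCross c u, neg_mem ⟨u, ?_, rfl⟩, _, ⟨vdiv u, vdiv_mem hu, rfl⟩, ?_⟩
  · rwa [add_sub_cancel_right]
  · rw [map_neg, ← homotopy_curl, Nat.cast_ofNat]

theorem exists_grad_add (c : R3) {v : VPol 3} (hv : v ∈ PolV 3 l) :
    ∃ r ∈ PolS 3 (l + 1), ∃ z ∈ GolyTc c l, grad 3 r + z = v := by
  obtain ⟨u, hu, rfl⟩ := exists_euler_eq_vec c one_ne_zero hv
  refine ⟨posVec c ⬝ᵥ u, ?_, - posCross c (curl u), neg_mem ⟨curl u, curl_mem hu, rfl⟩, ?_⟩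
  · refine sum_mem fun i _ => ?_
    rw [add_comm]
    exact mul_mem_PolS (posVec_mem c i) (mem_PolV_iff.1 hu i)
  · rw [← sub_eq_add_neg, ← homotopy_grad, Nat.cast_one, one_smul]

/-- On `(x - c) p` the divergence is `d p + E p`. Injectivity of `d + E` gives this; its
surjectivity gives the preimages under `vdiv` further down. -/
theorem posMul_eq_zero_of_vdiv {d : ℕ} (hd : d ≠ 0) {c : Fin d → ℝ} {p : SPol d}
    (h : vdiv (posMul c p) = 0) : posMul c p = 0 := by
  rw [vdiv_posMul] at h
  rw [eq_zero_of_euler hd h, map_zero]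

theorem RolyFc_eq_zero_of_vdiv {w : VPol 2} (hw : w ∈ RolyFc l) (h : vdiv w = 0) : w = 0 := by
  obtain ⟨p, _, rfl⟩ := hw
  exact posMul_eq_zero_of_vdiv two_ne_zero h

theorem RolyTc_eq_zero_of_vdiv {c : R3} {w : VPol 3} (hw : w ∈ RolyTc c l) (h : vdiv w = 0) :
    w = 0 := by
  obtain ⟨p, _, rfl⟩ := hw
  exact posMul_eq_zero_of_vdiv three_ne_zero h

theorem exists_RolyFc_vdiv {p : SPol 2} (hp : p ∈ PolS 2 (l - 1)) :
    ∃ w ∈ RolyFc l, vdiv w = p := by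
  obtain ⟨q, hq, rfl⟩ := exists_euler_eq (c := 0) two_ne_zero hp
  exact ⟨_, ⟨q, hq, rfl⟩, vdiv_posMul _ _⟩

theorem exists_RolyTc_vdiv (c : R3) {p : SPol 3} (hp : p ∈ PolS 3 (l - 1)) :
    ∃ w ∈ RolyTc c l, vdiv w = p := by
  obtain ⟨q, hq, rfl⟩ := exists_euler_eq (c := c) three_ne_zero hp
  exact ⟨_, ⟨q, hq, rfl⟩, vdiv_posMul _ _⟩

theorem posVec_dot_posCross (c : R3) (v : VPol 3) : posVec c ⬝ᵥ posCross c v = 0 :=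
  dot_self_cross _ _

/-- `w` is orthogonal to `x - c`, so `homotopy_grad` reduces to `w + E w = 0`. -/
theorem GolyTc_eq_zero_of_curl {c : R3} {w : VPol 3} (hw : w ∈ GolyTc c l) (h : curl w = 0) :
    w = 0 := by
  obtain ⟨q, _, rfl⟩ := hw
  refine eq_zero_of_euler_vec (c := c) one_ne_zero ?_
  rw [Nat.cast_one, one_smul, homotopy_grad, posVec_dot_posCross, h, map_zero, map_zero, sub_zero]

/-- The scalar product with `x - c` kills `z` and leaves `E r = 0`. -/
theorem eq_C_of_grad_add {c : R3} {r : SPol 3} {z : VPol 3} (hz : z ∈ GolyTc c l)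
    (h : grad 3 r + z = 0) : r = C (eval c r) := by
  obtain ⟨q, _, rfl⟩ := hz
  have := congrArg (posVec c ⬝ᵥ ·) h
  simp only [dotProduct_add, posVec_dot_posCross, dotProduct_zero, add_zero,
    posVec_dot_grad] at this
  exact eq_C_of_euler this

theorem grad_C (d : ℕ) (a : ℝ) : grad d (C a) = 0 := by
  ext1 i
  simp [grad]

theorem vrot_C (a : ℝ) : vrot (C a) = 0 := by
  ext1 i
  fin_cases i <;> simp [vrot, perp, grad]

theorem eq_C_of_vrot {r : SPol 2} (h : vrot r = 0) : r = C (eval 0 r) := by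
  refine eq_C_of_euler (c := 0) ?_
  have h0 := congrFun h 0
  have h1 := congrFun h 1
  simp only [vrot, perp, grad, LinearMap.coe_mk, AddHom.coe_mk, Matrix.cons_val_zero,
    Matrix.cons_val_one, Pi.zero_apply, neg_eq_zero] at h0 h1
  rw [euler_apply, Fin.sum_univ_two, h0, h1, mul_zero, mul_zero, add_zero]

theorem eq_zero_of_vrot_add {r : SPol 2} {w : VPol 2} (hw : w ∈ RolyFc l) (h : vrot r + w = 0) :
    w = 0 ∧ r = C (eval 0 r) := by
  have h1 := congrArg vdiv h
  rw [vdiv_add, vdiv_vrot, zero_add, ← vdivL_apply, ← vdivL_apply, map_zero] at h1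
  have h2 := RolyFc_eq_zero_of_vdiv hw h1
  rw [h2, add_zero] at h
  exact ⟨h2, eq_C_of_vrot h⟩

theorem eq_zero_of_curl_add {m : ℤ} {c : R3} {w z : VPol 3} (hw : w ∈ GolyTc c m)
    (hz : z ∈ RolyTc c l) (h : curl w + z = 0) : w = 0 ∧ z = 0 := by
  have h1 := congrArg vdiv h
  rw [vdiv_add, vdiv_curl, zero_add, ← vdivL_apply, ← vdivL_apply, map_zero] at h1
  have h2 := RolyTc_eq_zero_of_vdiv hz h1
  rw [h2, add_zero] at h
  exact ⟨GolyTc_eq_zero_of_curl hw h, h2⟩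

theorem eq_zero_of_grad_add {c : R3} {r : SPol 3} {z : VPol 3} (hz : z ∈ GolyTc c l)
    (h : grad 3 r + z = 0) : r = C (eval c r) ∧ z = 0 := by
  have h1 := eq_C_of_grad_add hz h
  rw [h1, grad_C, zero_add] at h
  exact ⟨h1, h⟩

/-- The gradient part of a vector potential is invisible to the curl, so the potential can be taken
in the complement of the gradients. -/
theorem exists_GolyTc_curl (c : R3) {v : VPol 3} (hv : v ∈ RolyT (l - 1)) :
    ∃ w ∈ GolyTc c l, curl w = v := by
  obtain ⟨u, hu, rfl⟩ := hv
  rw [sub_add_cancel] at hu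
  obtain ⟨r, _, z, hz, rfl⟩ := exists_grad_add c hu
  exact ⟨z, hz, by rw [map_add, curl_grad, zero_add]⟩

end Subspaces

end DDR

/-! ### Riesz representation and integrals of polynomials -/

namespace DDR

open MvPolynomial

section Riesz

variable {V W : Type*} [AddCommGroup V] [Module ℝ V] [AddCommGroup W] [Module ℝ W]

/-- Riesz representation on a finite-dimensional space `S`, with test functions parametrised by a
linear surjection `A` onto `S`, for a functional that vanishes on the kernel of `A`. -/
theorem existsUnique_riesz (S : Submodule ℝ W) [Module.Finite ℝ S] (B : W →ₗ[ℝ] W →ₗ[ℝ] ℝ)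
    (hB : ∀ u ∈ S, B u u = 0 → u = 0) (T : Submodule ℝ V) (A : V →ₗ[ℝ] W)
    (hA : ∀ v ∈ T, A v ∈ S) (hsurj : ∀ u ∈ S, ∃ v ∈ T, A v = u) (f : V →ₗ[ℝ] ℝ)
    (hker : ∀ v ∈ T, A v = 0 → f v = 0) :
    ∃! u : S, ∀ v ∈ T, B u.1 (A v) = f v := by
  have huniq : ∀ u : S, (∀ v ∈ T, B u.1 (A v) = 0) → u = 0 := fun u hu => by
    obtain ⟨v, hv, hvu⟩ := hsurj u.1 u.2
    have := hu v hv
    rw [hvu] at this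
    exact Subtype.ext (hB u.1 u.2 this)
  let A' : T →ₗ[ℝ] S := A.restrict hA
  have hA' : LinearMap.range A' = ⊤ := LinearMap.range_eq_top.2 fun u => by
    obtain ⟨v, hv, hvu⟩ := hsurj u.1 u.2
    exact ⟨⟨v, hv⟩, Subtype.ext hvu⟩
  -- `g` chooses a preimage under `A`. By `hker` the functional `f ∘ g` on `S` does not depend on
  -- this choice, and it is this functional that is represented.
  obtain ⟨g, hg⟩ := A'.exists_rightInverse_of_surjective hA'
  have hgA : ∀ v : T, f (g (A' v)).1 = f v.1 := fun v => by
    have h1 : A' (g (A' v) - v) = 0 := by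
      rw [map_sub, ← LinearMap.comp_apply A' g, hg, LinearMap.id_apply, sub_self]
    have := hker (g (A' v) - v).1 (g (A' v) - v).2 (congrArg Subtype.val h1)
    rw [Submodule.coe_sub, map_sub, sub_eq_zero] at this
    exact this
  let Φ : S →ₗ[ℝ] (S →ₗ[ℝ] ℝ) := B.domRestrict₁₂ S S
  have hΦ : Function.Injective Φ := by
    rw [injective_iff_map_eq_zero]
    intro u hu
    exact Subtype.ext (hB u.1 u.2 (LinearMap.congr_fun hu u))
  have hΦs : Function.Surjective Φ :=
    (LinearMap.injective_iff_surjective_of_finrank_eq_finrank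
      (Subspace.dual_finrank_eq (K := ℝ) (V := S)).symm).1 hΦ
  obtain ⟨u, hu⟩ := hΦs (f ∘ₗ T.subtype ∘ₗ g)
  refine ⟨u, fun v hv => ?_, fun u' hu' => ?_⟩
  · have := LinearMap.congr_fun hu (A' ⟨v, hv⟩)
    exact this.trans (hgA ⟨v, hv⟩)
  · rw [← sub_eq_zero]
    refine huniq _ fun v hv => ?_
    have := LinearMap.congr_fun hu (A' ⟨v, hv⟩)
    rw [Submodule.coe_sub, map_sub, LinearMap.sub_apply, hu' v hv, sub_eq_zero]
    exact (this.trans (hgA ⟨v, hv⟩)).symm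

theorem existsUnique_riesz' (S : Submodule ℝ W) [Module.Finite ℝ S] (B : W →ₗ[ℝ] W →ₗ[ℝ] ℝ)
    (hB : ∀ u ∈ S, B u u = 0 → u = 0) (f : W →ₗ[ℝ] ℝ) :
    ∃! u : S, ∀ v ∈ S, B u.1 v = f v :=
  existsUnique_riesz S B hB S LinearMap.id (fun _ h => h) (fun u hu => ⟨u, hu, rfl⟩) f
    fun v _ hv => by rw [show v = 0 from hv, map_zero]

end Riesz

theorem theSol_spec {α : Type*} [Zero α] {P : α → Prop} (h : ∃! x, P x) : P (theSol P) := by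
  unfold theSol
  rw [dif_pos h]
  exact h.choose_spec.1

/-- All identities between discrete operators are reduced to this: the candidate is checked against
the variational problem that defines the operator. -/
theorem theSol_eq {α : Type*} [Zero α] {P : α → Prop} (h : ∃! x, P x) {x : α} (hx : P x) :
    theSol P = x := h.unique (theSol_spec h) hx

section Integrals

variable {d : ℕ}

/-- Integral of polynomials over a bounded set. -/
noncomputable def intPoly {S : Set (Fin d → ℝ)} (hS : Bornology.IsBounded S) : SPol d →ₗ[ℝ] ℝ where
  toFun p := ∫ x in S, eval x p
  map_add' p q := by
    have h : ∀ p : SPol d, IntegrableOn (fun x => eval x p) S := fun p =>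
      ((continuous_eval' p).continuousOn.integrableOn_compact hS.isCompact_closure).mono_set
        subset_closure
    simp only [map_add]
    exact integral_add (h p) (h q)
  map_smul' c p := by
    simp only [smul_eval, RingHom.id_apply, smul_eq_mul]
    exact integral_const_mul _ _

/-- The symmetric form `L (p q)`. -/
noncomputable def mulForm {A : Type*} [CommRing A] [Algebra ℝ A] (L : A →ₗ[ℝ] ℝ) :
    A →ₗ[ℝ] A →ₗ[ℝ] ℝ := LinearMap.compr₂ (LinearMap.mul ℝ A) L

theorem mulForm_apply {A : Type*} [CommRing A] [Algebra ℝ A] (L : A →ₗ[ℝ] ℝ) (p q : A) :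
    mulForm L p q = L (p * q) := rfl

/-- The symmetric form `L (u · v)`. -/
noncomputable def dotForm (L : SPol d →ₗ[ℝ] ℝ) : VPol d →ₗ[ℝ] VPol d →ₗ[ℝ] ℝ :=
  LinearMap.mk₂ ℝ (fun u v => L (u ⬝ᵥ v))
    (fun u u' v => by rw [add_dotProduct, map_add])
    (fun c u v => by rw [smul_dotProduct, map_smul])
    (fun u v v' => by rw [dotProduct_add, map_add])
    (fun c u v => by rw [dotProduct_smul, map_smul])

/-- An open set contains a product of intervals, that is of infinite sets, and a polynomial is
determined by its values there. -/
theorem eq_zero_of_eval_open {S : Set (Fin d → ℝ)} (hS : IsOpen S) (hne : S.Nonempty) {p : SPol d}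
    (h : ∀ x ∈ S, eval x p = 0) : p = 0 := by
  obtain ⟨x, hx⟩ := hne
  obtain ⟨r, hr, hball⟩ := Metric.isOpen_iff.1 hS x hx
  refine MvPolynomial.funext_set (fun i => Metric.ball (x i) r) (fun i => ?_) fun y hy => ?_
  · rw [Real.ball_eq_Ioo]
    exact Set.Ioo_infinite (by linarith)
  · rw [map_zero]
    refine h y (hball ?_)
    rw [ball_pi _ hr]
    exact hy

/-- A continuous nonnegative function with zero integral vanishes on the open set, and then so does
each square in the sum. -/
theorem intPoly_dot_self {S : Set (Fin d → ℝ)} (hS : Bornology.IsBounded S) (hSo : IsOpen S)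
    (hne : S.Nonempty) {u : VPol d} (h : intPoly hS (u ⬝ᵥ u) = 0) : u = 0 := by
  have hnn : ∀ x, eval x (u ⬝ᵥ u) = ∑ i, eval x (u i) * eval x (u i) := fun x => by
    simp [dotProduct]
  have hcont := continuous_eval' (u ⬝ᵥ u)
  have hint : IntegrableOn (fun x => eval x (u ⬝ᵥ u)) S :=
    (hcont.continuousOn.integrableOn_compact hS.isCompact_closure).mono_set subset_closure
  have h1 : (fun x => eval x (u ⬝ᵥ u)) =ᵐ[volume.restrict S] 0 := by
    refine (setIntegral_eq_zero_iff_of_nonneg_ae ?_ hint).1 h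
    exact Filter.Eventually.of_forall fun x => by
      simp only [hnn]
      exact Finset.sum_nonneg fun i _ => mul_self_nonneg _
  have h2 := Measure.eqOn_open_of_ae_eq h1 hSo hcont.continuousOn continuousOn_const
  funext i
  refine eq_zero_of_eval_open hSo hne fun x hx => ?_
  have h3 := h2 hx
  simp only [hnn, Pi.zero_apply] at h3
  rw [Finset.sum_eq_zero_iff_of_nonneg fun i _ => mul_self_nonneg _] at h3
  exact mul_self_eq_zero.1 (h3 i (Finset.mem_univ i))

theorem intPoly_mul_self [NeZero d] {S : Set (Fin d → ℝ)} (hS : Bornology.IsBounded S)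
    (hSo : IsOpen S) (hne : S.Nonempty) {p : SPol d} (h : intPoly hS (p * p) = 0) : p = 0 := by
  have h2 : intPoly hS ((Pi.single 0 p : VPol d) ⬝ᵥ Pi.single 0 p) = 0 := by
    rw [dotProduct_single, Pi.single_eq_same]
    exact h
  have := congrFun (intPoly_dot_self hS hSo hne h2) 0
  rwa [Pi.single_eq_same] at this

/-- Integral of univariate polynomials over `[0, L]`. -/
noncomputable def intEdge (L : ℝ) : Polynomial ℝ →ₗ[ℝ] ℝ where
  toFun p := ∫ s in (0 : ℝ)..L, p.eval s
  map_add' p q := by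
    simp only [Polynomial.eval_add]
    exact intervalIntegral.integral_add (p.continuous.intervalIntegrable _ _)
      (q.continuous.intervalIntegrable _ _)
  map_smul' c p := by
    simp only [Polynomial.eval_smul, RingHom.id_apply, smul_eq_mul]
    exact intervalIntegral.integral_const_mul _ _

theorem intEdge_derivative (L : ℝ) (p : Polynomial ℝ) :
    intEdge L (Polynomial.derivative p) = p.eval L - p.eval 0 :=
  intervalIntegral.integral_eq_sub_of_hasDerivAt (fun s _ => p.hasDerivAt s)
    ((Polynomial.derivative p).continuous.intervalIntegrable _ _)

/-- A nonzero polynomial has finitely many roots, so its square is positive somewhere on `(0, L)`.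
-/
theorem intEdge_mul_self {L : ℝ} (hL : 0 < L) {p : Polynomial ℝ} (h : intEdge L (p * p) = 0) :
    p = 0 := by
  by_contra hp
  have hroots : (Set.Ioo 0 L \ {s | p.IsRoot s}).Nonempty :=
    ((Set.Ioo_infinite hL).sdiff (Polynomial.finite_setOfPred_isRoot hp)).nonempty
  obtain ⟨s, hs, hs0⟩ := hroots
  refine absurd h (ne_of_gt ?_)
  refine intervalIntegral.integral_pos hL (p * p).continuous.continuousOn
    (fun s _ => by rw [Polynomial.eval_mul]; exact mul_self_nonneg _)
    ⟨s, Set.Ioo_subset_Icc_self hs, ?_⟩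
  rw [Polynomial.eval_mul]
  exact mul_self_pos.2 hs0

/-- Antiderivative of a univariate polynomial, vanishing at the origin. -/
noncomputable def antideriv (p : Polynomial ℝ) : Polynomial ℝ :=
  p.sum fun n a => Polynomial.monomial (n + 1) (a / (n + 1))

theorem derivative_antideriv (p : Polynomial ℝ) : Polynomial.derivative (antideriv p) = p := by
  unfold antideriv
  rw [Polynomial.sum_def, map_sum]
  conv_rhs => rw [p.as_sum_support]
  refine Finset.sum_congr rfl fun n _ => ?_
  rw [Polynomial.derivative_monomial, Nat.add_sub_cancel]
  congr 1
  have : ((n : ℝ) + 1) ≠ 0 := by positivity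
  push_cast
  field_simp

theorem antideriv_eval_zero (p : Polynomial ℝ) : (antideriv p).eval 0 = 0 := by
  simp [antideriv, Polynomial.sum_def, Polynomial.eval_finsetSum]

/-- Trades the truncated exponent `(l + 1).toNat` for an integer bound, so that `l = -1` needs no
separate treatment. -/
theorem mem_PolE_iff {l : ℤ} {p : Polynomial ℝ} :
    p ∈ PolE l ↔ ∀ n ∈ p.support, (n : ℤ) ≤ l := by
  rw [PolE, Polynomial.mem_degreeLT]
  constructor
  · intro h n hn
    have := lt_of_le_of_lt (Polynomial.le_degree_of_mem_supp n hn) h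
    have : n < (l + 1).toNat := by exact_mod_cast this
    omega
  · intro h
    rw [Polynomial.degree_lt_iff_coeff_zero]
    intro n hn
    by_contra h'
    have := h n (Polynomial.mem_support_iff.2 h')
    omega

theorem antideriv_mem {l : ℤ} {p : Polynomial ℝ} (hp : p ∈ PolE l) : antideriv p ∈ PolE (l + 1) := by
  refine sum_mem fun n hn => mem_PolE_iff.2 fun m hm => ?_
  have h1 := mem_PolE_iff.1 hp n hn
  have h2 := Polynomial.support_monomial_subset _ _ hm
  rw [Finset.mem_singleton] at h2
  rw [h2]
  push_cast
  linarith

theorem derivative_mem {l : ℤ} {p : Polynomial ℝ} (hp : p ∈ PolE l) :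
    Polynomial.derivative p ∈ PolE (l - 1) := by
  refine mem_PolE_iff.2 fun n hn => ?_
  rw [Polynomial.mem_support_iff, Polynomial.coeff_derivative] at hn
  have := mem_PolE_iff.1 hp (n + 1) (Polynomial.mem_support_iff.2 (left_ne_zero_of_mul hn))
  push_cast at this
  linarith

theorem C_mem_PolE {l : ℤ} (hl : 0 ≤ l) (a : ℝ) : Polynomial.C a ∈ PolE l := by
  refine mem_PolE_iff.2 fun n hn => ?_
  have := Polynomial.support_C_subset a hn
  rw [Finset.mem_singleton] at this
  simpa [this] using hl

theorem eq_C_of_derivative_eq_zero {p : Polynomial ℝ} (h : Polynomial.derivative p = 0) :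
    p = Polynomial.C (p.eval 0) := by
  rw [Polynomial.eq_C_of_derivative_eq_zero h]
  simp

end Integrals

end DDR

/-! ### Restriction of polynomials to faces and edges -/

namespace DDR

namespace MeshData

open MvPolynomial

variable (M : MeshData)

/-- Restriction of polynomials to the plane of a face, in face coordinates. -/
noncomputable def resF (F : Fin M.nF) : SPol 3 →ₐ[ℝ] SPol 2 :=
  aeval fun i => C (M.ctrF F i) + C (M.e₁ F i) * X 0 + C (M.e₂ F i) * X 1

/-- Coordinates of the unit tangent of an edge in the basis of the plane of a face. -/
noncomputable def tau (F : Fin M.nF) (E : Fin M.nE) : R2 :=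
  ![M.e₁ F ⬝ᵥ M.tangent E, M.e₂ F ⬝ᵥ M.tangent E]

/-- Restriction of polynomials in the face coordinates to the line of an edge. -/
noncomputable def resE (F : Fin M.nF) (E : Fin M.nE) : SPol 2 →ₐ[ℝ] Polynomial ℝ :=
  aeval fun a => Polynomial.C (M.coord F (M.pos (M.tail E)) a) +
    Polynomial.C (M.tau F E a) * Polynomial.X

/-- Restriction of polynomials to the line of an edge. -/
noncomputable def resET (E : Fin M.nE) : SPol 3 →ₐ[ℝ] Polynomial ℝ :=
  aeval fun i => Polynomial.C (M.pos (M.tail E) i) + Polynomial.C (M.tangent E i) * Polynomial.X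

/-- Restriction to a face of the component of a field along a fixed vector. -/
noncomputable def resDot (F : Fin M.nF) (e : R3) : VPol 3 →ₗ[ℝ] SPol 2 :=
  ∑ i, e i • ((M.resF F).toLinearMap ∘ₗ LinearMap.proj i)

/-- The tangent field `w × n_F` on a face, in face coordinates. -/
noncomputable def tanF (F : Fin M.nF) : VPol 3 →ₗ[ℝ] VPol 2 :=
  LinearMap.pi ![M.resDot F (M.e₂ F), - M.resDot F (M.e₁ F)]

/-- Normal component on an edge of a tangent field on a face. -/
noncomputable def nrmE (F : Fin M.nF) (E : Fin M.nE) : VPol 2 →ₗ[ℝ] Polynomial ℝ :=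
  M.tau F E 0 • ((M.resE F E).toLinearMap ∘ₗ LinearMap.proj 1) -
    M.tau F E 1 • ((M.resE F E).toLinearMap ∘ₗ LinearMap.proj 0)

/-- Tangential component of a field on an edge. -/
noncomputable def tanE (E : Fin M.nE) : VPol 3 →ₗ[ℝ] Polynomial ℝ :=
  ∑ i, M.tangent E i • ((M.resET E).toLinearMap ∘ₗ LinearMap.proj i)

theorem eval_resF (F : Fin M.nF) (y : R2) (p : SPol 3) :
    eval y (M.resF F p) = eval (M.chart F y) p := by
  induction p using MvPolynomial.induction_on with
  | C a => simp [resF]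
  | add p q hp hq => simp only [map_add, hp, hq]
  | mul_X p i hp =>
    rw [map_mul, map_mul, map_mul, hp]
    congr 1
    simp [resF, chart, lift]
    ring

theorem coord_edgePt (F : Fin M.nF) (E : Fin M.nE) (s : ℝ) (a : Fin 2) :
    M.coord F (M.edgePt E s) a = M.coord F (M.pos (M.tail E)) a + M.tau F E a * s := by
  have h : M.edgePt E s - M.ctrF F = (M.pos (M.tail E) - M.ctrF F) + s • M.tangent E := by
    rw [edgePt]; abel
  fin_cases a <;> simp only [coord, tau, h, dotProduct_add, dotProduct_smul] <;>
    simp [mul_comm]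

theorem eval_resE (F : Fin M.nF) (E : Fin M.nE) (s : ℝ) (p : SPol 2) :
    (M.resE F E p).eval s = eval (M.coord F (M.edgePt E s)) p := by
  induction p using MvPolynomial.induction_on with
  | C a => simp [resE]
  | add p q hp hq => simp only [map_add, Polynomial.eval_add, hp, hq]
  | mul_X p i hp =>
    rw [map_mul, map_mul, Polynomial.eval_mul, hp, eval_X, coord_edgePt]
    simp [resE]

theorem eval_resET (E : Fin M.nE) (s : ℝ) (p : SPol 3) :
    (M.resET E p).eval s = eval (M.edgePt E s) p := by
  induction p using MvPolynomial.induction_on with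
  | C a => simp [resET]
  | add p q hp hq => simp only [map_add, Polynomial.eval_add, hp, hq]
  | mul_X p i hp =>
    rw [map_mul, map_mul, Polynomial.eval_mul, hp, eval_X]
    simp only [resET, edgePt, aeval_X, Polynomial.eval_add, Polynomial.eval_mul,
      Polynomial.eval_C, Polynomial.eval_X, Pi.add_apply, Pi.smul_apply, smul_eq_mul]
    ring

theorem pderiv_resF_zero (F : Fin M.nF) (p : SPol 3) :
    pderiv 0 (M.resF F p) = ∑ i, M.e₁ F i • M.resF F (pderiv i p) := by
  induction p using MvPolynomial.induction_on with
  | C a => simp [resF]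
  | add p q hp hq => simp only [map_add, hp, hq, smul_add, Finset.sum_add_distrib]
  | mul_X p j hp =>
    simp only [map_mul, Derivation.leibniz, smul_eq_mul, map_add, pderiv_X, hp, smul_add,
      Finset.sum_add_distrib, Finset.mul_sum]
    have hX : pderiv 0 (M.resF F (X j)) = C (M.e₁ F j) := by
      simp [resF, pderiv_X]
    rw [hX]
    congr 1
    · rw [Finset.sum_eq_single j]
      · simp [MvPolynomial.smul_eq_C_mul, mul_comm]
      · intro b _ hb
        simp [hb.symm]
      · simp
    · exact Finset.sum_congr rfl fun i _ => by rw [mul_smul_comm]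

theorem pderiv_resF_one (F : Fin M.nF) (p : SPol 3) :
    pderiv 1 (M.resF F p) = ∑ i, M.e₂ F i • M.resF F (pderiv i p) := by
  induction p using MvPolynomial.induction_on with
  | C a => simp [resF]
  | add p q hp hq => simp only [map_add, hp, hq, smul_add, Finset.sum_add_distrib]
  | mul_X p j hp =>
    simp only [map_mul, Derivation.leibniz, smul_eq_mul, map_add, pderiv_X, hp, smul_add,
      Finset.sum_add_distrib, Finset.mul_sum]
    have hX : pderiv 1 (M.resF F (X j)) = C (M.e₂ F j) := by
      simp [resF, pderiv_X]
    rw [hX]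
    congr 1
    · rw [Finset.sum_eq_single j]
      · simp [MvPolynomial.smul_eq_C_mul, mul_comm]
      · intro b _ hb
        simp [hb.symm]
      · simp
    · exact Finset.sum_congr rfl fun i _ => by rw [mul_smul_comm]

theorem derivative_resE (F : Fin M.nF) (E : Fin M.nE) (p : SPol 2) :
    Polynomial.derivative (M.resE F E p) = ∑ a, M.tau F E a • M.resE F E (pderiv a p) := by
  induction p using MvPolynomial.induction_on with
  | C a => simp [resE]
  | add p q hp hq => simp only [map_add, hp, hq, smul_add, Finset.sum_add_distrib]
  | mul_X p j hp =>
    simp only [map_mul, Polynomial.derivative_mul, hp, Derivation.leibniz, smul_eq_mul, map_add,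
      smul_add, Finset.sum_add_distrib, Finset.sum_mul, pderiv_X]
    have hX : Polynomial.derivative (M.resE F E (X j)) = Polynomial.C (M.tau F E j) := by
      simp [resE]
    rw [hX, add_comm]
    congr 1
    · rw [Finset.sum_eq_single j]
      · simp [Polynomial.smul_eq_C_mul, mul_comm]
      · intro b _ hb
        simp [hb.symm]
      · simp
    · exact Finset.sum_congr rfl fun i _ => by rw [smul_mul_assoc, mul_comm]

/-- Restriction substitutes affine functions for the variables, so the degree does not grow; this is
checked on monomials. -/
theorem resF_mem {l : ℤ} (F : Fin M.nF) {p : SPol 3} (hp : p ∈ PolS 3 l) :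
    M.resF F p ∈ PolS 2 l := by
  have hlin : ∀ i, M.resF F (X i) ∈ PolS 2 1 := fun i => by
    have hC : ∀ (a : ℝ) (j : Fin 2), C a * X j ∈ PolS 2 1 := fun a j => by
      rw [← zero_add (1 : ℤ)]
      exact mul_mem_PolS (C_mem_PolS a le_rfl) (X_mem_PolS j le_rfl)
    rw [resF, aeval_X]
    exact add_mem (add_mem (C_mem_PolS _ zero_le_one) (hC _ _)) (hC _ _)
  have hmon : ∀ (a : Fin 3 →₀ ℕ) (c : ℝ), M.resF F (monomial a c) ∈ PolS 2 (a.degree : ℤ) := by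
    intro a
    induction a using Finsupp.induction_linear with
    | zero => intro c; simpa [resF] using C_mem_PolS c le_rfl
    | add a b ha hb =>
      intro c
      rw [← mul_one c, ← monomial_mul, map_mul, map_add, Nat.cast_add]
      exact mul_mem_PolS (ha c) (hb 1)
    | single i n =>
      induction n with
      | zero => intro c; simpa [resF] using C_mem_PolS c le_rfl
      | succ n ih =>
        intro c
        rw [Finsupp.single_add, ← mul_one c, ← monomial_mul, map_mul, map_add, Nat.cast_add,
          Finsupp.degree_single i 1]
        exact mul_mem_PolS (ih c) (by simpa only [Nat.cast_one] using! hlin i)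
  rw [p.as_sum, map_sum]
  exact sum_mem fun a ha => PolS_mono 2 (hp ha) (hmon a _)

theorem resDot_apply (F : Fin M.nF) (e : R3) (w : VPol 3) :
    M.resDot F e w = ∑ i, e i • M.resF F (w i) := by
  simp [resDot]

theorem resDot_mem {l : ℤ} (F : Fin M.nF) (e : R3) {w : VPol 3} (hw : w ∈ PolV 3 l) :
    M.resDot F e w ∈ PolS 2 l := by
  rw [resDot_apply]
  exact sum_mem fun i _ => Submodule.smul_mem _ _ (M.resF_mem F (mem_PolV_iff.1 hw i))

theorem eval_resDot (F : Fin M.nF) (e : R3) (w : VPol 3) (y : R2) :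
    eval y (M.resDot F e w) = ev w (M.chart F y) ⬝ᵥ e := by
  rw [resDot_apply, map_sum, dotProduct]
  exact Finset.sum_congr rfl fun i _ => by rw [smul_eval, eval_resF, ev, mul_comm]

theorem tanF_apply (F : Fin M.nF) (w : VPol 3) :
    M.tanF F w = ![M.resDot F (M.e₂ F) w, - M.resDot F (M.e₁ F) w] := by
  ext1 i
  fin_cases i <;> rfl

theorem tanF_mem {l : ℤ} (F : Fin M.nF) {w : VPol 3} (hw : w ∈ PolV 3 l) :
    M.tanF F w ∈ PolV 2 l := by
  rw [tanF_apply, mem_PolV_iff]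
  intro i
  fin_cases i
  · exact M.resDot_mem F _ hw
  · exact neg_mem (M.resDot_mem F _ hw)

theorem nrmE_apply (F : Fin M.nF) (E : Fin M.nE) (v : VPol 2) :
    M.nrmE F E v = M.tau F E 0 • M.resE F E (v 1) - M.tau F E 1 • M.resE F E (v 0) := rfl

theorem tanE_apply (E : Fin M.nE) (w : VPol 3) :
    M.tanE E w = ∑ i, M.tangent E i • M.resET E (w i) := by
  simp [tanE]

theorem eval_tanE (E : Fin M.nE) (w : VPol 3) (s : ℝ) :
    (M.tanE E w).eval s = ev w (M.edgePt E s) ⬝ᵥ M.tangent E := by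
  rw [tanE_apply, Polynomial.eval_finsetSum, dotProduct]
  exact Finset.sum_congr rfl fun i _ => by
    rw [Polynomial.eval_smul, eval_resET, ev, smul_eq_mul, mul_comm]

/-- The pointwise form of Stokes' theorem: with Green's formula it turns the flux of a curl through
a face into a circulation along its edges. -/
theorem vdiv_tanF (F : Fin M.nF) (w : VPol 3) :
    vdiv (M.tanF F w) = M.resDot F (M.normalF F) (curl w) := by
  rw [tanF_apply, vdiv, Fin.sum_univ_two]
  simp only [Matrix.cons_val_zero, Matrix.cons_val_one, map_neg, resDot_apply, map_add,
    Derivation.map_smul, pderiv_resF_zero, pderiv_resF_one, normalF, cross_apply, curl,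
    LinearMap.coe_mk, AddHom.coe_mk, Fin.sum_univ_three, Matrix.cons_val, map_sub]
  module

theorem tanF_grad (F : Fin M.nF) (r : SPol 3) : M.tanF F (grad 3 r) = vrot (M.resF F r) := by
  rw [tanF_apply, resDot_apply, resDot_apply]
  simp only [vrot, perp, grad, LinearMap.coe_mk, AddHom.coe_mk, pderiv_resF_zero, pderiv_resF_one]

/-- The rotational is the gradient turned by `-π/2` and `n_FE` is the tangent turned by `π/2`, which
leaves minus the tangential derivative. -/
theorem nrmE_vrot (F : Fin M.nF) (E : Fin M.nE) (r : SPol 2) :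
    M.nrmE F E (vrot r) = - Polynomial.derivative (M.resE F E r) := by
  rw [nrmE_apply, derivative_resE, Fin.sum_univ_two]
  simp only [vrot, perp, grad, LinearMap.coe_mk, AddHom.coe_mk, Matrix.cons_val_zero,
    Matrix.cons_val_one, map_neg, smul_neg]
  abel

end MeshData

end DDR

/-! ### Frames of faces and edges in a mesh -/

namespace DDR

theorem dot3 (u v : R3) : u ⬝ᵥ v = u 0 * v 0 + u 1 * v 1 + u 2 * v 2 := by
  simp [dotProduct, Fin.sum_univ_three]

namespace MeshData

open MvPolynomial Set

variable {M : MeshData} {Ω : Set R3}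

theorem chart_apply (F : Fin M.nF) (y : R2) (i : Fin 3) :
    M.chart F y i = M.ctrF F i + (y 0 * M.e₁ F i + y 1 * M.e₂ F i) := by
  simp [chart, lift]

theorem continuous_chart (F : Fin M.nF) : Continuous (M.chart F) := by
  unfold chart lift; fun_prop

namespace IsPolyhedralMesh

theorem coord_chart (hM : M.IsPolyhedralMesh Ω) (F : Fin M.nF) (y : R2) :
    M.coord F (M.chart F y) = y := by
  have h21 : M.e₂ F ⬝ᵥ M.e₁ F = 0 := by rw [dotProduct_comm, hM.e₁_orth_e₂]
  have : M.chart F y - M.ctrF F = M.lift F y := by rw [chart, add_sub_cancel_left]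
  ext a
  fin_cases a <;> simp only [coord, this, lift, dotProduct_add, dotProduct_smul] <;>
    simp [hM.e₁_unit, hM.e₂_unit, hM.e₁_orth_e₂, h21]

theorem chart_injective (hM : M.IsPolyhedralMesh Ω) (F : Fin M.nF) :
    Function.Injective (M.chart F) := fun y y' h => by
  rw [← hM.coord_chart F y, h, hM.coord_chart]

theorem normalF_cross_e₁ (hM : M.IsPolyhedralMesh Ω) (F : Fin M.nF) :
    M.normalF F ⨯₃ M.e₁ F = M.e₂ F := by
  have h1 := hM.e₁_unit F
  have h2 := hM.e₁_orth_e₂ F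
  rw [dot3] at h1 h2
  rw [normalF, cross_apply, cross_apply]
  ext i
  fin_cases i <;> simp
  · linear_combination M.e₂ F 0 * h1 - M.e₁ F 0 * h2
  · linear_combination M.e₂ F 1 * h1 - M.e₁ F 1 * h2
  · linear_combination M.e₂ F 2 * h1 - M.e₁ F 2 * h2

theorem normalF_cross_e₂ (hM : M.IsPolyhedralMesh Ω) (F : Fin M.nF) :
    M.normalF F ⨯₃ M.e₂ F = - M.e₁ F := by
  have h1 := hM.e₂_unit F
  have h2 := hM.e₁_orth_e₂ F
  rw [dot3] at h1 h2
  rw [normalF, cross_apply, cross_apply]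
  ext i
  fin_cases i <;> simp
  · linear_combination - M.e₁ F 0 * h1 + M.e₂ F 0 * h2
  · linear_combination - M.e₁ F 1 * h1 + M.e₂ F 1 * h2
  · linear_combination - M.e₁ F 2 * h1 + M.e₂ F 2 * h2

theorem normalF_unit (hM : M.IsPolyhedralMesh Ω) (F : Fin M.nF) :
    M.normalF F ⬝ᵥ M.normalF F = 1 := by
  rw [normalF, cross_dot_cross, hM.e₁_unit, hM.e₂_unit, hM.e₁_orth_e₂]
  ring

theorem e₁_dot_normalFE (hM : M.IsPolyhedralMesh Ω) (F : Fin M.nF) (E : Fin M.nE) :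
    M.e₁ F ⬝ᵥ M.normalFE F E = - M.tau F E 1 := by
  rw [normalFE, triple_product_permutation, triple_product_permutation, ← cross_anticomm,
    dotProduct_neg, hM.normalF_cross_e₁, dotProduct_comm]
  rfl

theorem e₂_dot_normalFE (hM : M.IsPolyhedralMesh Ω) (F : Fin M.nF) (E : Fin M.nE) :
    M.e₂ F ⬝ᵥ M.normalFE F E = M.tau F E 0 := by
  rw [normalFE, triple_product_permutation, triple_product_permutation, ← cross_anticomm,
    dotProduct_neg, hM.normalF_cross_e₂, dotProduct_neg, neg_neg, dotProduct_comm]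
  rfl

theorem normalComp_eq (hM : M.IsPolyhedralMesh Ω) (F : Fin M.nF) (E : Fin M.nE) (v : VPol 2)
    (s : ℝ) :
    M.normalComp F v E (M.coord F (M.edgePt E s)) = (M.nrmE F E v).eval s := by
  rw [normalComp, lift, add_dotProduct, smul_dotProduct, smul_dotProduct, hM.e₁_dot_normalFE,
    hM.e₂_dot_normalFE, nrmE_apply, Polynomial.eval_sub, Polynomial.eval_smul,
    Polynomial.eval_smul, eval_resE, eval_resE]
  simp only [ev, smul_eq_mul]
  ring

theorem lift_dot_cross (hM : M.IsPolyhedralMesh Ω) (F : Fin M.nF) (u : VPol 2) (w : VPol 3)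
    (y : R2) :
    M.lift F (ev u y) ⬝ᵥ (ev w (M.chart F y) ⨯₃ M.normalF F) = eval y (u ⬝ᵥ M.tanF F w) := by
  have h : ∀ e : R3, e ⬝ᵥ (ev w (M.chart F y) ⨯₃ M.normalF F) =
      ev w (M.chart F y) ⬝ᵥ (M.normalF F ⨯₃ e) := fun e => triple_product_permutation _ _ _
  rw [lift, add_dotProduct, smul_dotProduct, smul_dotProduct, h, h, hM.normalF_cross_e₁,
    hM.normalF_cross_e₂, show u ⬝ᵥ M.tanF F w = u 0 * M.tanF F w 0 + u 1 * M.tanF F w 1 from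
      Fin.sum_univ_two _, map_add, map_mul, map_mul, tanF_apply]
  simp only [Matrix.cons_val_zero, Matrix.cons_val_one, map_neg, eval_resDot, dotProduct_neg,
    smul_eq_mul, ev]

theorem len_pos (hM : M.IsPolyhedralMesh Ω) (E : Fin M.nE) : 0 < M.len E := by
  have hne : M.pos (M.head E) - M.pos (M.tail E) ≠ 0 := fun h =>
    hM.tail_ne_head E (hM.pos_injective (sub_eq_zero.1 h).symm)
  refine Real.sqrt_pos.2 (lt_of_le_of_ne ?_ (fun h => hne (dotProduct_self_eq_zero.1 h.symm)))
  exact Finset.sum_nonneg fun i _ => mul_self_nonneg _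

theorem len_smul_tangent (hM : M.IsPolyhedralMesh Ω) (E : Fin M.nE) :
    M.len E • M.tangent E = M.pos (M.head E) - M.pos (M.tail E) := by
  rw [tangent, smul_inv_smul₀ (hM.len_pos E).ne']

theorem edgePt_len (hM : M.IsPolyhedralMesh Ω) (E : Fin M.nE) :
    M.edgePt E (M.len E) = M.pos (M.head E) := by
  rw [edgePt, hM.len_smul_tangent, add_sub_cancel]

theorem tangent_unit (hM : M.IsPolyhedralMesh Ω) (E : Fin M.nE) :
    M.tangent E ⬝ᵥ M.tangent E = 1 := by
  have h : M.len E * M.len E =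
      (M.pos (M.head E) - M.pos (M.tail E)) ⬝ᵥ (M.pos (M.head E) - M.pos (M.tail E)) :=
    Real.mul_self_sqrt (Finset.sum_nonneg fun i _ => mul_self_nonneg _)
  have hL := (hM.len_pos E).ne'
  rw [tangent, smul_dotProduct, dotProduct_smul, ← h, smul_eq_mul, smul_eq_mul]
  field_simp

theorem edgeSet_eq (hM : M.IsPolyhedralMesh Ω) (E : Fin M.nE) :
    M.edgeSet E = M.edgePt E '' Ioo 0 (M.len E) := by
  have hL := hM.len_pos E
  rw [edgeSet, openSegment_eq_image']
  ext x
  constructor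
  · rintro ⟨t, ht, rfl⟩
    refine ⟨t * M.len E, ⟨mul_pos ht.1 hL, by nlinarith [ht.2]⟩, ?_⟩
    rw [edgePt, mul_smul, hM.len_smul_tangent]
  · rintro ⟨s, hs, rfl⟩
    refine ⟨s / M.len E, ⟨div_pos hs.1 hL, (div_lt_one hL).2 hs.2⟩, ?_⟩
    simp only
    rw [edgePt, ← hM.len_smul_tangent, smul_smul, div_mul_cancel₀ _ hL.ne']

theorem edgeClosure_eq (hM : M.IsPolyhedralMesh Ω) (E : Fin M.nE) :
    M.edgeClosure E = M.edgePt E '' Icc 0 (M.len E) := by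
  have hL := hM.len_pos E
  rw [edgeClosure, segment_eq_image']
  ext x
  constructor
  · rintro ⟨t, ht, rfl⟩
    refine ⟨t * M.len E, ⟨mul_nonneg ht.1 hL.le, by nlinarith [ht.2]⟩, ?_⟩
    rw [edgePt, mul_smul, hM.len_smul_tangent]
  · rintro ⟨s, hs, rfl⟩
    refine ⟨s / M.len E, ⟨div_nonneg hs.1 hL.le, (div_le_one hL).2 hs.2⟩, ?_⟩
    simp only
    rw [edgePt, ← hM.len_smul_tangent, smul_smul, div_mul_cancel₀ _ hL.ne']

theorem edgeSet_subset {F : Fin M.nF} {E : Fin M.nE} (hE : E ∈ M.edgesOf F) :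
    M.edgeSet E ⊆ M.faceFrontier F := by
  classical
  exact (Finset.mem_filter.1 hE).2

/-- The line of an edge of a face lies in the plane of the face. -/
theorem chart_coord_edgePt (hM : M.IsPolyhedralMesh Ω) {F : Fin M.nF} {E : Fin M.nE}
    (hE : E ∈ M.edgesOf F) (s : ℝ) : M.chart F (M.coord F (M.edgePt E s)) = M.edgePt E s := by
  have hL := hM.len_pos E
  have h0 : ∀ s ∈ Ioo 0 (M.len E), M.chart F (M.coord F (M.edgePt E s)) = M.edgePt E s := by
    intro s hs
    obtain ⟨y, -, hy⟩ := edgeSet_subset hE (hM.edgeSet_eq E ▸ mem_image_of_mem _ hs)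
    rw [← hy, hM.coord_chart]
  -- The difference is affine in `s` and vanishes on the open edge, so two interior parameters force
  -- it to vanish on the whole line.
  have key : ∀ s i, M.chart F (M.coord F (M.edgePt E s)) i - M.edgePt E s i =
      (M.ctrF F i + (M.coord F (M.pos (M.tail E)) 0 * M.e₁ F i +
        M.coord F (M.pos (M.tail E)) 1 * M.e₂ F i) - M.pos (M.tail E) i) +
      s * (M.tau F E 0 * M.e₁ F i + M.tau F E 1 * M.e₂ F i - M.tangent E i) := by
    intro s i
    rw [chart_apply, coord_edgePt, coord_edgePt, edgePt]
    simp only [Pi.add_apply, Pi.smul_apply, smul_eq_mul]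
    ring
  ext i
  have ha := key (M.len E / 3) i
  have hb := key (M.len E / 2) i
  rw [h0 _ ⟨by linarith, by linarith⟩, sub_self] at ha hb
  rw [← sub_eq_zero, key]
  have hc : M.tau F E 0 * M.e₁ F i + M.tau F E 1 * M.e₂ F i - M.tangent E i = 0 := by
    have : M.len E * (M.tau F E 0 * M.e₁ F i + M.tau F E 1 * M.e₂ F i - M.tangent E i) = 0 := by
      linear_combination 6 * ha - 6 * hb
    exact (mul_eq_zero.1 this).resolve_left hL.ne'
  rw [hc] at ha ⊢
  linarith

theorem lift_tau (hM : M.IsPolyhedralMesh Ω) {F : Fin M.nF} {E : Fin M.nE}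
    (hE : E ∈ M.edgesOf F) : M.lift F (M.tau F E) = M.tangent E := by
  ext i
  have h0 := congrFun (hM.chart_coord_edgePt hE 0) i
  have h1 := congrFun (hM.chart_coord_edgePt hE 1) i
  rw [chart_apply, coord_edgePt, coord_edgePt, edgePt] at h0 h1
  simp only [Pi.add_apply, Pi.smul_apply, smul_eq_mul, lift] at *
  linarith

theorem tau_unit (hM : M.IsPolyhedralMesh Ω) {F : Fin M.nF} {E : Fin M.nE}
    (hE : E ∈ M.edgesOf F) : M.tau F E 0 * M.tau F E 0 + M.tau F E 1 * M.tau F E 1 = 1 := by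
  have h := hM.tangent_unit E
  nth_rewrite 1 [← hM.lift_tau hE] at h
  rw [lift, add_dotProduct, smul_dotProduct, smul_dotProduct] at h
  exact h

theorem lift_nrm (hM : M.IsPolyhedralMesh Ω) {F : Fin M.nF} {E : Fin M.nE}
    (hE : E ∈ M.edgesOf F) :
    M.lift F ![- M.tau F E 1, M.tau F E 0] = M.normalFE F E := by
  rw [normalFE, ← hM.lift_tau hE, lift, lift, map_add, map_smul, map_smul, hM.normalF_cross_e₁,
    hM.normalF_cross_e₂]
  simp [add_comm]

/-- `(w × n_F) · n_FE = w · (n_F × (n_F × t_E)) = - w · t_E`. The result no longer depends on the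
face, so edge terms of different faces of an element can cancel. -/
theorem nrmE_tanF (hM : M.IsPolyhedralMesh Ω) {F : Fin M.nF} {E : Fin M.nE}
    (hE : E ∈ M.edgesOf F) (w : VPol 3) : M.nrmE F E (M.tanF F w) = - M.tanE E w := by
  refine Polynomial.funext fun s => ?_
  rw [Polynomial.eval_neg, eval_tanE, nrmE_apply, tanF_apply, Polynomial.eval_sub,
    Polynomial.eval_smul, Polynomial.eval_smul, eval_resE, eval_resE, ← hM.lift_tau hE, lift]
  simp only [Matrix.cons_val_zero, Matrix.cons_val_one, map_neg, eval_resDot,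
    hM.chart_coord_edgePt hE, smul_eq_mul, dotProduct_add, dotProduct_smul]
  ring

end IsPolyhedralMesh

end MeshData

end DDR

/-! ### Interpolation, approximation, and the divergence theorem on faces and elements -/

namespace DDR

open MvPolynomial Set

theorem hasDerivAt_insertNth {n : ℕ} (i : Fin (n + 1)) (p : SPol (n + 1)) (z : Fin n → ℝ) (t : ℝ) :
    HasDerivAt (fun t => eval (i.insertNth t z) p) (eval (i.insertNth t z) (pderiv i p)) t := by
  have := hasDerivAt_eval p (x := fun t => i.insertNth t z) (x' := Pi.single i 1) (t := t) ?_
  · convert! this using 1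
    simp [Pi.single_apply]
  · intro j
    rcases eq_or_ne j i with rfl | hj
    · simpa using hasDerivAt_id' t
    · obtain ⟨a, rfl⟩ := Fin.exists_succAbove_eq hj
      simpa using hasDerivAt_const t (z a)

/-- The divergence theorem for polynomial fields. -/
theorem IsFlatBoundary.integral_vdiv {n : ℕ} {ι : Type*} {U : Set (Fin (n + 1) → ℝ)}
    {J : Finset ι} {P : ι → FlatPiece n} (hB : IsFlatBoundary U J P) (v : VPol (n + 1)) :
    ∫ x in U, eval x (vdiv v) =
      ∑ j ∈ J, (P j).sgn * ∫ y in (P j).dom, (P j).nrm ⬝ᵥ ev v ((P j).param y) := by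
  have hint : ∀ p : SPol (n + 1), IntegrableOn (fun x => eval x p) U := fun p =>
    ((continuous_eval' p).continuousOn.integrableOn_compact
      hB.bounded.isCompact_closure).mono_set subset_closure
  have hint2 : ∀ j i, IntegrableOn (fun y => (P j).nrm i * eval ((P j).param y) (v i))
      (P j).dom := fun j i =>
    ((continuous_const.mul ((continuous_eval' (v i)).comp
      (P j).continuous_param)).continuousOn.integrableOn_compact
      (P j).bounded.isCompact_closure).mono_set subset_closure
  calc ∫ x in U, eval x (vdiv v) = ∫ x in U, ∑ i, eval x (pderiv i (v i)) := by
        simp only [vdiv, map_sum]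
    _ = ∑ i, ∫ x in U, eval x (pderiv i (v i)) := integral_finsetSum _ fun i _ => hint _
    _ = ∑ i, ∑ j ∈ J, (P j).sgn * (P j).nrm i * ∫ y in (P j).dom, eval ((P j).param y) (v i) :=
        Finset.sum_congr rfl fun i _ => hB.integral_deriv i (continuous_eval' _)
          (continuous_eval' _) fun z t => hasDerivAt_insertNth i (v i) z t
    _ = ∑ j ∈ J, (P j).sgn * ∑ i, ∫ y in (P j).dom, (P j).nrm i * eval ((P j).param y) (v i) := by
        rw [Finset.sum_comm]
        refine Finset.sum_congr rfl fun j _ => ?_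
        rw [Finset.mul_sum]
        exact Finset.sum_congr rfl fun i _ => by rw [integral_const_mul, mul_assoc]
    _ = _ := by
        refine Finset.sum_congr rfl fun j _ => ?_
        rw [← integral_finsetSum _ fun i _ => hint2 j i]
        rfl

/-- Polynomials interpolate arbitrary values at finitely many points. -/
theorem exists_eval_eq {d : ℕ} {ι : Type*} [Fintype ι] {x : ι → Fin d → ℝ}
    (hx : Function.Injective x) (q : ι → ℝ) : ∃ p : SPol d, ∀ j, eval (x j) p = q j := by
  classical
  -- The factor of index `k` is `(x j - x k) · (X - x k)`: it is zero at `x k` and `|x j - x k|²` at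
  -- `x j`.
  let f : ι → SPol d := fun j => ∏ k ∈ Finset.univ.erase j,
    ∑ i, C (x j i - x k i) * (X i - C (x k i))
  have h0 : ∀ j k, k ≠ j → eval (x k) (f j) = 0 := fun j k hk => by
    simp only [f, map_prod]
    refine Finset.prod_eq_zero (Finset.mem_erase.2 ⟨hk, Finset.mem_univ k⟩) ?_
    simp
  have h1 : ∀ j, eval (x j) (f j) ≠ 0 := fun j => by
    simp only [f, map_prod]
    refine Finset.prod_ne_zero_iff.2 fun k hk h => (Finset.mem_erase.1 hk).1 (hx ?_)
    have : (x j - x k) ⬝ᵥ (x j - x k) = 0 := by simpa [dotProduct] using h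
    exact (sub_eq_zero.1 (dotProduct_self_eq_zero.1 this)).symm
  refine ⟨∑ j, C (q j / eval (x j) (f j)) * f j, fun k => ?_⟩
  rw [map_sum, Finset.sum_eq_single k]
  · rw [map_mul, eval_C, div_mul_cancel₀ _ (h1 k)]
  · intro j _ hj
    rw [map_mul, h0 j k hj.symm, mul_zero]
  · simp

/-- Weierstrass approximation of continuous functions of several variables on a compact set. -/
theorem exists_eval_near {d : ℕ} {K : Set (Fin d → ℝ)} (hK : IsCompact K) {f : (Fin d → ℝ) → ℝ}
    (hf : Continuous f) {ε : ℝ} (hε : 0 < ε) :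
    ∃ p : SPol d, ∀ x ∈ K, |eval x p - f x| < ε := by
  have : CompactSpace K := isCompact_iff_compactSpace.1 hK
  let g : Fin d → C(K, ℝ) := fun i => ⟨fun x => x.1 i, (continuous_apply i).comp
    continuous_subtype_val⟩
  let Φ : SPol d →ₐ[ℝ] C(K, ℝ) := aeval g
  have hΦ : ∀ p (x : K), Φ p x = eval x.1 p := by
    intro p x
    induction p using MvPolynomial.induction_on with
    | C a => simp [Φ]
    | add p q hp hq => simp only [map_add, ContinuousMap.add_apply, hp, hq]
    | mul_X p i hp =>
      rw [map_mul, map_mul, ContinuousMap.mul_apply, hp, eval_X, aeval_X]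
      rfl
  have hsep : Φ.range.SeparatesPoints := by
    intro x y hxy
    obtain ⟨i, hi⟩ := Function.ne_iff.1 fun h => hxy (Subtype.ext h)
    refine ⟨_, ⟨Φ (X i), ⟨X i, rfl⟩, rfl⟩, ?_⟩
    change Φ (X i) x ≠ Φ (X i) y
    rw [hΦ, hΦ, eval_X, eval_X]
    exact hi
  obtain ⟨⟨_, p, rfl⟩, hp⟩ := ContinuousMap.exists_mem_subalgebra_near_continuous_of_separatesPoints
    Φ.range hsep (fun x => f x.1) (hf.comp continuous_subtype_val) ε hε
  refine ⟨p, fun x hx => ?_⟩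
  have := hp ⟨x, hx⟩
  rw [Real.norm_eq_abs] at this
  rw [← hΦ p ⟨x, hx⟩]
  exact this

namespace MeshData

variable {M : MeshData} {Ω : Set R3}

/-- Integral of polynomials in the arc length over an edge. -/
noncomputable def IE (M : MeshData) (E : Fin M.nE) : Polynomial ℝ →ₗ[ℝ] ℝ := intEdge (M.len E)

namespace IsPolyhedralMesh

/-- Integral of polynomials over a face. -/
noncomputable def IF (hM : M.IsPolyhedralMesh Ω) (F : Fin M.nF) : SPol 2 →ₗ[ℝ] ℝ :=
  intPoly (hM.isBounded_dom F)

/-- Integral of polynomials over an element. -/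
noncomputable def IT (hM : M.IsPolyhedralMesh Ω) (T : Fin M.nT) : SPol 3 →ₗ[ℝ] ℝ :=
  intPoly (hM.isBounded_cell T)

/-- An edge as a boundary piece of a face. -/
noncomputable def edgePiece (hM : M.IsPolyhedralMesh Ω) (F : Fin M.nF) (E : M.edgesOf F) :
    FlatPiece 1 where
  base := M.coord F (M.pos (M.tail E))
  mat := Matrix.of fun a _ => M.tau F E a
  nrm := ![- M.tau F E 1, M.tau F E 0]
  dom := Set.pi univ fun _ => Ioo 0 (M.len E)
  sgn := M.ωFE F E
  det_eq i := by
    rw [Matrix.det_unique]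
    fin_cases i
    · exact (abs_neg _).symm
    · rfl
  orth := by
    ext a
    change ∑ x : Fin 2, ![- M.tau F E 1, M.tau F E 0] x * M.tau F E x = 0
    simp [Fin.sum_univ_two, mul_comm]
  unit := by
    rw [← hM.tau_unit E.2]
    simp [dotProduct, Fin.sum_univ_two, add_comm]
  bounded := Bornology.IsBounded.pi fun _ => Metric.isBounded_Ioo _ _
  measurable := MeasurableSet.univ_pi fun _ => measurableSet_Ioo
  null := (convex_pi fun _ _ => convex_Ioo _ _).addHaar_frontier volume
  sign := hM.ωFE_sign F E E.2

theorem edgePiece_param (hM : M.IsPolyhedralMesh Ω) (F : Fin M.nF) (E : M.edgesOf F)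
    (y : Fin 1 → ℝ) : (hM.edgePiece F E).param y = M.coord F (M.edgePt E (y 0)) := by
  ext a
  rw [coord_edgePt]
  simp [FlatPiece.param, edgePiece, Matrix.mulVec, dotProduct]

/-- The mesh states coverage, disjointness and orientation in space; they are pulled back to face
coordinates through the injective affine chart. -/
theorem isFlatBoundary_face (hM : M.IsPolyhedralMesh Ω) (F : Fin M.nF) :
    IsFlatBoundary (M.dom F) Finset.univ (hM.edgePiece F) where
  isOpen := hM.isOpen_dom F
  bounded := hM.isBounded_dom F
  cover := by
    intro y hy
    have h : M.chart F y ∈ M.faceFrontier F := mem_image_of_mem _ hy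
    rw [hM.frontier_face] at h
    simp only [mem_iUnion] at h
    obtain ⟨E, hE, hyE⟩ := h
    rw [hM.edgeClosure_eq] at hyE
    obtain ⟨s, hs, hys⟩ := hyE
    simp only [mem_iUnion]
    refine ⟨⟨E, hE⟩, Finset.mem_univ _, fun _ => s, ?_, ?_⟩
    · simp only [edgePiece]
      rw [closure_pi_set, closure_Ioo (hM.len_pos E).ne]
      exact fun _ _ => hs
    · rw [edgePiece_param, hys, hM.coord_chart]
  disjoint := by
    intro E _ E' _ hne
    rw [disjoint_left]
    rintro _ ⟨y, hy, rfl⟩ ⟨y', hy', h⟩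
    rw [edgePiece_param, edgePiece_param] at h
    have h2 := congrArg (M.chart F) h
    rw [hM.chart_coord_edgePt E.2, hM.chart_coord_edgePt E'.2] at h2
    have hyE : M.edgePt E (y 0) ∈ M.edgeSet E := by
      rw [hM.edgeSet_eq]
      exact mem_image_of_mem _ (hy 0 (mem_univ _))
    refine disjoint_left.1 (hM.disjoint_edge fun h' => hne (Subtype.ext h')) hyE ?_
    rw [hM.edgeSet_eq, ← h2]
    exact mem_image_of_mem _ (hy' 0 (mem_univ _))
  out := by
    intro E _ y hy
    obtain ⟨ε, hε, h⟩ := hM.ωFE_out F E E.2 (M.edgePt E (y 0))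
      (hM.edgeSet_eq E ▸ mem_image_of_mem _ (hy 0 (mem_univ _)))
    refine ⟨ε, hε, fun t ht => ?_⟩
    have key : ∀ a : ℝ, M.chart F ((hM.edgePiece F E).param y +
        a • ((hM.edgePiece F E).sgn • (hM.edgePiece F E).nrm)) =
        M.edgePt E (y 0) + a • M.ωFE F E • M.normalFE F E := by
      intro a
      rw [edgePiece_param, ← hM.chart_coord_edgePt E.2, ← hM.lift_nrm E.2]
      ext i
      simp only [chart_apply, edgePiece, lift, Pi.add_apply, Pi.smul_apply, smul_eq_mul,
        Matrix.cons_val_zero, Matrix.cons_val_one, hM.coord_chart]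
      ring
    have hmem : ∀ z, M.chart F z ∈ M.faceSet F ↔ z ∈ M.dom F := fun z =>
      (hM.chart_injective F).mem_set_image
    have h2 := h t ht
    rw [sub_eq_add_neg, ← neg_smul, ← key, ← key, hmem, hmem, neg_smul, ← sub_eq_add_neg] at h2
    exact h2

/-- Green's formula on a face. -/
theorem green (hM : M.IsPolyhedralMesh Ω) (F : Fin M.nF) (v : VPol 2) :
    hM.IF F (vdiv v) = ∑ E ∈ M.edgesOf F, M.ωFE F E * M.IE E (M.nrmE F E v) := by
  rw [← Finset.sum_coe_sort]
  refine ((hM.isFlatBoundary_face F).integral_vdiv v).trans (Finset.sum_congr rfl fun E _ => ?_)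
  congr 1
  -- The domain of a one-dimensional piece consists of functions on `Fin 1`; it is identified with
  -- an interval of arc length.
  have hmp := volume_preserving_funUnique (Fin 1) ℝ
  have hdom : (hM.edgePiece F E).dom =
      (MeasurableEquiv.funUnique (Fin 1) ℝ) ⁻¹' Ioo 0 (M.len E) := by
    ext y
    simp [edgePiece, MeasurableEquiv.funUnique, Fin.forall_fin_one, Set.mem_pi]
  have hfun : (fun y => (hM.edgePiece F E).nrm ⬝ᵥ ev v ((hM.edgePiece F E).param y)) =
      fun y => (M.nrmE F E v).eval (MeasurableEquiv.funUnique (Fin 1) ℝ y) := by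
    funext y
    rw [edgePiece_param, ← hM.normalComp_eq, normalComp, lift, add_dotProduct, smul_dotProduct,
      smul_dotProduct, hM.e₁_dot_normalFE, hM.e₂_dot_normalFE]
    simp [dotProduct, Fin.sum_univ_two, edgePiece, MeasurableEquiv.funUnique, mul_comm]
  rw [hfun, hdom]
  refine (hmp.setIntegral_preimage_emb (MeasurableEquiv.measurableEmbedding _)
    (fun s => (M.nrmE F E v).eval s) _).trans ?_
  rw [← integral_Ioc_eq_integral_Ioo, ← intervalIntegral.integral_of_le (hM.len_pos E).le]
  rfl

/-- The frontier lies in finitely many lines of the plane. This provides the field `null` of the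
face pieces. -/
theorem volume_frontier_dom (hM : M.IsPolyhedralMesh Ω) (F : Fin M.nF) :
    volume (frontier (M.dom F)) = 0 := by
  refine measure_mono_null (hM.isFlatBoundary_face F).cover
    ((measure_biUnion_null_iff (Finset.countable_toSet _)).2 fun E _ => ?_)
  refine measure_mono_null (t := (AffineSubspace.mk' (M.coord F (M.pos (M.tail E)))
    (Submodule.span ℝ {M.tau F E}) : Set R2)) ?_ (Measure.addHaar_affineSubspace _ _ ?_)
  · rintro _ ⟨y, _, rfl⟩
    rw [SetLike.mem_coe, AffineSubspace.mem_mk', Submodule.mem_span_singleton]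
    refine ⟨y 0, ?_⟩
    ext a
    rw [edgePiece_param, vsub_eq_sub, Pi.sub_apply, coord_edgePt]
    simp [mul_comm]
  · intro h
    have h2 := congrArg AffineSubspace.direction h
    rw [AffineSubspace.direction_mk', AffineSubspace.direction_top] at h2
    have h3 := finrank_span_le_card (R := ℝ) ({M.tau F E} : Set R2)
    rw [h2, finrank_top] at h3
    simp at h3

/-- A face as a boundary piece of an element. -/
noncomputable def facePiece (hM : M.IsPolyhedralMesh Ω) (T : Fin M.nT) (F : M.facesOf T) :
    FlatPiece 2 where
  base := M.ctrF F
  mat := Matrix.of fun i => ![M.e₁ F i, M.e₂ F i]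
  nrm := M.normalF F
  dom := M.dom F
  sgn := M.ωTF T F
  det_eq i := by
    rw [Matrix.det_fin_two]
    fin_cases i
    · simp [normalF, cross_apply, mul_comm]
    · simp only [Matrix.submatrix_apply, Matrix.of_apply, id, normalF, cross_apply]
      simp [mul_comm, Fin.succAbove]
      rw [abs_sub_comm]
    · simp [normalF, cross_apply, mul_comm, Fin.succAbove]
  orth := by
    ext a
    have h1 : M.normalF F ⬝ᵥ M.e₁ F = 0 := by
      rw [normalF, dotProduct_comm, dot_self_cross]
    have h2 : M.normalF F ⬝ᵥ M.e₂ F = 0 := by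
      rw [normalF, dotProduct_comm, dot_cross_self]
    fin_cases a
    · exact h1
    · exact h2
  unit := hM.normalF_unit F
  bounded := hM.isBounded_dom F
  measurable := (hM.isOpen_dom F).measurableSet
  null := hM.volume_frontier_dom F
  sign := hM.ωTF_sign T F F.2

theorem facePiece_param (hM : M.IsPolyhedralMesh Ω) (T : Fin M.nT) (F : M.facesOf T) :
    (hM.facePiece T F).param = M.chart F := by
  funext y
  ext i
  rw [chart_apply]
  simp [FlatPiece.param, facePiece, Matrix.mulVec, dotProduct, Fin.sum_univ_two, mul_comm]

theorem isFlatBoundary_cell (hM : M.IsPolyhedralMesh Ω) (T : Fin M.nT) :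
    IsFlatBoundary (M.cell T) Finset.univ (hM.facePiece T) where
  isOpen := hM.isOpen_cell T
  bounded := hM.isBounded_cell T
  cover := by
    intro x hx
    rw [hM.frontier_cell] at hx
    simp only [mem_iUnion] at hx ⊢
    obtain ⟨F, hF, hx⟩ := hx
    refine ⟨⟨F, hF⟩, Finset.mem_univ _, ?_⟩
    rw [facePiece_param]
    exact closure_minimal (image_mono subset_closure)
      ((hM.isBounded_dom F).isCompact_closure.image (continuous_chart F)).isClosed hx
  disjoint := by
    intro F _ F' _ hne
    rw [facePiece_param, facePiece_param]
    exact hM.disjoint_face fun h' => hne (Subtype.ext h')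
  out := by
    intro F _ y hy
    rw [facePiece_param]
    exact hM.ωTF_out T F F.2 _ (mem_image_of_mem _ hy)

/-- The divergence theorem on an element. -/
theorem gauss (hM : M.IsPolyhedralMesh Ω) (T : Fin M.nT) (w : VPol 3) :
    hM.IT T (vdiv w) = ∑ F ∈ M.facesOf T, M.ωTF T F * hM.IF F (M.resDot F (M.normalF F) w) := by
  rw [← Finset.sum_coe_sort]
  refine ((hM.isFlatBoundary_cell T).integral_vdiv w).trans (Finset.sum_congr rfl fun F _ => ?_)
  rw [facePiece_param]
  congr 1
  refine integral_congr_ae (Filter.Eventually.of_forall fun y => ?_)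
  simp only
  rw [eval_resDot, dotProduct_comm]
  rfl

end IsPolyhedralMesh

end MeshData

end DDR

/-! ### The boundary of a boundary vanishes -/

namespace DDR

namespace MeshData

open MvPolynomial Set

variable {M : MeshData} {Ω : Set R3}

namespace IsPolyhedralMesh

/-- The oriented boundary of the boundary of a face vanishes. -/
theorem sum_vertices (hM : M.IsPolyhedralMesh Ω) (F : Fin M.nF) (q : Fin M.nV → ℝ) :
    ∑ E ∈ M.edgesOf F, M.ωFE F E * (q (M.head E) - q (M.tail E)) = 0 := by
  -- A polynomial with the prescribed vertex values makes this Green's formula for the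
  -- divergence-free field `vrot p`, whose flux through an edge is minus the difference of the end
  -- values.
  obtain ⟨p, hp⟩ := exists_eval_eq hM.pos_injective q
  have h := hM.green F (vrot (M.resF F p))
  rw [vdiv_vrot, map_zero] at h
  have h2 : ∀ E ∈ M.edgesOf F, M.ωFE F E * M.IE E (M.nrmE F E (vrot (M.resF F p))) =
      - (M.ωFE F E * (q (M.head E) - q (M.tail E))) := by
    intro E hE
    rw [nrmE_vrot, map_neg, IE, intEdge_derivative, eval_resE, eval_resE, eval_resF, eval_resF,
      hM.chart_coord_edgePt hE, hM.chart_coord_edgePt hE, hM.edgePt_len,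
      show M.edgePt E 0 = M.pos (M.tail E) by simp [edgePt], hp, hp, mul_neg]
  rw [Finset.sum_congr rfl h2, Finset.sum_neg_distrib] at h
  linarith

theorem continuous_edgePt (M : MeshData) (E : Fin M.nE) : Continuous (M.edgePt E) := by
  unfold edgePt; fun_prop

/-- A signed measure on the edges, constant on each edge, that vanishes on polynomials is zero. -/
theorem coeff_eq_zero_of_sum_edges (hM : M.IsPolyhedralMesh Ω) {b : Fin M.nE → ℝ}
    (h : ∀ p : SPol 3, ∑ E, b E * M.IE E (M.resET E p) = 0) (E₀ : Fin M.nE) : b E₀ = 0 := by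
  have hcl : ∀ E, IsCompact (M.edgeClosure E) := fun E => by
    rw [hM.edgeClosure_eq]
    exact isCompact_Icc.image (continuous_edgePt M E)
  set m := M.edgePt E₀ (M.len E₀ / 2)
  have hL := hM.len_pos E₀
  have hmE : m ∈ M.edgeSet E₀ := by
    rw [hM.edgeSet_eq]
    exact mem_image_of_mem _ ⟨by linarith, by linarith⟩
  set K' := ⋃ E ∈ Finset.univ.erase E₀, M.edgeClosure E
  have hK' : IsClosed K' :=
    (Finset.finite_toSet _).isClosed_biUnion fun E _ => (hcl E).isClosed
  have hm : m ∉ K' := by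
    simp only [K', mem_iUnion, not_exists]
    intro E hE hmE'
    rw [edgeClosure, ← insert_endpoints_openSegment] at hmE'
    rcases hmE' with h1 | h1 | h1
    · exact hM.vertex_not_mem_edge _ E₀ (h1 ▸ hmE)
    · exact hM.vertex_not_mem_edge _ E₀ (h1 ▸ hmE)
    · exact disjoint_left.1 (hM.disjoint_edge (Finset.mem_erase.1 hE).1) h1 hmE
  obtain ⟨δ, hδ, hball⟩ := Metric.isOpen_iff.1 hK'.isOpen_compl _ hm
  -- A bump at the midpoint of `E₀` that vanishes on every other closed edge: it isolates `b E₀`.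
  let f : R3 → ℝ := fun x => max 0 (δ - dist x m)
  have hf : Continuous f := continuous_const.max (continuous_const.sub
    (continuous_id.dist continuous_const))
  have hfE : ∀ E, E ≠ E₀ → ∀ s ∈ Icc 0 (M.len E), f (M.edgePt E s) = 0 := by
    intro E hE s hs
    refine max_eq_left ?_
    by_contra hlt
    have : M.edgePt E s ∈ Metric.ball m δ := by
      rw [Metric.mem_ball]
      linarith
    refine hball this ?_
    simp only [K', mem_iUnion]
    exact ⟨E, Finset.mem_erase.2 ⟨hE, Finset.mem_univ _⟩,
      hM.edgeClosure_eq E ▸ mem_image_of_mem _ hs⟩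
  have hfc : ∀ E, Continuous fun s => f (M.edgePt E s) := fun E =>
    hf.comp (continuous_edgePt M E)
  have hpos : 0 < ∫ s in (0 : ℝ)..M.len E₀, f (M.edgePt E₀ s) := by
    refine intervalIntegral.integral_pos hL (hfc E₀).continuousOn
      (fun s _ => le_max_left _ _) ⟨M.len E₀ / 2, ⟨by linarith, by linarith⟩, ?_⟩
    change 0 < max 0 (δ - dist m m)
    rw [dist_self, sub_zero]
    exact lt_max_of_lt_right hδ
  have hsum : ∑ E, b E * ∫ s in (0 : ℝ)..M.len E, f (M.edgePt E s) = 0 := by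
    -- The sum is zero for a polynomial within `ε` of the bump on all edges, so only the
    -- approximation error remains.
    have hbound : ∀ ε > 0, |∑ E, b E * ∫ s in (0 : ℝ)..M.len E, f (M.edgePt E s)| ≤
        ε * ∑ E, |b E| * M.len E := by
      intro ε hε
      obtain ⟨p, hp⟩ := exists_eval_near (isCompact_iUnion hcl) hf hε
      have heq : ∑ E, b E * ∫ s in (0 : ℝ)..M.len E, f (M.edgePt E s) =
          ∑ E, ((b E * ∫ s in (0 : ℝ)..M.len E, f (M.edgePt E s)) -
            b E * M.IE E (M.resET E p)) := by
        rw [Finset.sum_sub_distrib, h p, sub_zero]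
      rw [heq, Finset.mul_sum]
      refine (Finset.abs_sum_le_sum_abs _ _).trans (Finset.sum_le_sum fun E _ => ?_)
      have hIE : M.IE E (M.resET E p) = ∫ s in (0 : ℝ)..M.len E, eval (M.edgePt E s) p := by
        change ∫ s in (0 : ℝ)..M.len E, (M.resET E p).eval s = _
        simp only [eval_resET]
      have hpc : Continuous fun s => eval (M.edgePt E s) p :=
        (continuous_eval' p).comp (continuous_edgePt M E)
      rw [← mul_sub, abs_mul, hIE, ← intervalIntegral.integral_sub
        ((hfc E).intervalIntegrable _ _) (hpc.intervalIntegrable _ _)]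
      have hle := intervalIntegral.norm_integral_le_of_norm_le_const (a := 0) (b := M.len E)
        (C := ε) (f := fun s => f (M.edgePt E s) - eval (M.edgePt E s) p) fun s hs => by
          rw [uIoc_of_le (hM.len_pos E).le] at hs
          rw [norm_sub_rev]
          refine (hp _ (mem_iUnion.2 ⟨E, ?_⟩)).le
          rw [hM.edgeClosure_eq]
          exact mem_image_of_mem _ (Ioc_subset_Icc_self hs)
      rw [Real.norm_eq_abs, sub_zero, abs_of_pos (hM.len_pos E)] at hle
      calc |b E| * _ ≤ |b E| * (ε * M.len E) := mul_le_mul_of_nonneg_left hle (abs_nonneg _)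
        _ = ε * (|b E| * M.len E) := by ring
    have hC : 0 ≤ ∑ E, |b E| * M.len E :=
      Finset.sum_nonneg fun E _ => mul_nonneg (abs_nonneg _) (hM.len_pos E).le
    by_contra hne
    have hlt := abs_pos.2 hne
    set S := |∑ E, b E * ∫ s in (0 : ℝ)..M.len E, f (M.edgePt E s)|
    set D := ∑ E, |b E| * M.len E
    have h1 := hbound (S / (2 * (D + 1))) (by positivity)
    have h2 : S / (2 * (D + 1)) * D < S := by
      rw [div_mul_eq_mul_div, div_lt_iff₀ (by positivity)]
      nlinarith
    linarith
  rw [Finset.sum_eq_single E₀] at hsum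
  · exact (mul_eq_zero.1 hsum).resolve_right hpos.ne'
  · intro E _ hE
    rw [intervalIntegral.integral_congr (g := fun _ => 0)]
    · simp
    · intro s hs
      rw [uIcc_of_le (hM.len_pos E).le] at hs
      exact hfE E hE s hs
  · simp

/-- The oriented boundary of the boundary of an element vanishes. -/
theorem sum_edges (hM : M.IsPolyhedralMesh Ω) (T : Fin M.nT) (a : Fin M.nE → ℝ) :
    ∑ F ∈ M.facesOf T, M.ωTF T F * ∑ E ∈ M.edgesOf F, M.ωFE F E * a E = 0 := by
  classical
  -- `c E` collects the signs with which the faces of `T` see the edge `E`; the claim amounts to `c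
  -- = 0`.
  set c : Fin M.nE → ℝ := fun E => ∑ F ∈ M.facesOf T, M.ωTF T F *
    if E ∈ M.edgesOf F then M.ωFE F E else 0
  have hswap : ∀ a : Fin M.nE → ℝ,
      ∑ F ∈ M.facesOf T, M.ωTF T F * ∑ E ∈ M.edgesOf F, M.ωFE F E * a E = ∑ E, c E * a E := by
    intro a
    simp only [c, Finset.sum_mul]
    rw [Finset.sum_comm]
    refine Finset.sum_congr rfl fun F _ => ?_
    simp only [mul_assoc]
    rw [← Finset.mul_sum]
    congr 1
    rw [← Finset.sum_subset (Finset.subset_univ (M.edgesOf F))]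
    · exact Finset.sum_congr rfl fun E hE => by rw [if_pos hE]
    · intro E _ hE
      rw [if_neg hE, zero_mul]
  -- The total flux of a curl through the boundary of `T` is zero, and Green's formula turns each
  -- face flux into circulations along edges.
  have hpol : ∀ w : VPol 3, ∑ E, c E * M.IE E (M.tanE E w) = 0 := by
    intro w
    rw [← hswap]
    have h := hM.gauss T (curl w)
    rw [vdiv_curl, map_zero] at h
    have h2 : ∀ F, hM.IF F (M.resDot F (M.normalF F) (curl w)) =
        - ∑ E ∈ M.edgesOf F, M.ωFE F E * M.IE E (M.tanE E w) := by
      intro F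
      rw [← vdiv_tanF, hM.green, ← Finset.sum_neg_distrib]
      exact Finset.sum_congr rfl fun E hE => by rw [hM.nrmE_tanF hE, map_neg, mul_neg]
    simp only [h2, mul_neg, Finset.sum_neg_distrib] at h
    linarith
  rw [hswap]
  refine Finset.sum_eq_zero fun E₀ _ => ?_
  -- With fields parallel to the tangent of `E₀`, the coefficient of `E` becomes `c E` times a
  -- cosine, which is 1 for `E₀` itself.
  have h0 := hM.coeff_eq_zero_of_sum_edges (b := fun E => c E * (M.tangent E ⬝ᵥ M.tangent E₀))
    (fun p => by
      rw [← hpol fun i => M.tangent E₀ i • p]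
      refine Finset.sum_congr rfl fun E _ => ?_
      rw [mul_assoc]
      congr 1
      rw [tanE_apply, dotProduct, Finset.sum_mul, map_sum]
      exact Finset.sum_congr rfl fun i _ => by
        rw [map_smul, map_smul, map_smul, smul_eq_mul, smul_eq_mul, mul_assoc]) E₀
  rw [hM.tangent_unit, mul_one] at h0
  rw [h0, zero_mul]

/-- The rotated tangential trace of `(x - c) × p` on a face has the degree of `p`, up to a field in
the complement of the rotationals. -/
theorem tanF_posCross (hM : M.IsPolyhedralMesh Ω) (F : Fin M.nF) (c : R3) (p : VPol 3) :
    M.tanF F (posCross c p) =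
      (M.normalF F ⬝ᵥ (M.ctrF F - c)) • ![M.resDot F (M.e₁ F) p, M.resDot F (M.e₂ F) p] -
      (fun a => (![M.e₁ F ⬝ᵥ (M.ctrF F - c), M.e₂ F ⬝ᵥ (M.ctrF F - c)] a : ℝ) •
        M.resDot F (M.normalF F) p) -
      posMul 0 (M.resDot F (M.normalF F) p) := by
  have hev : ∀ y, ev (posCross c p) y = (y - c) ⨯₃ ev p y := by
    intro y
    ext i
    fin_cases i <;> simp [ev, posCross, cross_apply, posVec] <;> ring
  have h21 : M.e₂ F ⬝ᵥ M.e₁ F = 0 := by rw [dotProduct_comm, hM.e₁_orth_e₂]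
  have hn1 : M.normalF F ⬝ᵥ M.e₁ F = 0 := by rw [normalF, dotProduct_comm, dot_self_cross]
  have hn2 : M.normalF F ⬝ᵥ M.e₂ F = 0 := by rw [normalF, dotProduct_comm, dot_cross_self]
  have hq : ∀ y, M.chart F y - c = (M.ctrF F - c) + M.lift F y := fun y => by
    rw [chart]; abel
  have hd1 : ∀ y, M.e₁ F ⬝ᵥ (M.chart F y - c) = M.e₁ F ⬝ᵥ (M.ctrF F - c) + y 0 := fun y => by
    rw [hq, dotProduct_add, lift, dotProduct_add, dotProduct_smul, dotProduct_smul, hM.e₁_unit,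
      hM.e₁_orth_e₂]
    simp
  have hd2 : ∀ y, M.e₂ F ⬝ᵥ (M.chart F y - c) = M.e₂ F ⬝ᵥ (M.ctrF F - c) + y 1 := fun y => by
    rw [hq, dotProduct_add, lift, dotProduct_add, dotProduct_smul, dotProduct_smul, hM.e₂_unit,
      h21]
    simp
  have hdn : ∀ y, M.normalF F ⬝ᵥ (M.chart F y - c) = M.normalF F ⬝ᵥ (M.ctrF F - c) := fun y => by
    rw [hq, dotProduct_add, lift, dotProduct_add, dotProduct_smul, dotProduct_smul, hn1, hn2]
    simp
  -- Writing `e₂ = n × e₁`, the Binet–Cauchy identity separates the factors. Since `n · (x - c)` is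
  -- constant on the face, the first product has the degree of `p`.
  have k1 : ∀ y, M.e₂ F ⬝ᵥ ((M.chart F y - c) ⨯₃ ev p (M.chart F y)) =
      (M.normalF F ⬝ᵥ (M.ctrF F - c)) * (M.e₁ F ⬝ᵥ ev p (M.chart F y)) -
      (M.normalF F ⬝ᵥ ev p (M.chart F y)) * (M.e₁ F ⬝ᵥ (M.ctrF F - c) + y 0) := fun y => by
    conv_lhs => rw [← hM.normalF_cross_e₁]
    rw [cross_dot_cross, hdn, hd1]
  have k2 : ∀ y, - (M.e₁ F ⬝ᵥ ((M.chart F y - c) ⨯₃ ev p (M.chart F y))) =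
      (M.normalF F ⬝ᵥ (M.ctrF F - c)) * (M.e₂ F ⬝ᵥ ev p (M.chart F y)) -
      (M.normalF F ⬝ᵥ ev p (M.chart F y)) * (M.e₂ F ⬝ᵥ (M.ctrF F - c) + y 1) := fun y => by
    rw [← neg_dotProduct, ← hM.normalF_cross_e₂, cross_dot_cross, hdn, hd2]
  rw [tanF_apply]
  ext1 a
  refine MvPolynomial.funext fun y => ?_
  fin_cases a
  · have := k1 y
    simp only [Fin.zero_eta, Matrix.cons_val_zero, Pi.sub_apply, Pi.smul_apply, map_sub, smul_eval,
      eval_resDot, posMul, posVec, LinearMap.coe_mk, AddHom.coe_mk, smul_eq_mul, map_mul, eval_X,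
      eval_C, Pi.zero_apply, sub_zero]
    rw [hev, dotProduct_comm, this, dotProduct_comm (M.e₁ F) (ev p _),
      dotProduct_comm (M.normalF F) (ev p _)]
    ring
  · have := k2 y
    simp only [Fin.mk_one, Matrix.cons_val_one, Matrix.cons_val_zero, Pi.sub_apply, Pi.smul_apply,
      map_sub, map_neg, smul_eval, eval_resDot, posMul, posVec, LinearMap.coe_mk, AddHom.coe_mk,
      smul_eq_mul, map_mul, eval_X, eval_C, Pi.zero_apply, sub_zero]
    rw [hev, dotProduct_comm, this, dotProduct_comm (M.e₂ F) (ev p _),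
      dotProduct_comm (M.normalF F) (ev p _)]
    ring

/-- Although `w` has degree `l + 1`, the excess degree of its trace lies in the complement of the
rotationals. This is what allows the face trace formula to be used for the test fields of the curl
potential. -/
theorem exists_tanF_eq (hM : M.IsPolyhedralMesh Ω) (F : Fin M.nF) {c : R3} {l : ℤ} {w : VPol 3}
    (hw : w ∈ GolyTc c (l + 1)) :
    ∃ u ∈ PolV 2 l, ∃ z ∈ RolyFc (l + 1), M.tanF F w = u + z := by
  obtain ⟨p, hp, rfl⟩ := hw
  rw [add_sub_cancel_right] at hp
  refine ⟨_, ?_, - posMul 0 (M.resDot F (M.normalF F) p), neg_mem ⟨_, ?_, rfl⟩,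
    (hM.tanF_posCross F c p).trans (sub_eq_add_neg _ _)⟩
  · refine sub_mem (Submodule.smul_mem _ _ ?_) ?_
    · rw [mem_PolV_iff]
      intro a
      fin_cases a
      · exact M.resDot_mem F _ hp
      · exact M.resDot_mem F _ hp
    · rw [mem_PolV_iff]
      exact fun a => Submodule.smul_mem _ _ (M.resDot_mem F _ hp)
  · rw [SetLike.mem_coe, add_sub_cancel_right]
    exact M.resDot_mem F _ hp

end IsPolyhedralMesh

end MeshData

end DDR

/-! ### Boundary functionals and reduction of the problems to linear algebra -/

namespace DDR

open MvPolynomial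

instance finite_RolyF (l : ℤ) : Module.Finite ℝ (RolyF l) :=
  inferInstanceAs (Module.Finite ℝ ((PolS 2 (l + 1)).map vrot))

instance finite_RolyFc (l : ℤ) : Module.Finite ℝ (RolyFc l) :=
  inferInstanceAs (Module.Finite ℝ ((PolS 2 (l - 1)).map (posMul 0)))

instance finite_GolyT (l : ℤ) : Module.Finite ℝ (GolyT l) :=
  inferInstanceAs (Module.Finite ℝ ((PolS 3 (l + 1)).map (grad 3)))

instance finite_GolyTc (c : R3) (l : ℤ) : Module.Finite ℝ (GolyTc c l) :=
  inferInstanceAs (Module.Finite ℝ ((PolV 3 (l - 1)).map (posCross c)))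

instance finite_RolyT (l : ℤ) : Module.Finite ℝ (RolyT l) :=
  inferInstanceAs (Module.Finite ℝ ((PolV 3 (l + 1)).map curl))

instance finite_RolyTc (c : R3) (l : ℤ) : Module.Finite ℝ (RolyTc c l) :=
  inferInstanceAs (Module.Finite ℝ ((PolS 3 (l - 1)).map (posMul c)))

namespace MeshData

variable {M : MeshData} {Ω : Set R3}

/-- Boundary functional of a face acting on normal components. -/
noncomputable def bdN (M : MeshData) (F : Fin M.nF) (f : Fin M.nE → Polynomial ℝ) :
    VPol 2 →ₗ[ℝ] ℝ :=
  ∑ E ∈ M.edgesOf F, M.ωFE F E • (mulForm (M.IE E) (f E) ∘ₗ M.nrmE F E)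

/-- Boundary functional of a face acting on scalar polynomials. -/
noncomputable def bdS (M : MeshData) (F : Fin M.nF) (f : Fin M.nE → Polynomial ℝ) :
    SPol 2 →ₗ[ℝ] ℝ :=
  ∑ E ∈ M.edgesOf F, M.ωFE F E • (mulForm (M.IE E) (f E) ∘ₗ (M.resE F E).toLinearMap)

theorem bdN_apply (F : Fin M.nF) (f : Fin M.nE → Polynomial ℝ) (v : VPol 2) :
    M.bdN F f v = ∑ E ∈ M.edgesOf F, M.ωFE F E * M.IE E (f E * M.nrmE F E v) := by
  simp [bdN, mulForm_apply]

theorem bdS_apply (F : Fin M.nF) (f : Fin M.nE → Polynomial ℝ) (r : SPol 2) :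
    M.bdS F f r = ∑ E ∈ M.edgesOf F, M.ωFE F E * M.IE E (f E * M.resE F E r) := by
  simp [bdS, mulForm_apply]

theorem intE_mul (E : Fin M.nE) (p q : Polynomial ℝ) :
    M.intE E (fun s => p.eval s * q.eval s) = mulForm (M.IE E) p q := by
  simp only [← Polynomial.eval_mul]
  rfl

theorem bdryF_res (F : Fin M.nF) (f : Fin M.nE → Polynomial ℝ) (r : SPol 2) :
    M.bdryF F (fun E s => (f E).eval s) (fun _ y => eval y r) = M.bdS F f r := by
  rw [bdryF, bdS_apply]
  refine Finset.sum_congr rfl fun E _ => ?_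
  simp only [← eval_resE, ← Polynomial.eval_mul]
  rfl

namespace IsPolyhedralMesh

/-- Boundary functional of an element acting on normal components. -/
noncomputable def bdT (hM : M.IsPolyhedralMesh Ω) (T : Fin M.nT) (f : Fin M.nF → SPol 2) :
    VPol 3 →ₗ[ℝ] ℝ :=
  ∑ F ∈ M.facesOf T, M.ωTF T F • (mulForm (hM.IF F) (f F) ∘ₗ M.resDot F (M.normalF F))

/-- Boundary functional of an element acting on rotated tangential components. -/
noncomputable def bdTan (hM : M.IsPolyhedralMesh Ω) (T : Fin M.nT) (u : Fin M.nF → VPol 2) :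
    VPol 3 →ₗ[ℝ] ℝ :=
  ∑ F ∈ M.facesOf T, M.ωTF T F • (dotForm (hM.IF F) (u F) ∘ₗ M.tanF F)

/-- Boundary functional of an element acting on scalar polynomials. -/
noncomputable def bdTS (hM : M.IsPolyhedralMesh Ω) (T : Fin M.nT) (f : Fin M.nF → SPol 2) :
    SPol 3 →ₗ[ℝ] ℝ :=
  ∑ F ∈ M.facesOf T, M.ωTF T F • (mulForm (hM.IF F) (f F) ∘ₗ (M.resF F).toLinearMap)

theorem bdT_apply (hM : M.IsPolyhedralMesh Ω) (T : Fin M.nT) (f : Fin M.nF → SPol 2) (w : VPol 3) :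
    hM.bdT T f w = ∑ F ∈ M.facesOf T, M.ωTF T F *
      mulForm (hM.IF F) (f F) (M.resDot F (M.normalF F) w) := by
  simp [bdT]

theorem bdTan_apply (hM : M.IsPolyhedralMesh Ω) (T : Fin M.nT) (u : Fin M.nF → VPol 2)
    (w : VPol 3) : hM.bdTan T u w =
      ∑ F ∈ M.facesOf T, M.ωTF T F * dotForm (hM.IF F) (u F) (M.tanF F w) := by
  simp [bdTan]

theorem bdTS_apply (hM : M.IsPolyhedralMesh Ω) (T : Fin M.nT) (f : Fin M.nF → SPol 2)
    (r : SPol 3) : hM.bdTS T f r =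
      ∑ F ∈ M.facesOf T, M.ωTF T F * mulForm (hM.IF F) (f F) (M.resF F r) := by
  simp [bdTS]

theorem intF_mul (hM : M.IsPolyhedralMesh Ω) (F : Fin M.nF) (p q : SPol 2) :
    M.intF F (fun y => eval y p * eval y q) = mulForm (hM.IF F) p q := by
  simp only [← map_mul]
  rfl

theorem intT_mul (hM : M.IsPolyhedralMesh Ω) (T : Fin M.nT) (p q : SPol 3) :
    M.intT T (fun y => eval y p * eval y q) = mulForm (hM.IT T) p q := by
  simp only [← map_mul]
  rfl

theorem intF_dot (hM : M.IsPolyhedralMesh Ω) (F : Fin M.nF) (u v : VPol 2) :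
    M.intF F (fun y => ev u y ⬝ᵥ ev v y) = dotForm (hM.IF F) u v := by
  simp only [ev_dotProduct]
  rfl

theorem intT_dot (hM : M.IsPolyhedralMesh Ω) (T : Fin M.nT) (u v : VPol 3) :
    M.intT T (fun y => ev u y ⬝ᵥ ev v y) = dotForm (hM.IT T) u v := by
  simp only [ev_dotProduct]
  rfl

theorem bdryF_nrm (hM : M.IsPolyhedralMesh Ω) (F : Fin M.nF) (f : Fin M.nE → Polynomial ℝ)
    (v : VPol 2) : M.bdryF F (fun E s => (f E).eval s) (M.normalComp F v) = M.bdN F f v := by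
  rw [bdryF, bdN_apply]
  refine Finset.sum_congr rfl fun E _ => ?_
  simp only [hM.normalComp_eq, ← Polynomial.eval_mul]
  rfl

theorem bdryT_nrm (hM : M.IsPolyhedralMesh Ω) (T : Fin M.nT) (f : Fin M.nF → SPol 2)
    (w : VPol 3) :
    M.bdryT T (fun F y x => eval y (f F) * (ev w x ⬝ᵥ M.normalF F)) = hM.bdT T f w := by
  rw [bdryT, bdT_apply]
  refine Finset.sum_congr rfl fun F _ => ?_
  simp only [← eval_resDot, hM.intF_mul]

theorem bdryT_tan (hM : M.IsPolyhedralMesh Ω) (T : Fin M.nT) (u : Fin M.nF → VPol 2)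
    (w : VPol 3) :
    M.bdryT T (fun F y x => M.lift F (ev (u F) y) ⬝ᵥ (ev w x ⨯₃ M.normalF F)) =
      hM.bdTan T u w := by
  rw [bdryT, bdTan_apply]
  refine Finset.sum_congr rfl fun F _ => ?_
  simp only [hM.lift_dot_cross]
  rfl

theorem bdryT_res (hM : M.IsPolyhedralMesh Ω) (T : Fin M.nT) (f : Fin M.nF → SPol 2)
    (r : SPol 3) :
    M.bdryT T (fun F y x => eval y (f F) * eval x r) = hM.bdTS T f r := by
  rw [bdryT, bdTS_apply]
  refine Finset.sum_congr rfl fun F _ => ?_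
  simp only [← eval_resF, hM.intF_mul]

theorem mulE_pos (hM : M.IsPolyhedralMesh Ω) (E : Fin M.nE) {p : Polynomial ℝ}
    (h : mulForm (M.IE E) p p = 0) : p = 0 := intEdge_mul_self (hM.len_pos E) h

theorem mulF_pos (hM : M.IsPolyhedralMesh Ω) (F : Fin M.nF) {p : SPol 2}
    (h : mulForm (hM.IF F) p p = 0) : p = 0 :=
  intPoly_mul_self (hM.isBounded_dom F) (hM.isOpen_dom F) ⟨0, hM.ctrF_mem F⟩ h

theorem dotF_pos (hM : M.IsPolyhedralMesh Ω) (F : Fin M.nF) {u : VPol 2}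
    (h : dotForm (hM.IF F) u u = 0) : u = 0 :=
  intPoly_dot_self (hM.isBounded_dom F) (hM.isOpen_dom F) ⟨0, hM.ctrF_mem F⟩ h

theorem mulT_pos (hM : M.IsPolyhedralMesh Ω) (T : Fin M.nT) {p : SPol 3}
    (h : mulForm (hM.IT T) p p = 0) : p = 0 :=
  intPoly_mul_self (hM.isBounded_cell T) (hM.isOpen_cell T) ⟨_, hM.ctrT_mem T⟩ h

theorem dotT_pos (hM : M.IsPolyhedralMesh Ω) (T : Fin M.nT) {u : VPol 3}
    (h : dotForm (hM.IT T) u u = 0) : u = 0 :=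
  intPoly_dot_self (hM.isBounded_cell T) (hM.isOpen_cell T) ⟨_, hM.ctrT_mem T⟩ h

theorem IF_C_ne_zero (hM : M.IsPolyhedralMesh Ω) (F : Fin M.nF) {a : ℝ}
    (h : hM.IF F (C a) = 0) : a = 0 := by
  have h2 : mulForm (hM.IF F) (C a) (C a) = 0 := by
    rw [mulForm_apply, C_mul', map_smul, h, smul_zero]
  exact C_eq_zero.1 (hM.mulF_pos F h2)

theorem IT_C_ne_zero (hM : M.IsPolyhedralMesh Ω) (T : Fin M.nT) {a : ℝ}
    (h : hM.IT T (C a) = 0) : a = 0 := by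
  have h2 : mulForm (hM.IT T) (C a) (C a) = 0 := by
    rw [mulForm_apply, C_mul', map_smul, h, smul_zero]
  exact C_eq_zero.1 (hM.mulT_pos T h2)

/-! ### Algebraic form of the variational problems -/

theorem isVProjF_iff (hM : M.IsPolyhedralMesh Ω) (F : Fin M.nF) (S : Submodule ℝ (VPol 2))
    (f : VPol 2) (p : S) : M.IsVProjF F S (ev f) p ↔
      ∀ v ∈ S, dotForm (hM.IF F) p.1 v = dotForm (hM.IF F) f v := by
  simp only [IsVProjF, hM.intF_dot, Subtype.forall]

theorem isVProjT_iff (hM : M.IsPolyhedralMesh Ω) (T : Fin M.nT) (S : Submodule ℝ (VPol 3))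
    (f : VPol 3) (p : S) : M.IsVProjT T S (ev f) p ↔
      ∀ v ∈ S, dotForm (hM.IT T) p.1 v = dotForm (hM.IT T) f v := by
  simp only [IsVProjT, hM.intT_dot, Subtype.forall]

theorem isEdgeGrad_iff (k : ℕ) (E : Fin M.nE) (qE : PolE ((k : ℤ) - 1)) (qV : Fin M.nV → ℝ)
    (g : PolE (k : ℤ)) : M.IsEdgeGrad k E qE qV g ↔ ∀ r ∈ PolE (k : ℤ),
      mulForm (M.IE E) g.1 r = - mulForm (M.IE E) qE.1 (Polynomial.derivative r) +
        qV (M.head E) * r.eval (M.len E) - qV (M.tail E) * r.eval 0 := by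
  simp only [IsEdgeGrad, intE_mul, Subtype.forall]

theorem isFaceGrad_iff (hM : M.IsPolyhedralMesh Ω) (k : ℕ) (F : Fin M.nF)
    (qF : PolS 2 ((k : ℤ) - 1)) (qE : Fin M.nE → PolE ((k : ℤ) - 1)) (qV : Fin M.nV → ℝ)
    (g : PolV 2 (k : ℤ)) : M.IsFaceGrad k F qF qE qV g ↔ ∀ v ∈ PolV 2 (k : ℤ),
      dotForm (hM.IF F) g.1 v = - mulForm (hM.IF F) qF.1 (vdiv v) +
        M.bdN F (fun E => (M.edgeTrace k E (qE E) qV).1) v := by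
  simp only [IsFaceGrad, hM.intF_mul, hM.intF_dot, hM.bdryF_nrm F
    (fun E => (M.edgeTrace k E (qE E) qV).1), Subtype.forall]

theorem isFaceTrace_iff (hM : M.IsPolyhedralMesh Ω) (k : ℕ) (F : Fin M.nF)
    (qF : PolS 2 ((k : ℤ) - 1)) (qE : Fin M.nE → PolE ((k : ℤ) - 1)) (qV : Fin M.nV → ℝ)
    (p : PolS 2 ((k : ℤ) + 1)) :
    M.IsFaceTrace k F qF qE qV p ↔ ∀ v ∈ RolyFc ((k : ℤ) + 2),
      mulForm (hM.IF F) p.1 (vdiv v) = - dotForm (hM.IF F) (M.faceGrad k F qF qE qV).1 v +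
        M.bdN F (fun E => (M.edgeTrace k E (qE E) qV).1) v := by
  simp only [IsFaceTrace, hM.intF_mul, hM.intF_dot, hM.bdryF_nrm F
    (fun E => (M.edgeTrace k E (qE E) qV).1), Subtype.forall]

theorem isElemGrad_iff (hM : M.IsPolyhedralMesh Ω) (k : ℕ) (T : Fin M.nT)
    (qT : PolS 3 ((k : ℤ) - 1)) (qF : Fin M.nF → PolS 2 ((k : ℤ) - 1))
    (qE : Fin M.nE → PolE ((k : ℤ) - 1)) (qV : Fin M.nV → ℝ)
    (g : PolV 3 (k : ℤ)) : M.IsElemGrad k T qT qF qE qV g ↔ ∀ v ∈ PolV 3 (k : ℤ),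
      dotForm (hM.IT T) g.1 v = - mulForm (hM.IT T) qT.1 (vdiv v) +
        hM.bdT T (fun F => (M.faceTrace k F (qF F) qE qV).1) v := by
  simp only [IsElemGrad, hM.intT_mul, hM.intT_dot, hM.bdryT_nrm T
    (fun F => (M.faceTrace k F (qF F) qE qV).1), Subtype.forall]

theorem isFaceCurl_iff (hM : M.IsPolyhedralMesh Ω) (k : ℕ) (F : Fin M.nF)
    (vF : RolyF ((k : ℤ) - 1)) (vE : Fin M.nE → PolE (k : ℤ)) (c : PolS 2 (k : ℤ)) :
    M.IsFaceCurl k F vF vE c ↔ ∀ r ∈ PolS 2 (k : ℤ),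
      mulForm (hM.IF F) c.1 r = dotForm (hM.IF F) vF.1 (vrot r) -
        M.bdS F (fun E => (vE E).1) r := by
  simp only [IsFaceCurl, hM.intF_mul, hM.intF_dot, bdryF_res F (fun E => (vE E).1),
    Subtype.forall]

theorem isTanTrace_iff (hM : M.IsPolyhedralMesh Ω) (k : ℕ) (F : Fin M.nF)
    (vF : RolyF ((k : ℤ) - 1)) (vFc : RolyFc k) (vE : Fin M.nE → PolE (k : ℤ))
    (u : PolV 2 (k : ℤ)) :
    M.IsTanTrace k F vF vFc vE u ↔
      ∀ r ∈ PolS 2 ((k : ℤ) + 1), hM.IF F r = 0 → ∀ w ∈ RolyFc k,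
        dotForm (hM.IF F) u.1 (vrot r + w) =
          mulForm (hM.IF F) (M.faceCurl k F vF vE).1 r + M.bdS F (fun E => (vE E).1) r +
            dotForm (hM.IF F) vFc.1 w := by
  simp only [IsTanTrace, hM.intF_mul, hM.intF_dot, bdryF_res F (fun E => (vE E).1)]
  exact ⟨fun h r hr h0 => h r ⟨hr, h0⟩, fun h r hr => h r hr.1 hr.2⟩

theorem tanBdry_eq (hM : M.IsPolyhedralMesh Ω) (k : ℕ) (T : Fin M.nT)
    (vF : Fin M.nF → RolyF ((k : ℤ) - 1)) (vFc : Fin M.nF → RolyFc k)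
    (vE : Fin M.nE → PolE (k : ℤ)) (w : VPol 3) : M.tanBdry k T vF vFc vE w =
      hM.bdTan T (fun F => (M.tanTrace k F (vF F) (vFc F) vE).1) w :=
  hM.bdryT_tan T (fun F => (M.tanTrace k F (vF F) (vFc F) vE).1) w

theorem isElemCurl_iff (hM : M.IsPolyhedralMesh Ω) (k : ℕ) (T : Fin M.nT)
    (vT : RolyT ((k : ℤ) - 1)) (vF : Fin M.nF → RolyF ((k : ℤ) - 1)) (vFc : Fin M.nF → RolyFc k)
    (vE : Fin M.nE → PolE (k : ℤ)) (c : PolV 3 (k : ℤ)) :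
    M.IsElemCurl k T vT vF vFc vE c ↔ ∀ w ∈ PolV 3 (k : ℤ),
      dotForm (hM.IT T) c.1 w = dotForm (hM.IT T) vT.1 (curl w) +
        hM.bdTan T (fun F => (M.tanTrace k F (vF F) (vFc F) vE).1) w := by
  simp only [IsElemCurl, hM.intT_dot, hM.tanBdry_eq, Subtype.forall]

theorem isPotCurl_iff (hM : M.IsPolyhedralMesh Ω) (k : ℕ) (T : Fin M.nT)
    (vT : RolyT ((k : ℤ) - 1)) (vTc : RolyTc (M.ctrT T) k)
    (vF : Fin M.nF → RolyF ((k : ℤ) - 1)) (vFc : Fin M.nF → RolyFc k)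
    (vE : Fin M.nE → PolE (k : ℤ)) (p : PolV 3 (k : ℤ)) :
    M.IsPotCurl k T vT vTc vF vFc vE p ↔
      ∀ w ∈ GolyTc (M.ctrT T) ((k : ℤ) + 1), ∀ z ∈ RolyTc (M.ctrT T) k,
        dotForm (hM.IT T) p.1 (curl w + z) =
          dotForm (hM.IT T) (M.elemCurl k T vT vF vFc vE).1 w -
            hM.bdTan T (fun F => (M.tanTrace k F (vF F) (vFc F) vE).1) w +
            dotForm (hM.IT T) vTc.1 z := by
  simp only [IsPotCurl, hM.intT_dot, hM.tanBdry_eq]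

theorem isElemDiv_iff (hM : M.IsPolyhedralMesh Ω) (k : ℕ) (T : Fin M.nT)
    (wT : GolyT ((k : ℤ) - 1)) (wF : Fin M.nF → PolS 2 (k : ℤ)) (d : PolS 3 (k : ℤ)) :
    M.IsElemDiv k T wT wF d ↔ ∀ r ∈ PolS 3 (k : ℤ),
      mulForm (hM.IT T) d.1 r = - dotForm (hM.IT T) wT.1 (grad 3 r) +
        hM.bdTS T (fun F => (wF F).1) r := by
  simp only [IsElemDiv, divBdry, hM.intT_mul, hM.intT_dot, hM.bdryT_res T (fun F => (wF F).1),
    Subtype.forall]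

theorem isPotDiv_iff (hM : M.IsPolyhedralMesh Ω) (k : ℕ) (T : Fin M.nT)
    (wT : GolyT ((k : ℤ) - 1)) (wTc : GolyTc (M.ctrT T) k) (wF : Fin M.nF → PolS 2 (k : ℤ))
    (p : PolV 3 (k : ℤ)) :
    M.IsPotDiv k T wT wTc wF p ↔
      ∀ r ∈ PolS 3 ((k : ℤ) + 1), hM.IT T r = 0 → ∀ z ∈ GolyTc (M.ctrT T) k,
        dotForm (hM.IT T) p.1 (grad 3 r + z) =
          - mulForm (hM.IT T) (M.elemDiv k T wT wF).1 r + hM.bdTS T (fun F => (wF F).1) r +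
            dotForm (hM.IT T) wTc.1 z := by
  simp only [IsPotDiv, divBdry, hM.intT_mul, hM.intT_dot, hM.bdryT_res T (fun F => (wF F).1)]
  exact ⟨fun h r hr h0 => h r ⟨hr, h0⟩, fun h r hr => h r hr.1 hr.2⟩

theorem isExtPolE_iff (k : ℕ) (q : M.XGrad 0) (E : Fin M.nE) (p : PolE ((k : ℤ) - 1)) :
    M.IsExtPolE k q E p ↔ ∀ r ∈ PolE (k : ℤ),
      mulForm (M.IE E) p.1 (Polynomial.derivative r) =
        - mulForm (M.IE E) (M.edgeGrad 0 E (q.qE E) q.qV).1 r +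
          q.qV (M.head E) * r.eval (M.len E) - q.qV (M.tail E) * r.eval 0 := by
  simp only [IsExtPolE, intE_mul, Subtype.forall]

theorem isExtPolF_iff (hM : M.IsPolyhedralMesh Ω) (k : ℕ) (q : M.XGrad 0) (F : Fin M.nF)
    (p : PolS 2 ((k : ℤ) - 1)) :
    M.IsExtPolF k q F p ↔ ∀ v ∈ RolyFc k,
      mulForm (hM.IF F) p.1 (vdiv v) =
        - dotForm (hM.IF F) (M.faceGrad 0 F (q.qF F) q.qE q.qV).1 v +
          M.bdN F (fun E => (M.edgeTrace k E (M.extPolE k q E) q.qV).1) v := by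
  simp only [IsExtPolF, hM.intF_mul, hM.intF_dot, hM.bdryF_nrm F
    (fun E => (M.edgeTrace k E (M.extPolE k q E) q.qV).1), Subtype.forall]

theorem isExtPolT_iff (hM : M.IsPolyhedralMesh Ω) (k : ℕ) (q : M.XGrad 0) (T : Fin M.nT)
    (p : PolS 3 ((k : ℤ) - 1)) :
    M.IsExtPolT k q T p ↔ ∀ v ∈ RolyTc (M.ctrT T) k,
      mulForm (hM.IT T) p.1 (vdiv v) =
        - dotForm (hM.IT T) (M.elemGrad 0 T (q.qT T) q.qF q.qE q.qV).1 v +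
          hM.bdT T (fun F => (M.faceTrace k F (M.extPolF k q F) (M.extPolE k q) q.qV).1) v := by
  simp only [IsExtPolT, hM.intT_mul, hM.intT_dot, hM.bdryT_nrm T
    (fun F => (M.faceTrace k F (M.extPolF k q F) (M.extPolE k q) q.qV).1), Subtype.forall]

theorem isExtRolyF_iff (hM : M.IsPolyhedralMesh Ω) (k : ℕ) (v : M.XCurl 0) (F : Fin M.nF)
    (u : RolyF ((k : ℤ) - 1)) :
    M.IsExtRolyF k v F u ↔ ∀ r ∈ PolS 2 (k : ℤ),
      dotForm (hM.IF F) u.1 (vrot r) = mulForm (hM.IF F) (M.faceCurl 0 F (v.vF F) v.vE).1 r +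
        M.bdS F (fun E => (v.vE E).1) r := by
  simp only [IsExtRolyF, hM.intF_mul, hM.intF_dot, bdryF_res F (fun E => (v.vE E).1),
    Subtype.forall]

theorem isExtRolyT_iff (hM : M.IsPolyhedralMesh Ω) (k : ℕ) (v : M.XCurl 0) (T : Fin M.nT)
    (u : RolyT ((k : ℤ) - 1)) :
    M.IsExtRolyT k v T u ↔ ∀ w ∈ GolyTc (M.ctrT T) k,
      dotForm (hM.IT T) u.1 (curl w) =
        dotForm (hM.IT T) (M.elemCurl 0 T (v.vT T) v.vF v.vFc v.vE).1 w -
          hM.bdTan T (fun F => (M.tanTrace k F (M.extRolyF k v F) (M.extRolyFc k v F)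
            (M.inclE k v)).1) w := by
  simp only [IsExtRolyT, hM.intT_dot, hM.tanBdry_eq, Subtype.forall]

theorem isExtGolyT_iff (hM : M.IsPolyhedralMesh Ω) (k : ℕ) (w : M.XDiv 0) (T : Fin M.nT)
    (u : GolyT ((k : ℤ) - 1)) :
    M.IsExtGolyT k w T u ↔ ∀ r ∈ PolS 3 (k : ℤ),
      dotForm (hM.IT T) u.1 (grad 3 r) =
        - mulForm (hM.IT T) (M.elemDiv 0 T (w.wT T) w.wF).1 r +
          hM.bdTS T (fun F => (w.wF F).1) r := by
  simp only [IsExtGolyT, divBdry, hM.intT_mul, hM.intT_dot, hM.bdryT_res T (fun F => (w.wF F).1),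
    Subtype.forall]

end IsPolyhedralMesh

end MeshData

end DDR

namespace DDR

open MvPolynomial

namespace MeshData

variable {M : MeshData} {Ω : Set R3}

namespace IsPolyhedralMesh

/-! ### Well-posedness -/

theorem existsUnique_projE (hM : M.IsPolyhedralMesh Ω) (E : Fin M.nE) (l : ℤ) {f : ℝ → ℝ}
    (hf : Continuous f) : ∃! p, M.IsProjE E (PolE l) f p := by
  let φ : Polynomial ℝ →ₗ[ℝ] ℝ :=
    { toFun := fun r => M.intE E (fun s => f s * r.eval s)
      map_add' := fun p q => by
        simp only [Polynomial.eval_add, mul_add]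
        exact intervalIntegral.integral_add ((hf.mul p.continuous).intervalIntegrable _ _)
          ((hf.mul q.continuous).intervalIntegrable _ _)
      map_smul' := fun c p => by
        simp only [Polynomial.eval_smul, smul_eq_mul, mul_left_comm _ c, RingHom.id_apply]
        exact intervalIntegral.integral_const_mul _ _ }
  simp only [IsProjE, intE_mul, Subtype.forall]
  exact existsUnique_riesz' (PolE l) (mulForm (M.IE E)) (fun _ _ h => hM.mulE_pos E h) φ

theorem existsUnique_projF (hM : M.IsPolyhedralMesh Ω) (F : Fin M.nF) (l : ℤ) {f : R2 → ℝ}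
    (hf : Continuous f) : ∃! p, M.IsProjF F (PolS 2 l) f p := by
  have hint : ∀ p : SPol 2, IntegrableOn (fun y => f y * eval y p) (M.dom F) := fun p =>
    ((hf.mul (continuous_eval' p)).continuousOn.integrableOn_compact
      (hM.isBounded_dom F).isCompact_closure).mono_set subset_closure
  let φ : SPol 2 →ₗ[ℝ] ℝ :=
    { toFun := fun r => M.intF F (fun s => f s * eval s r)
      map_add' := fun p q => by
        simp only [map_add, mul_add]
        exact integral_add (hint p) (hint q)
      map_smul' := fun c p => by
        simp only [smul_eval, mul_left_comm _ c, RingHom.id_apply, smul_eq_mul]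
        exact integral_const_mul _ _ }
  simp only [IsProjF, hM.intF_mul, Subtype.forall]
  exact existsUnique_riesz' (PolS 2 l) (mulForm (hM.IF F)) (fun _ _ h => hM.mulF_pos F h) φ

theorem existsUnique_projT (hM : M.IsPolyhedralMesh Ω) (T : Fin M.nT) (l : ℤ) {f : R3 → ℝ}
    (hf : Continuous f) : ∃! p, M.IsProjT T (PolS 3 l) f p := by
  have hint : ∀ p : SPol 3, IntegrableOn (fun y => f y * eval y p) (M.cell T) := fun p =>
    ((hf.mul (continuous_eval' p)).continuousOn.integrableOn_compact
      (hM.isBounded_cell T).isCompact_closure).mono_set subset_closure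
  let φ : SPol 3 →ₗ[ℝ] ℝ :=
    { toFun := fun r => M.intT T (fun s => f s * eval s r)
      map_add' := fun p q => by
        simp only [map_add, mul_add]
        exact integral_add (hint p) (hint q)
      map_smul' := fun c p => by
        simp only [smul_eval, mul_left_comm _ c, RingHom.id_apply, smul_eq_mul]
        exact integral_const_mul _ _ }
  simp only [IsProjT, hM.intT_mul, Subtype.forall]
  exact existsUnique_riesz' (PolS 3 l) (mulForm (hM.IT T)) (fun _ _ h => hM.mulT_pos T h) φ

theorem existsUnique_vprojF (hM : M.IsPolyhedralMesh Ω) (F : Fin M.nF) (S : Submodule ℝ (VPol 2))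
    [Module.Finite ℝ S] (f : VPol 2) : ∃! p, M.IsVProjF F S (ev f) p := by
  simp only [hM.isVProjF_iff]
  exact existsUnique_riesz' S (dotForm (hM.IF F)) (fun _ _ h => hM.dotF_pos F h) _

theorem existsUnique_vprojT (hM : M.IsPolyhedralMesh Ω) (T : Fin M.nT) (S : Submodule ℝ (VPol 3))
    [Module.Finite ℝ S] (f : VPol 3) : ∃! p, M.IsVProjT T S (ev f) p := by
  simp only [hM.isVProjT_iff]
  exact existsUnique_riesz' S (dotForm (hM.IT T)) (fun _ _ h => hM.dotT_pos T h) _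

/-- Evaluation difference `a r(L) - b r(0)`. -/
noncomputable def endForm (L a b : ℝ) : Polynomial ℝ →ₗ[ℝ] ℝ :=
  a • Polynomial.leval L - b • Polynomial.leval 0

theorem existsUnique_edgeGrad (hM : M.IsPolyhedralMesh Ω) (k : ℕ) (E : Fin M.nE)
    (qE : PolE ((k : ℤ) - 1)) (qV : Fin M.nV → ℝ) : ∃! g, M.IsEdgeGrad k E qE qV g := by
  simp only [isEdgeGrad_iff, add_sub_assoc]
  exact existsUnique_riesz' (PolE k) (mulForm (M.IE E)) (fun _ _ h => hM.mulE_pos E h)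
    (-(mulForm (M.IE E) qE.1 ∘ₗ Polynomial.derivative) +
      endForm (M.len E) (qV (M.head E)) (qV (M.tail E)))

theorem edgeGrad_spec (hM : M.IsPolyhedralMesh Ω) (k : ℕ) (E : Fin M.nE)
    (qE : PolE ((k : ℤ) - 1)) (qV : Fin M.nV → ℝ) {r : Polynomial ℝ} (hr : r ∈ PolE (k : ℤ)) :
    mulForm (M.IE E) (M.edgeGrad k E qE qV).1 r =
      - mulForm (M.IE E) qE.1 (Polynomial.derivative r) +
        qV (M.head E) * r.eval (M.len E) - qV (M.tail E) * r.eval 0 :=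
  (isEdgeGrad_iff k E qE qV _).1 (theSol_spec (hM.existsUnique_edgeGrad k E qE qV)) r hr

theorem mulE_by_parts (E : Fin M.nE) (p r : Polynomial ℝ) :
    mulForm (M.IE E) p (Polynomial.derivative r) =
      - mulForm (M.IE E) (Polynomial.derivative p) r + p.eval (M.len E) * r.eval (M.len E) -
        p.eval 0 * r.eval 0 := by
  have h := intEdge_derivative (M.len E) (p * r)
  rw [Polynomial.derivative_mul, map_add, Polynomial.eval_mul, Polynomial.eval_mul] at h
  rw [mulForm_apply, mulForm_apply, IE]
  linarith

/-- The edge trace is characterised by its derivative, the edge gradient, and its value at the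
first endpoint. -/
theorem isEdgeTrace_iff (hM : M.IsPolyhedralMesh Ω) (k : ℕ) (E : Fin M.nE)
    (qE : PolE ((k : ℤ) - 1)) (qV : Fin M.nV → ℝ) (p : PolE ((k : ℤ) + 1)) :
    M.IsEdgeTrace k E qE qV p ↔ p.1.eval 0 = qV (M.tail E) ∧
      Polynomial.derivative p.1 = (M.edgeGrad k E qE qV).1 := by
  have hd : Polynomial.derivative p.1 ∈ PolE (k : ℤ) := by
    have := derivative_mem p.2
    rwa [add_sub_cancel_right] at this
  simp only [IsEdgeTrace, IsProjE, intE_mul, Subtype.forall]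
  constructor
  · rintro ⟨h0, hL, h⟩
    refine ⟨h0, ?_⟩
    -- Integration by parts on the edge shows that the derivative of the trace and the edge gradient
    -- have the same moments of degree up to `k`.
    have key : ∀ r ∈ PolE (k : ℤ), mulForm (M.IE E)
        (Polynomial.derivative p.1 - (M.edgeGrad k E qE qV).1) r = 0 := by
      intro r hr
      have h1 := mulE_by_parts E p.1 r
      rw [map_sub, LinearMap.sub_apply, hM.edgeGrad_spec k E qE qV hr, h _ (derivative_mem hr), h1,
        h0, hL]
      ring
    exact sub_eq_zero.1 (hM.mulE_pos E (key _ (sub_mem hd (M.edgeGrad k E qE qV).2)))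
  · rintro ⟨h0, h⟩
    -- The test function 1 in the edge gradient gives the value at the second endpoint;
    -- antiderivatives as test functions then give all moments of degree up to `k - 1`.
    have hL : p.1.eval (M.len E) = qV (M.head E) := by
      have h1 := hM.edgeGrad_spec k E qE qV (C_mem_PolE (Int.natCast_nonneg k) 1)
      have h2 := mulE_by_parts E p.1 (Polynomial.C 1)
      rw [Polynomial.derivative_C, map_zero] at h1 h2
      rw [h, h1, h0] at h2
      simp only [Polynomial.eval_C] at h2
      linarith
    refine ⟨h0, hL, fun r hr => ?_⟩
    have hr' : antideriv r ∈ PolE (k : ℤ) := by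
      have := antideriv_mem hr
      rwa [sub_add_cancel] at this
    have h1 := hM.edgeGrad_spec k E qE qV hr'
    have h2 := mulE_by_parts E p.1 (antideriv r)
    rw [derivative_antideriv] at h1 h2
    rw [h2, h, h1, h0, hL]
    ring

theorem existsUnique_edgeTrace (hM : M.IsPolyhedralMesh Ω) (k : ℕ) (E : Fin M.nE)
    (qE : PolE ((k : ℤ) - 1)) (qV : Fin M.nV → ℝ) : ∃! p, M.IsEdgeTrace k E qE qV p := by
  simp only [hM.isEdgeTrace_iff]
  refine ⟨⟨antideriv (M.edgeGrad k E qE qV).1 + Polynomial.C (qV (M.tail E)),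
    add_mem (antideriv_mem (M.edgeGrad k E qE qV).2) (C_mem_PolE (by positivity) _)⟩, ⟨?_, ?_⟩, ?_⟩
  · rw [Polynomial.eval_add, antideriv_eval_zero, Polynomial.eval_C, zero_add]
  · rw [Polynomial.derivative_add, derivative_antideriv, Polynomial.derivative_C, add_zero]
  · rintro p ⟨h0, h⟩
    refine Subtype.ext (sub_eq_zero.1 ?_)
    have h1 : Polynomial.derivative (p.1 - (antideriv (M.edgeGrad k E qE qV).1 +
        Polynomial.C (qV (M.tail E)))) = 0 := by
      rw [Polynomial.derivative_sub, Polynomial.derivative_add, derivative_antideriv, h]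
      simp
    rw [eq_C_of_derivative_eq_zero h1]
    simp [h0, antideriv_eval_zero]

theorem edgeTrace_spec (hM : M.IsPolyhedralMesh Ω) (k : ℕ) (E : Fin M.nE)
    (qE : PolE ((k : ℤ) - 1)) (qV : Fin M.nV → ℝ) :
    M.IsEdgeTrace k E qE qV (M.edgeTrace k E qE qV) :=
  theSol_spec (hM.existsUnique_edgeTrace k E qE qV)

theorem existsUnique_faceGrad (hM : M.IsPolyhedralMesh Ω) (k : ℕ) (F : Fin M.nF)
    (qF : PolS 2 ((k : ℤ) - 1)) (qE : Fin M.nE → PolE ((k : ℤ) - 1)) (qV : Fin M.nV → ℝ) :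
    ∃! g, M.IsFaceGrad k F qF qE qV g := by
  simp only [hM.isFaceGrad_iff]
  exact existsUnique_riesz' (PolV 2 k) (dotForm (hM.IF F)) (fun _ _ h => hM.dotF_pos F h)
    (-(mulForm (hM.IF F) qF.1 ∘ₗ vdivL 2) +
      M.bdN F (fun E => (M.edgeTrace k E (qE E) qV).1))

/-- The divergence maps `R^{c,l}(F)` bijectively onto `P^{l-1}(F)`, so every functional is
admissible. It serves the face trace with `l = k + 2` and the face extension with `l = k`. -/
theorem existsUnique_vdivF (hM : M.IsPolyhedralMesh Ω) (F : Fin M.nF) (l : ℤ)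
    (f : VPol 2 →ₗ[ℝ] ℝ) : ∃! p : PolS 2 (l - 1), ∀ v ∈ RolyFc l,
      mulForm (hM.IF F) p.1 (vdiv v) = f v :=
  existsUnique_riesz (PolS 2 (l - 1)) (mulForm (hM.IF F)) (fun _ _ h => hM.mulF_pos F h)
    (RolyFc l) (vdivL 2) (fun _ hv => vdiv_mem (RolyFc_le hv)) (fun _ hu => exists_RolyFc_vdiv hu) f
    fun v hv h => by rw [RolyFc_eq_zero_of_vdiv hv h, map_zero]

theorem existsUnique_faceTrace (hM : M.IsPolyhedralMesh Ω) (k : ℕ) (F : Fin M.nF)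
    (qF : PolS 2 ((k : ℤ) - 1)) (qE : Fin M.nE → PolE ((k : ℤ) - 1)) (qV : Fin M.nV → ℝ) :
    ∃! p, M.IsFaceTrace k F qF qE qV p := by
  simp only [hM.isFaceTrace_iff]
  have h := hM.existsUnique_vdivF F ((k : ℤ) + 2)
    (-(dotForm (hM.IF F) (M.faceGrad k F qF qE qV).1) +
      M.bdN F (fun E => (M.edgeTrace k E (qE E) qV).1))
  rwa [show (k : ℤ) + 2 - 1 = k + 1 by ring] at h

theorem existsUnique_elemGrad (hM : M.IsPolyhedralMesh Ω) (k : ℕ) (T : Fin M.nT)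
    (qT : PolS 3 ((k : ℤ) - 1)) (qF : Fin M.nF → PolS 2 ((k : ℤ) - 1))
    (qE : Fin M.nE → PolE ((k : ℤ) - 1)) (qV : Fin M.nV → ℝ) :
    ∃! g, M.IsElemGrad k T qT qF qE qV g := by
  simp only [hM.isElemGrad_iff]
  exact existsUnique_riesz' (PolV 3 k) (dotForm (hM.IT T)) (fun _ _ h => hM.dotT_pos T h)
    (-(mulForm (hM.IT T) qT.1 ∘ₗ vdivL 3) +
      hM.bdT T (fun F => (M.faceTrace k F (qF F) qE qV).1))

theorem existsUnique_faceCurl (hM : M.IsPolyhedralMesh Ω) (k : ℕ) (F : Fin M.nF)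
    (vF : RolyF ((k : ℤ) - 1)) (vE : Fin M.nE → PolE (k : ℤ)) :
    ∃! c, M.IsFaceCurl k F vF vE c := by
  simp only [hM.isFaceCurl_iff]
  exact existsUnique_riesz' (PolS 2 k) (mulForm (hM.IF F)) (fun _ _ h => hM.mulF_pos F h)
    (dotForm (hM.IF F) vF.1 ∘ₗ vrot - M.bdS F (fun E => (vE E).1))

theorem exists_IF_sub_C (hM : M.IsPolyhedralMesh Ω) (F : Fin M.nF) (r : SPol 2) :
    ∃ a : ℝ, hM.IF F (r - C a) = 0 := by
  have h1 : hM.IF F (C 1) ≠ 0 := fun h => one_ne_zero (hM.IF_C_ne_zero F h)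
  refine ⟨hM.IF F r / hM.IF F (C 1), ?_⟩
  rw [← mul_one (_ / _), C_mul, C_mul', map_sub, map_smul, smul_eq_mul, div_mul_cancel₀ _ h1,
    sub_self]

theorem exists_IT_sub_C (hM : M.IsPolyhedralMesh Ω) (T : Fin M.nT) (r : SPol 3) :
    ∃ a : ℝ, hM.IT T (r - C a) = 0 := by
  have h1 : hM.IT T (C 1) ≠ 0 := fun h => one_ne_zero (hM.IT_C_ne_zero T h)
  refine ⟨hM.IT T r / hM.IT T (C 1), ?_⟩
  rw [← mul_one (_ / _), C_mul, C_mul', map_sub, map_smul, smul_eq_mul, div_mul_cancel₀ _ h1,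
    sub_self]

/-- `P^k(F)` is the direct sum of rotationals and `R^{c,k}(F)`. The zero-mean condition removes the
constants, which are the kernel of `vrot`, so no compatibility is needed. -/
theorem existsUnique_tanTrace (hM : M.IsPolyhedralMesh Ω) (k : ℕ) (F : Fin M.nF)
    (vF : RolyF ((k : ℤ) - 1)) (vFc : RolyFc k) (vE : Fin M.nE → PolE (k : ℤ)) :
    ∃! u, M.IsTanTrace k F vF vFc vE u := by
  simp only [hM.isTanTrace_iff]
  have h := existsUnique_riesz (PolV 2 k) (dotForm (hM.IF F)) (fun _ _ h => hM.dotF_pos F h)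
    ((PolS 2 ((k : ℤ) + 1) ⊓ LinearMap.ker (hM.IF F)).prod (RolyFc k)) (vrot.coprod LinearMap.id)
    ?_ ?_ ((mulForm (hM.IF F) (M.faceCurl k F vF vE).1 + M.bdS F (fun E => (vE E).1)).coprod
      (dotForm (hM.IF F) vFc.1)) ?_
  · refine (existsUnique_congr fun u => ?_).1 h
    exact ⟨fun h r hr h0 w hw => h (r, w) ⟨⟨hr, h0⟩, hw⟩,
      fun h v hv => h v.1 hv.1.1 hv.1.2 v.2 hv.2⟩
  · rintro ⟨r, w⟩ ⟨⟨hr, -⟩, hw⟩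
    have := vrot_mem hr
    rw [add_sub_cancel_right] at this
    exact add_mem this (RolyFc_le hw)
  · intro u hu
    obtain ⟨r, hr, w, hw, rfl⟩ := exists_vrot_add hu
    obtain ⟨a, ha⟩ := hM.exists_IF_sub_C F r
    refine ⟨(r - C a, w), ⟨⟨sub_mem hr (C_mem_PolS a (by positivity)), ha⟩, hw⟩, ?_⟩
    rw [LinearMap.coprod_apply, map_sub, vrot_C, sub_zero, LinearMap.id_apply]
  · rintro ⟨r, w⟩ ⟨⟨hr, h0⟩, hw⟩ h
    obtain ⟨rfl, h2⟩ := eq_zero_of_vrot_add hw h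
    replace h2 : r = C (eval 0 r) := h2
    have h0 : hM.IF F r = 0 := h0
    rw [h2] at h0
    have hr : r = 0 := by rw [h2, hM.IF_C_ne_zero F h0, map_zero]
    rw [hr]
    exact map_zero _

theorem existsUnique_elemCurl (hM : M.IsPolyhedralMesh Ω) (k : ℕ) (T : Fin M.nT)
    (vT : RolyT ((k : ℤ) - 1)) (vF : Fin M.nF → RolyF ((k : ℤ) - 1)) (vFc : Fin M.nF → RolyFc k)
    (vE : Fin M.nE → PolE (k : ℤ)) : ∃! c, M.IsElemCurl k T vT vF vFc vE c := by
  simp only [hM.isElemCurl_iff]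
  exact existsUnique_riesz' (PolV 3 k) (dotForm (hM.IT T)) (fun _ _ h => hM.dotT_pos T h)
    (dotForm (hM.IT T) vT.1 ∘ₗ curl +
      hM.bdTan T (fun F => (M.tanTrace k F (vF F) (vFc F) vE).1))

theorem existsUnique_elemDiv (hM : M.IsPolyhedralMesh Ω) (k : ℕ) (T : Fin M.nT)
    (wT : GolyT ((k : ℤ) - 1)) (wF : Fin M.nF → PolS 2 (k : ℤ)) :
    ∃! d, M.IsElemDiv k T wT wF d := by
  simp only [hM.isElemDiv_iff]
  exact existsUnique_riesz' (PolS 3 k) (mulForm (hM.IT T)) (fun _ _ h => hM.mulT_pos T h)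
    (-(dotForm (hM.IT T) wT.1 ∘ₗ grad 3) + hM.bdTS T (fun F => (wF F).1))

/-- `(w, z) ↦ curl w + z` is a bijection of `G^{c,k+1}(T) × R^{c,k}(T)` onto the fields of degree
`k`, so the right-hand side is unrestricted. -/
theorem existsUnique_potCurl (hM : M.IsPolyhedralMesh Ω) (k : ℕ) (T : Fin M.nT)
    (vT : RolyT ((k : ℤ) - 1)) (vTc : RolyTc (M.ctrT T) k)
    (vF : Fin M.nF → RolyF ((k : ℤ) - 1)) (vFc : Fin M.nF → RolyFc k)
    (vE : Fin M.nE → PolE (k : ℤ)) : ∃! p, M.IsPotCurl k T vT vTc vF vFc vE p := by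
  simp only [hM.isPotCurl_iff]
  have h := existsUnique_riesz (PolV 3 k) (dotForm (hM.IT T)) (fun _ _ h => hM.dotT_pos T h)
    ((GolyTc (M.ctrT T) ((k : ℤ) + 1)).prod (RolyTc (M.ctrT T) k)) (curl.coprod LinearMap.id)
    ?_ ?_ ((dotForm (hM.IT T) (M.elemCurl k T vT vF vFc vE).1 -
      hM.bdTan T (fun F => (M.tanTrace k F (vF F) (vFc F) vE).1)).coprod
      (dotForm (hM.IT T) vTc.1)) ?_
  · refine (existsUnique_congr fun u => ?_).1 h
    exact ⟨fun h w hw z hz => h (w, z) ⟨hw, hz⟩, fun h v hv => h v.1 hv.1 v.2 hv.2⟩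
  · rintro ⟨w, z⟩ ⟨hw, hz⟩
    have := curl_mem (GolyTc_le _ hw)
    rw [add_sub_cancel_right] at this
    exact add_mem this (RolyTc_le _ hz)
  · intro u hu
    obtain ⟨w, hw, z, hz, rfl⟩ := exists_curl_add (M.ctrT T) hu
    exact ⟨(w, z), ⟨hw, hz⟩, rfl⟩
  · rintro ⟨w, z⟩ ⟨hw, hz⟩ h
    obtain ⟨h1, h2⟩ := eq_zero_of_curl_add hw hz h
    simp only at h1 h2
    rw [h1, h2]
    exact map_zero _

theorem existsUnique_potDiv (hM : M.IsPolyhedralMesh Ω) (k : ℕ) (T : Fin M.nT)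
    (wT : GolyT ((k : ℤ) - 1)) (wTc : GolyTc (M.ctrT T) k) (wF : Fin M.nF → PolS 2 (k : ℤ)) :
    ∃! p, M.IsPotDiv k T wT wTc wF p := by
  simp only [hM.isPotDiv_iff]
  have h := existsUnique_riesz (PolV 3 k) (dotForm (hM.IT T)) (fun _ _ h => hM.dotT_pos T h)
    ((PolS 3 ((k : ℤ) + 1) ⊓ LinearMap.ker (hM.IT T)).prod (GolyTc (M.ctrT T) k))
    ((grad 3).coprod LinearMap.id)
    ?_ ?_ ((-mulForm (hM.IT T) (M.elemDiv k T wT wF).1 + hM.bdTS T (fun F => (wF F).1)).coprod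
      (dotForm (hM.IT T) wTc.1)) ?_
  · refine (existsUnique_congr fun u => ?_).1 h
    exact ⟨fun h r hr h0 w hw => h (r, w) ⟨⟨hr, h0⟩, hw⟩,
      fun h v hv => h v.1 hv.1.1 hv.1.2 v.2 hv.2⟩
  · rintro ⟨r, z⟩ ⟨⟨hr, -⟩, hz⟩
    have := grad_mem hr
    rw [add_sub_cancel_right] at this
    exact add_mem this (GolyTc_le _ hz)
  · intro u hu
    obtain ⟨r, hr, z, hz, rfl⟩ := exists_grad_add (M.ctrT T) hu
    obtain ⟨a, ha⟩ := hM.exists_IT_sub_C T r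
    refine ⟨(r - C a, z), ⟨⟨sub_mem hr (C_mem_PolS a (by positivity)), ha⟩, hz⟩, ?_⟩
    rw [LinearMap.coprod_apply, map_sub, grad_C, sub_zero, LinearMap.id_apply]
  · rintro ⟨r, z⟩ ⟨⟨hr, h0⟩, hz⟩ h
    obtain ⟨h2, rfl⟩ := eq_zero_of_grad_add hz h
    replace h2 : r = C (eval (M.ctrT T) r) := h2
    have h0 : hM.IT T r = 0 := h0
    rw [h2] at h0
    have hr : r = 0 := by rw [h2, hM.IT_C_ne_zero T h0, map_zero]
    rw [hr]
    exact map_zero _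

theorem operatorsWellPosed (hM : M.IsPolyhedralMesh Ω) (k : ℕ) : M.OperatorsWellPosed k where
  projT T _ hf := hM.existsUnique_projT T _ hf
  projF F _ hf := hM.existsUnique_projF F _ hf
  projE E _ hf := hM.existsUnique_projE E _ hf
  vprojRF F f := hM.existsUnique_vprojF F _ f
  vprojRFc F f := hM.existsUnique_vprojF F _ f
  vprojRT T f := hM.existsUnique_vprojT T _ f
  vprojRTc T f := hM.existsUnique_vprojT T _ f
  vprojGT T f := hM.existsUnique_vprojT T _ f
  vprojGTc T f := hM.existsUnique_vprojT T _ f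
  edgeTrace := hM.existsUnique_edgeTrace k
  edgeGrad := hM.existsUnique_edgeGrad k
  faceGrad := hM.existsUnique_faceGrad k
  faceTrace := hM.existsUnique_faceTrace k
  elemGrad := hM.existsUnique_elemGrad k
  faceCurl := hM.existsUnique_faceCurl k
  tanTrace := hM.existsUnique_tanTrace k
  elemCurl := hM.existsUnique_elemCurl k
  elemDiv := hM.existsUnique_elemDiv k

theorem faceCurl_spec (hM : M.IsPolyhedralMesh Ω) (k : ℕ) (F : Fin M.nF)
    (vF : RolyF ((k : ℤ) - 1)) (vE : Fin M.nE → PolE (k : ℤ)) {r : SPol 2}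
    (hr : r ∈ PolS 2 (k : ℤ)) : mulForm (hM.IF F) (M.faceCurl k F vF vE).1 r =
      dotForm (hM.IF F) vF.1 (vrot r) - M.bdS F (fun E => (vE E).1) r :=
  (hM.isFaceCurl_iff k F vF vE _).1 (theSol_spec (hM.existsUnique_faceCurl k F vF vE)) r hr

theorem elemDiv_spec (hM : M.IsPolyhedralMesh Ω) (k : ℕ) (T : Fin M.nT)
    (wT : GolyT ((k : ℤ) - 1)) (wF : Fin M.nF → PolS 2 (k : ℤ)) {r : SPol 3}
    (hr : r ∈ PolS 3 (k : ℤ)) : mulForm (hM.IT T) (M.elemDiv k T wT wF).1 r =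
      - dotForm (hM.IT T) wT.1 (grad 3 r) + hM.bdTS T (fun F => (wF F).1) r :=
  (hM.isElemDiv_iff k T wT wF _).1 (theSol_spec (hM.existsUnique_elemDiv k T wT wF)) r hr

theorem extensionsWellPosed (hM : M.IsPolyhedralMesh Ω) (k : ℕ) : M.ExtensionsWellPosed k where
  potCurl := hM.existsUnique_potCurl 0
  potDiv := hM.existsUnique_potDiv 0
  extPolE q E := by
    simp only [isExtPolE_iff, add_sub_assoc]
    refine existsUnique_riesz (PolE ((k : ℤ) - 1)) (mulForm (M.IE E))
      (fun _ _ h => hM.mulE_pos E h) (PolE k) Polynomial.derivative (fun _ hv => derivative_mem hv)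
      (fun u hu => ⟨antideriv u, ?_, derivative_antideriv u⟩)
      (-(mulForm (M.IE E) (M.edgeGrad 0 E (q.qE E) q.qV).1) +
        endForm (M.len E) (q.qV (M.head E)) (q.qV (M.tail E))) fun r _ h => ?_
    · have := antideriv_mem hu
      rwa [sub_add_cancel] at this
    -- The kernel consists of constants; compatibility is the definition of the degree-0 edge
    -- gradient tested with that constant.
    · rw [eq_C_of_derivative_eq_zero h]
      have h1 := hM.edgeGrad_spec 0 E (q.qE E) q.qV
        (C_mem_PolE (Int.natCast_nonneg 0) (r.eval 0))
      rw [LinearMap.add_apply, LinearMap.neg_apply, h1, Polynomial.derivative_C, map_zero]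
      simp [endForm]
  extPolF q F := by
    simp only [hM.isExtPolF_iff]
    exact hM.existsUnique_vdivF F k
      (-(dotForm (hM.IF F) (M.faceGrad 0 F (q.qF F) q.qE q.qV).1) +
        M.bdN F (fun E => (M.edgeTrace k E (M.extPolE k q E) q.qV).1))
  extPolT q T := by
    simp only [hM.isExtPolT_iff]
    exact existsUnique_riesz (PolS 3 ((k : ℤ) - 1)) (mulForm (hM.IT T))
      (fun _ _ h => hM.mulT_pos T h)
      (RolyTc (M.ctrT T) k) (vdivL 3) (fun _ hv => vdiv_mem (RolyTc_le _ hv))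
      (fun _ hu => exists_RolyTc_vdiv _ hu)
      (-(dotForm (hM.IT T) (M.elemGrad 0 T (q.qT T) q.qF q.qE q.qV).1) +
        hM.bdT T (fun F => (M.faceTrace k F (M.extPolF k q F) (M.extPolE k q) q.qV).1))
      fun v hv h => by rw [RolyTc_eq_zero_of_vdiv hv h, map_zero]
  extRolyF v F := by
    simp only [hM.isExtRolyF_iff]
    refine existsUnique_riesz (RolyF ((k : ℤ) - 1)) (dotForm (hM.IF F))
      (fun _ _ h => hM.dotF_pos F h) (PolS 2 k) vrot
      (fun r hr => ⟨r, ?_, rfl⟩) ?_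
      (mulForm (hM.IF F) (M.faceCurl 0 F (v.vF F) v.vE).1 +
        M.bdS F (fun E => (v.vE E).1)) fun r _ h => ?_
    · rwa [SetLike.mem_coe, sub_add_cancel]
    · rintro _ ⟨r, hr, rfl⟩
      rw [SetLike.mem_coe, sub_add_cancel] at hr
      exact ⟨r, hr, rfl⟩
    -- For a constant the right-hand side is zero by the definition of the degree-0 face curl.
    · rw [eq_C_of_vrot h, LinearMap.add_apply, hM.faceCurl_spec 0 F _ _
        (C_mem_PolS _ (Int.natCast_nonneg 0)), vrot_C, map_zero, zero_sub, neg_add_cancel]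
  extRolyT v T := by
    simp only [hM.isExtRolyT_iff]
    exact existsUnique_riesz (RolyT ((k : ℤ) - 1)) (dotForm (hM.IT T))
      (fun _ _ h => hM.dotT_pos T h) (GolyTc (M.ctrT T) k) curl
      (fun w hw => ⟨w, by
        rw [SetLike.mem_coe, sub_add_cancel]
        exact GolyTc_le _ hw, rfl⟩)
      (fun u hu => exists_GolyTc_curl _ hu)
      (dotForm (hM.IT T) (M.elemCurl 0 T (v.vT T) v.vF v.vFc v.vE).1 -
        hM.bdTan T (fun F => (M.tanTrace k F (M.extRolyF k v F) (M.extRolyFc k v F)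
          (M.inclE k v)).1))
      fun w hw h => by rw [GolyTc_eq_zero_of_curl hw h, map_zero]
  extGolyT w T := by
    simp only [hM.isExtGolyT_iff]
    refine existsUnique_riesz (GolyT ((k : ℤ) - 1)) (dotForm (hM.IT T))
      (fun _ _ h => hM.dotT_pos T h) (PolS 3 k) (grad 3)
      (fun r hr => ⟨r, ?_, rfl⟩) ?_
      (-mulForm (hM.IT T) (M.elemDiv 0 T (w.wT T) w.wF).1 +
        hM.bdTS T (fun F => (w.wF F).1)) fun r _ h => ?_
    · rwa [SetLike.mem_coe, sub_add_cancel]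
    · rintro _ ⟨r, hr, rfl⟩
      rw [SetLike.mem_coe, sub_add_cancel] at hr
      exact ⟨r, hr, rfl⟩
    -- A function with zero gradient is constant, and the degree-0 divergence tested with it gives
    -- the compatibility.
    · have h1 := eq_C_of_grad_add (c := 0) (l := 0) (zero_mem (GolyTc 0 0)) ((add_zero _).trans h)
      rw [h1, LinearMap.add_apply, LinearMap.neg_apply, hM.elemDiv_spec 0 T _ _
        (C_mem_PolS _ (Int.natCast_nonneg 0)), grad_C, map_zero, neg_zero, zero_add,
        neg_add_cancel]

end IsPolyhedralMesh

end MeshData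

end DDR

/-! ### The square of the discrete gradient -/

namespace DDR

open MvPolynomial

namespace MeshData

variable {M : MeshData} {Ω : Set R3}

namespace IsPolyhedralMesh

/-! ### Defining identities of the operators -/

theorem vprojF_spec (hM : M.IsPolyhedralMesh Ω) (F : Fin M.nF) (S : Submodule ℝ (VPol 2))
    [Module.Finite ℝ S] (f : VPol 2) {v : VPol 2} (hv : v ∈ S) :
    dotForm (hM.IF F) (M.vprojF F S (ev f)).1 v = dotForm (hM.IF F) f v :=
  (hM.isVProjF_iff F S f _).1 (theSol_spec (hM.existsUnique_vprojF F S f)) v hv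

theorem vprojT_spec (hM : M.IsPolyhedralMesh Ω) (T : Fin M.nT) (S : Submodule ℝ (VPol 3))
    [Module.Finite ℝ S] (f : VPol 3) {v : VPol 3} (hv : v ∈ S) :
    dotForm (hM.IT T) (M.vprojT T S (ev f)).1 v = dotForm (hM.IT T) f v :=
  (hM.isVProjT_iff T S f _).1 (theSol_spec (hM.existsUnique_vprojT T S f)) v hv

theorem vprojF_congr (hM : M.IsPolyhedralMesh Ω) (F : Fin M.nF) (S : Submodule ℝ (VPol 2))
    [Module.Finite ℝ S] {f g : VPol 2}
    (h : ∀ v ∈ S, dotForm (hM.IF F) f v = dotForm (hM.IF F) g v) :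
    M.vprojF F S (ev f) = M.vprojF F S (ev g) :=
  theSol_eq (hM.existsUnique_vprojF F S f) ((hM.isVProjF_iff F S f _).2 fun v hv =>
    (hM.vprojF_spec F S g hv).trans (h v hv).symm)

theorem vprojT_congr (hM : M.IsPolyhedralMesh Ω) (T : Fin M.nT) (S : Submodule ℝ (VPol 3))
    [Module.Finite ℝ S] {f g : VPol 3}
    (h : ∀ v ∈ S, dotForm (hM.IT T) f v = dotForm (hM.IT T) g v) :
    M.vprojT T S (ev f) = M.vprojT T S (ev g) :=
  theSol_eq (hM.existsUnique_vprojT T S f) ((hM.isVProjT_iff T S f _).2 fun v hv =>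
    (hM.vprojT_spec T S g hv).trans (h v hv).symm)

theorem faceGrad_spec (hM : M.IsPolyhedralMesh Ω) (k : ℕ) (F : Fin M.nF)
    (qF : PolS 2 ((k : ℤ) - 1)) (qE : Fin M.nE → PolE ((k : ℤ) - 1)) (qV : Fin M.nV → ℝ)
    {v : VPol 2} (hv : v ∈ PolV 2 (k : ℤ)) :
    dotForm (hM.IF F) (M.faceGrad k F qF qE qV).1 v = - mulForm (hM.IF F) qF.1 (vdiv v) +
      M.bdN F (fun E => (M.edgeTrace k E (qE E) qV).1) v :=
  (hM.isFaceGrad_iff k F qF qE qV _).1 (theSol_spec (hM.existsUnique_faceGrad k F qF qE qV)) v hv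

theorem elemGrad_spec (hM : M.IsPolyhedralMesh Ω) (k : ℕ) (T : Fin M.nT)
    (qT : PolS 3 ((k : ℤ) - 1)) (qF : Fin M.nF → PolS 2 ((k : ℤ) - 1))
    (qE : Fin M.nE → PolE ((k : ℤ) - 1)) (qV : Fin M.nV → ℝ)
    {v : VPol 3} (hv : v ∈ PolV 3 (k : ℤ)) :
    dotForm (hM.IT T) (M.elemGrad k T qT qF qE qV).1 v = - mulForm (hM.IT T) qT.1 (vdiv v) +
      hM.bdT T (fun F => (M.faceTrace k F (qF F) qE qV).1) v :=
  (hM.isElemGrad_iff k T qT qF qE qV _).1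
    (theSol_spec (hM.existsUnique_elemGrad k T qT qF qE qV)) v hv

/-! ### The gradient and its traces -/

/-- The edge components of the gradient integrate by parts on the boundary of a face. -/
theorem bdN_edgeTrace_vrot (hM : M.IsPolyhedralMesh Ω) (k : ℕ) (F : Fin M.nF)
    (qE : Fin M.nE → PolE ((k : ℤ) - 1)) (qV : Fin M.nV → ℝ) (r : SPol 2) :
    M.bdN F (fun E => (M.edgeTrace k E (qE E) qV).1) (vrot r) =
      M.bdS F (fun E => (M.edgeGrad k E (qE E) qV).1) r := by
  -- The end-point terms of the integrations by parts are differences of the vertex function `q_V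
  -- r(x_V)`, which `sum_vertices` sums to zero.
  rw [bdN_apply, bdS_apply, ← sub_eq_zero, ← Finset.sum_sub_distrib,
    ← neg_eq_zero, ← hM.sum_vertices F fun V => qV V * eval (M.coord F (M.pos V)) r,
    ← Finset.sum_neg_distrib]
  refine Finset.sum_congr rfl fun E _ => ?_
  have hs := hM.edgeTrace_spec k E (qE E) qV
  have hd := ((hM.isEdgeTrace_iff k E (qE E) qV _).1 hs).2
  have hb := mulE_by_parts E (M.edgeTrace k E (qE E) qV).1 (M.resE F E r)
  rw [hd, hs.1, hs.2.1, eval_resE, eval_resE, hM.edgePt_len, mulForm_apply, mulForm_apply] at hb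
  have h0 : M.edgePt E 0 = M.pos (M.tail E) := by rw [edgePt, zero_smul, add_zero]
  rw [nrmE_vrot, mul_neg, map_neg, hb, h0]
  ring

/-- Against rotationals the face unknown drops out, and the face gradient sees only the edge
gradients. -/
theorem faceGrad_vrot (hM : M.IsPolyhedralMesh Ω) (k : ℕ) (F : Fin M.nF)
    (qF : PolS 2 ((k : ℤ) - 1)) (qE : Fin M.nE → PolE ((k : ℤ) - 1)) (qV : Fin M.nV → ℝ)
    {r : SPol 2} (hr : r ∈ PolS 2 ((k : ℤ) + 1)) :
    dotForm (hM.IF F) (M.faceGrad k F qF qE qV).1 (vrot r) =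
      M.bdS F (fun E => (M.edgeGrad k E (qE E) qV).1) r := by
  have h := vrot_mem hr
  rw [add_sub_cancel_right] at h
  rw [hM.faceGrad_spec k F qF qE qV h, vdiv_vrot, map_zero, neg_zero, zero_add,
    hM.bdN_edgeTrace_vrot]

/-- The integration by parts formula that defines the face trace holds for a larger space of test
functions. -/
theorem faceTrace_vdiv (hM : M.IsPolyhedralMesh Ω) (k : ℕ) (F : Fin M.nF)
    (qF : PolS 2 ((k : ℤ) - 1)) (qE : Fin M.nE → PolE ((k : ℤ) - 1)) (qV : Fin M.nV → ℝ)
    {u z : VPol 2} (hu : u ∈ PolV 2 (k : ℤ)) (hz : z ∈ RolyFc ((k : ℤ) + 2)) :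
    mulForm (hM.IF F) (M.faceTrace k F qF qE qV).1 (vdiv (u + z)) =
      - dotForm (hM.IF F) (M.faceGrad k F qF qE qV).1 (u + z) +
        M.bdN F (fun E => (M.edgeTrace k E (qE E) qV).1) (u + z) := by
  -- The rotational part of `u` adds nothing: its divergence is zero, and its gradient and boundary
  -- terms are equal and cancel. The rest is an admissible test function of the face trace.
  obtain ⟨r, hr, w, hw, rfl⟩ := exists_vrot_add hu
  have hwz : w + z ∈ RolyFc ((k : ℤ) + 2) := add_mem (RolyFc_mono (by linarith) hw) hz
  have h := (hM.isFaceTrace_iff k F qF qE qV _).1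
    (theSol_spec (hM.existsUnique_faceTrace k F qF qE qV)) _ hwz
  rw [add_assoc, vdiv_add, vdiv_vrot, zero_add, map_add (dotForm _ _), map_add (M.bdN _ _),
    hM.faceGrad_vrot k F qF qE qV hr, hM.bdN_edgeTrace_vrot]
  exact h.trans (by ring)

/-- On each face `curl w · n_F` is the divergence of `w × n_F`, so the face trace formula applies.
The edge terms pair `γ_E` with `w · t_E`, which depends only on the edge, and `sum_edges` cancels
them. -/
theorem bdT_faceTrace_curl (hM : M.IsPolyhedralMesh Ω) (k : ℕ) (T : Fin M.nT)
    (qF : Fin M.nF → PolS 2 ((k : ℤ) - 1)) (qE : Fin M.nE → PolE ((k : ℤ) - 1))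
    (qV : Fin M.nV → ℝ) {w : VPol 3}
    (hw : ∀ F, ∃ u ∈ PolV 2 (k : ℤ), ∃ z ∈ RolyFc ((k : ℤ) + 2), M.tanF F w = u + z) :
    hM.bdT T (fun F => (M.faceTrace k F (qF F) qE qV).1) (curl w) =
      - hM.bdTan T (fun F => (M.faceGrad k F (qF F) qE qV).1) w := by
  have h := hM.sum_edges T fun E => M.IE E ((M.edgeTrace k E (qE E) qV).1 * M.tanE E w)
  rw [bdT_apply, bdTan_apply, ← Finset.sum_neg_distrib, ← add_zero (∑ F ∈ M.facesOf T, _), ← h,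
    ← Finset.sum_add_distrib]
  refine Finset.sum_congr rfl fun F _ => ?_
  obtain ⟨u, hu, z, hz, huz⟩ := hw F
  have h1 := hM.faceTrace_vdiv k F (qF F) qE qV hu hz
  rw [← huz, vdiv_tanF, bdN_apply] at h1
  have h2 : ∑ E ∈ M.edgesOf F, M.ωFE F E *
      M.IE E ((M.edgeTrace k E (qE E) qV).1 * M.nrmE F E (M.tanF F w)) =
      - ∑ E ∈ M.edgesOf F, M.ωFE F E *
        M.IE E ((M.edgeTrace k E (qE E) qV).1 * M.tanE E w) := by
    rw [← Finset.sum_neg_distrib]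
    refine Finset.sum_congr rfl fun E hE => ?_
    rw [hM.nrmE_tanF hE, mul_neg, map_neg, mul_neg]
  rw [h1, h2]
  ring

theorem bdT_faceTrace_curl_of_mem (hM : M.IsPolyhedralMesh Ω) (k : ℕ) (T : Fin M.nT)
    (qF : Fin M.nF → PolS 2 ((k : ℤ) - 1)) (qE : Fin M.nE → PolE ((k : ℤ) - 1))
    (qV : Fin M.nV → ℝ) {w : VPol 3} (hw : w ∈ PolV 3 (k : ℤ)) :
    hM.bdT T (fun F => (M.faceTrace k F (qF F) qE qV).1) (curl w) =
      - hM.bdTan T (fun F => (M.faceGrad k F (qF F) qE qV).1) w :=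
  hM.bdT_faceTrace_curl k T qF qE qV fun F =>
    ⟨_, M.tanF_mem F hw, 0, zero_mem _, (add_zero _).symm⟩

theorem elemGrad_curl (hM : M.IsPolyhedralMesh Ω) (k : ℕ) (T : Fin M.nT)
    (qT : PolS 3 ((k : ℤ) - 1)) (qF : Fin M.nF → PolS 2 ((k : ℤ) - 1))
    (qE : Fin M.nE → PolE ((k : ℤ) - 1)) (qV : Fin M.nV → ℝ) {w : VPol 3}
    (hw : curl w ∈ PolV 3 (k : ℤ)) :
    dotForm (hM.IT T) (M.elemGrad k T qT qF qE qV).1 (curl w) =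
      hM.bdT T (fun F => (M.faceTrace k F (qF F) qE qV).1) (curl w) := by
  rw [hM.elemGrad_spec k T qT qF qE qV hw, vdiv_curl, map_zero, neg_zero, zero_add]

theorem vrot_mem_RolyF {k : ℕ} {r : SPol 2} (hr : r ∈ PolS 2 (k : ℤ)) :
    vrot r ∈ RolyF ((k : ℤ) - 1) := ⟨r, by rwa [sub_add_cancel], rfl⟩

theorem curl_mem_RolyT {k : ℕ} {w : VPol 3} (hw : w ∈ PolV 3 (k : ℤ)) :
    curl w ∈ RolyT ((k : ℤ) - 1) := ⟨w, by rwa [sub_add_cancel], rfl⟩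

theorem grad_mem_GolyT {k : ℕ} {r : SPol 3} (hr : r ∈ PolS 3 (k : ℤ)) :
    grad 3 r ∈ GolyT ((k : ℤ) - 1) := ⟨r, by rwa [sub_add_cancel], rfl⟩

/-! ### Operators of the curl space on gradients -/

/-- The projection on `R^{k-1}(F)` keeps the moments against rotationals, which by `faceGrad_vrot`
equal the edge term subtracted in the face curl. -/
theorem faceCurl_gradh (hM : M.IsPolyhedralMesh Ω) (k : ℕ) (q : M.XGrad k) (F : Fin M.nF) :
    M.faceCurl k F ((M.gradh k q).vF F) (M.gradh k q).vE = 0 := by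
  refine theSol_eq (hM.existsUnique_faceCurl k F _ _) ((hM.isFaceCurl_iff k F _ _ _).2 ?_)
  intro r hr
  have h1 := hM.vprojF_spec F (RolyF ((k : ℤ) - 1))
    (M.faceGrad k F (q.qF F) q.qE q.qV).1 (vrot_mem_RolyF hr)
  rw [hM.faceGrad_vrot k F _ _ _ (PolS_mono 2 (by linarith) hr)] at h1
  rw [ZeroMemClass.coe_zero, map_zero, LinearMap.zero_apply]
  exact (sub_eq_zero.2 h1).symm

/-- Once the face curl is zero, the trace problem prescribes exactly the moments of the face
gradient. -/
theorem tanTrace_gradh (hM : M.IsPolyhedralMesh Ω) (k : ℕ) (q : M.XGrad k) (F : Fin M.nF) :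
    M.tanTrace k F ((M.gradh k q).vF F) ((M.gradh k q).vFc F) (M.gradh k q).vE =
      M.faceGrad k F (q.qF F) q.qE q.qV := by
  refine theSol_eq (hM.existsUnique_tanTrace k F _ _ _) ((hM.isTanTrace_iff k F _ _ _ _).2 ?_)
  intro r hr _ w hw
  have h1 := hM.vprojF_spec F (RolyFc k) (M.faceGrad k F (q.qF F) q.qE q.qV).1 hw
  rw [hM.faceCurl_gradh, ZeroMemClass.coe_zero, map_zero, LinearMap.zero_apply, zero_add, map_add,
    hM.faceGrad_vrot k F _ _ _ hr]
  exact congrArg _ h1.symm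

theorem elemCurl_gradh (hM : M.IsPolyhedralMesh Ω) (k : ℕ) (q : M.XGrad k) (T : Fin M.nT) :
    M.elemCurl k T ((M.gradh k q).vT T) (M.gradh k q).vF (M.gradh k q).vFc (M.gradh k q).vE =
      0 := by
  refine theSol_eq (hM.existsUnique_elemCurl k T _ _ _ _) ((hM.isElemCurl_iff k T _ _ _ _ _).2 ?_)
  intro w hw
  have hc := curl_mem_RolyT hw
  have h1 := hM.vprojT_spec T (RolyT ((k : ℤ) - 1)) (M.elemGrad k T (q.qT T) q.qF q.qE q.qV).1 hc
  rw [hM.elemGrad_curl k T _ _ _ _ (PolV_mono (by linarith) (RolyT_le hc)),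
    hM.bdT_faceTrace_curl_of_mem k T _ _ _ hw] at h1
  simp only [hM.tanTrace_gradh]
  rw [ZeroMemClass.coe_zero, map_zero, LinearMap.zero_apply]
  exact (eq_neg_iff_add_eq_zero.1 h1).symm

/-- Here `w` has degree `k + 1`, so its trace on a face is not of degree `k`; `exists_tanF_eq`
supplies the splitting needed in `bdT_faceTrace_curl`. -/
theorem potCurl_gradh (hM : M.IsPolyhedralMesh Ω) (k : ℕ) (q : M.XGrad k) (T : Fin M.nT) :
    M.potCurl k T ((M.gradh k q).vT T) ((M.gradh k q).vTc T) (M.gradh k q).vF (M.gradh k q).vFc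
      (M.gradh k q).vE = M.elemGrad k T (q.qT T) q.qF q.qE q.qV := by
  refine theSol_eq (hM.existsUnique_potCurl k T _ _ _ _ _)
    ((hM.isPotCurl_iff k T _ _ _ _ _ _).2 ?_)
  intro w hw z hz
  have h1 := hM.vprojT_spec T (RolyTc (M.ctrT T) k) (M.elemGrad k T (q.qT T) q.qF q.qE q.qV).1 hz
  have hc := curl_mem (GolyTc_le _ hw)
  rw [add_sub_cancel_right] at hc
  simp only [hM.tanTrace_gradh]
  rw [hM.elemCurl_gradh, ZeroMemClass.coe_zero, map_zero, LinearMap.zero_apply, zero_sub, map_add,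
    hM.elemGrad_curl k T _ _ _ _ hc, hM.bdT_faceTrace_curl]
  · exact congrArg _ h1.symm
  · intro F
    obtain ⟨u, hu, z, hz, h⟩ := hM.exists_tanF_eq F hw
    exact ⟨u, hu, z, RolyFc_mono (by linarith) hz, h⟩

/-! ### Commutation of the gradient with the extensions -/

/-- The equation of the edge extension is that of the degree-`k` edge gradient with the degree-0
gradient as its solution. -/
theorem edgeGrad_extPolE (hM : M.IsPolyhedralMesh Ω) (k : ℕ) (q : M.XGrad 0) (E : Fin M.nE) :
    M.edgeGrad k E (M.extPolE k q E) q.qV = M.inclE k (M.gradh 0 q) E := by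
  refine theSol_eq (hM.existsUnique_edgeGrad k E _ _) ((isEdgeGrad_iff k E _ _ _).2 ?_)
  intro r hr
  have h := (isExtPolE_iff k q E _).1 (theSol_spec ((hM.extensionsWellPosed k).extPolE q E)) r hr
  change mulForm (M.IE E) (M.edgeGrad 0 E (q.qE E) q.qV).1 r =
    - mulForm (M.IE E) (M.extPolE k q E).1 (Polynomial.derivative r) + _ - _
  change mulForm (M.IE E) (M.extPolE k q E).1 (Polynomial.derivative r) = _ at h
  rw [h]
  ring

/-- The degree-0 face curl of a gradient is zero, so the extension has only its edge term. By
`edgeGrad_extPolE` this is the edge term of the degree-`k` face gradient against rotationals. -/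
theorem extRolyF_gradh (hM : M.IsPolyhedralMesh Ω) (k : ℕ) (q : M.XGrad 0) (F : Fin M.nF) :
    M.extRolyF k (M.gradh 0 q) F = (M.gradh k (M.extGrad k q)).vF F := by
  refine theSol_eq ((hM.extensionsWellPosed k).extRolyF _ F) ((hM.isExtRolyF_iff k _ F _).2 ?_)
  intro r hr
  have h1 := hM.vprojF_spec F (RolyF ((k : ℤ) - 1))
    (M.faceGrad k F (M.extPolF k q F) (M.extPolE k q) q.qV).1 (vrot_mem_RolyF hr)
  rw [hM.faceGrad_vrot k F _ _ _ (PolS_mono 2 (by linarith) hr)] at h1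
  have h2 : ∀ E, (M.edgeGrad k E (M.extPolE k q E) q.qV).1 = ((M.gradh 0 q).vE E).1 := fun E => by
    rw [hM.edgeGrad_extPolE, inclE, Submodule.coe_inclusion]
  simp only [h2] at h1
  rw [hM.faceCurl_gradh, ZeroMemClass.coe_zero, map_zero, LinearMap.zero_apply, zero_add, ← h1]
  rfl

/-- The degree-0 tangential trace is the degree-0 face gradient, and the face extension is built so
that the gradients of both degrees agree against `R^{c,k}(F)`. -/
theorem extRolyFc_gradh (hM : M.IsPolyhedralMesh Ω) (k : ℕ) (q : M.XGrad 0) (F : Fin M.nF) :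
    M.extRolyFc k (M.gradh 0 q) F = (M.gradh k (M.extGrad k q)).vFc F := by
  unfold extRolyFc
  rw [hM.tanTrace_gradh]
  refine hM.vprojF_congr F _ fun v hv => ?_
  have h := (hM.isExtPolF_iff k q F _).1
    (theSol_spec ((hM.extensionsWellPosed k).extPolF q F)) v hv
  have h1 := hM.faceGrad_spec k F (M.extPolF k q F) (M.extPolE k q) q.qV (RolyFc_le hv)
  change mulForm (hM.IF F) (M.extPolF k q F).1 (vdiv v) = _ at h
  rw [h] at h1
  refine Eq.trans ?_ h1.symm
  ring

theorem inclE_gradh (hM : M.IsPolyhedralMesh Ω) (k : ℕ) (q : M.XGrad 0) :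
    M.inclE k (M.gradh 0 q) = (M.gradh k (M.extGrad k q)).vE :=
  funext fun E => (hM.edgeGrad_extPolE k q E).symm

/-- The degree-0 element curl vanishes, and the face components already identified make the
tangential traces equal to face gradients. What remains is the element gradient tested against `curl
w`. -/
theorem extRolyT_gradh (hM : M.IsPolyhedralMesh Ω) (k : ℕ) (q : M.XGrad 0) (T : Fin M.nT) :
    M.extRolyT k (M.gradh 0 q) T = (M.gradh k (M.extGrad k q)).vT T := by
  refine theSol_eq ((hM.extensionsWellPosed k).extRolyT _ T) ((hM.isExtRolyT_iff k _ T _).2 ?_)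
  intro w hw
  have hw' := GolyTc_le _ hw
  have hc := curl_mem_RolyT hw'
  have h1 := hM.vprojT_spec T (RolyT ((k : ℤ) - 1))
    (M.elemGrad k T (M.extPolT k q T) (M.extPolF k q) (M.extPolE k q) q.qV).1 hc
  rw [hM.elemGrad_curl k T _ _ _ _ (PolV_mono (by linarith) (RolyT_le hc)),
    hM.bdT_faceTrace_curl_of_mem k T _ _ _ hw'] at h1
  simp only [hM.extRolyF_gradh, hM.extRolyFc_gradh, hM.inclE_gradh, hM.tanTrace_gradh]
  rw [hM.elemCurl_gradh, ZeroMemClass.coe_zero, map_zero, LinearMap.zero_apply, zero_sub]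
  exact h1

/-- The degree-0 potential is the degree-0 element gradient, and the element extension equates its
moments against `R^{c,k}(T)` with those of degree `k`. -/
theorem extRolyTc_gradh (hM : M.IsPolyhedralMesh Ω) (k : ℕ) (q : M.XGrad 0) (T : Fin M.nT) :
    M.extRolyTc k (M.gradh 0 q) T = (M.gradh k (M.extGrad k q)).vTc T := by
  unfold extRolyTc
  rw [hM.potCurl_gradh]
  refine hM.vprojT_congr T _ fun v hv => ?_
  have h := (hM.isExtPolT_iff k q T _).1
    (theSol_spec ((hM.extensionsWellPosed k).extPolT q T)) v hv
  have h1 := hM.elemGrad_spec k T (M.extPolT k q T) (M.extPolF k q) (M.extPolE k q) q.qV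
    (RolyTc_le _ hv)
  change mulForm (hM.IT T) (M.extPolT k q T).1 (vdiv v) = _ at h
  rw [h] at h1
  refine Eq.trans ?_ h1.symm
  ring

theorem gradh_extGrad (hM : M.IsPolyhedralMesh Ω) (k : ℕ) (q : M.XGrad 0) :
    M.gradh k (M.extGrad k q) = M.extCurl k (M.gradh 0 q) :=
  XCurl.ext (funext fun T => (hM.extRolyT_gradh k q T).symm)
    (funext fun T => (hM.extRolyTc_gradh k q T).symm)
    (funext fun F => (hM.extRolyF_gradh k q F).symm)
    (funext fun F => (hM.extRolyFc_gradh k q F).symm) (hM.inclE_gradh k q).symm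

end IsPolyhedralMesh

end MeshData

end DDR

/-! ### The squares of the discrete curl and divergence, and constants -/

namespace DDR

open MvPolynomial

namespace MeshData

variable {M : MeshData} {Ω : Set R3}

namespace IsPolyhedralMesh

/-! ### The curl and its traces -/

theorem elemCurl_spec (hM : M.IsPolyhedralMesh Ω) (k : ℕ) (T : Fin M.nT)
    (vT : RolyT ((k : ℤ) - 1)) (vF : Fin M.nF → RolyF ((k : ℤ) - 1)) (vFc : Fin M.nF → RolyFc k)
    (vE : Fin M.nE → PolE (k : ℤ)) {w : VPol 3} (hw : w ∈ PolV 3 (k : ℤ)) :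
    dotForm (hM.IT T) (M.elemCurl k T vT vF vFc vE).1 w = dotForm (hM.IT T) vT.1 (curl w) +
      hM.bdTan T (fun F => (M.tanTrace k F (vF F) (vFc F) vE).1) w :=
  (hM.isElemCurl_iff k T vT vF vFc vE _).1
    (theSol_spec (hM.existsUnique_elemCurl k T vT vF vFc vE)) w hw

/-- Removes the zero-mean restriction on `r`: for constants the identity is the definition of the
face curl. -/
theorem tanTrace_vrot (hM : M.IsPolyhedralMesh Ω) (k : ℕ) (F : Fin M.nF)
    (vF : RolyF ((k : ℤ) - 1)) (vFc : RolyFc k) (vE : Fin M.nE → PolE (k : ℤ))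
    {r : SPol 2} (hr : r ∈ PolS 2 ((k : ℤ) + 1)) :
    dotForm (hM.IF F) (M.tanTrace k F vF vFc vE).1 (vrot r) =
      mulForm (hM.IF F) (M.faceCurl k F vF vE).1 r + M.bdS F (fun E => (vE E).1) r := by
  obtain ⟨a, ha⟩ := hM.exists_IF_sub_C F r
  have h := (hM.isTanTrace_iff k F vF vFc vE _).1
    (theSol_spec (hM.existsUnique_tanTrace k F vF vFc vE)) (r - C a)
    (sub_mem hr (C_mem_PolS a (by positivity))) ha 0 (zero_mem _)
  have h2 := hM.faceCurl_spec k F vF vE (C_mem_PolS a (Int.natCast_nonneg k))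
  rw [vrot_C, map_zero] at h2
  rw [add_zero, map_sub vrot, vrot_C, sub_zero, map_zero, add_zero, map_sub, map_sub, h2] at h
  refine h.trans ?_
  ring

theorem resE_resF (hM : M.IsPolyhedralMesh Ω) {F : Fin M.nF} {E : Fin M.nE}
    (hE : E ∈ M.edgesOf F) (r : SPol 3) : M.resE F E (M.resF F r) = M.resET E r :=
  Polynomial.funext fun s => by
    rw [eval_resE, eval_resF, hM.chart_coord_edgePt hE, eval_resET]

/-- `grad r × n_F` is the rotational of the restriction of `r`. The resulting edge terms `v_E r` are
common to the faces sharing an edge and cancel by `sum_edges`. -/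
theorem bdTan_tanTrace_grad (hM : M.IsPolyhedralMesh Ω) (k : ℕ) (T : Fin M.nT)
    (vF : Fin M.nF → RolyF ((k : ℤ) - 1)) (vFc : Fin M.nF → RolyFc k)
    (vE : Fin M.nE → PolE (k : ℤ)) {r : SPol 3} (hr : r ∈ PolS 3 ((k : ℤ) + 1)) :
    hM.bdTan T (fun F => (M.tanTrace k F (vF F) (vFc F) vE).1) (grad 3 r) =
      hM.bdTS T (fun F => (M.faceCurl k F (vF F) vE).1) r := by
  have h := hM.sum_edges T fun E => M.IE E ((vE E).1 * M.resET E r)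
  rw [bdTan_apply, bdTS_apply, ← add_zero (∑ F ∈ M.facesOf T, _ * mulForm _ _ _), ← h,
    ← Finset.sum_add_distrib]
  refine Finset.sum_congr rfl fun F _ => ?_
  rw [tanF_grad, hM.tanTrace_vrot k F _ _ _ (M.resF_mem F hr), bdS_apply, mul_add]
  congr 2
  exact Finset.sum_congr rfl fun E hE => by rw [hM.resE_resF hE]

theorem elemCurl_grad (hM : M.IsPolyhedralMesh Ω) (k : ℕ) (T : Fin M.nT)
    (vT : RolyT ((k : ℤ) - 1)) (vF : Fin M.nF → RolyF ((k : ℤ) - 1)) (vFc : Fin M.nF → RolyFc k)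
    (vE : Fin M.nE → PolE (k : ℤ)) {r : SPol 3} (hr : r ∈ PolS 3 ((k : ℤ) + 1)) :
    dotForm (hM.IT T) (M.elemCurl k T vT vF vFc vE).1 (grad 3 r) =
      hM.bdTS T (fun F => (M.faceCurl k F (vF F) vE).1) r := by
  have h := grad_mem hr
  rw [add_sub_cancel_right] at h
  rw [hM.elemCurl_spec k T _ _ _ _ h, curl_grad, map_zero, zero_add,
    hM.bdTan_tanTrace_grad k T _ _ _ hr]

/-! ### Operators of the divergence space on curls -/

/-- The projection on `G^{k-1}(T)` keeps the moments against gradients, which by `elemCurl_grad`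
equal the boundary term of the divergence. -/
theorem elemDiv_curlh (hM : M.IsPolyhedralMesh Ω) (k : ℕ) (v : M.XCurl k) (T : Fin M.nT) :
    M.elemDiv k T ((M.curlh k v).wT T) (M.curlh k v).wF = 0 := by
  refine theSol_eq (hM.existsUnique_elemDiv k T _ _) ((hM.isElemDiv_iff k T _ _ _).2 ?_)
  intro r hr
  have h1 := hM.vprojT_spec T (GolyT ((k : ℤ) - 1))
    (M.elemCurl k T (v.vT T) v.vF v.vFc v.vE).1 (grad_mem_GolyT hr)
  rw [hM.elemCurl_grad k T _ _ _ _ (PolS_mono 3 (by linarith) hr)] at h1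
  rw [ZeroMemClass.coe_zero, map_zero, LinearMap.zero_apply]
  exact (neg_add_eq_zero.2 h1).symm

theorem potDiv_curlh (hM : M.IsPolyhedralMesh Ω) (k : ℕ) (v : M.XCurl k) (T : Fin M.nT) :
    M.potDiv k T ((M.curlh k v).wT T) ((M.curlh k v).wTc T) (M.curlh k v).wF =
      M.elemCurl k T (v.vT T) v.vF v.vFc v.vE := by
  refine theSol_eq (hM.existsUnique_potDiv k T _ _ _) ((hM.isPotDiv_iff k T _ _ _ _).2 ?_)
  intro r hr _ z hz
  have h1 := hM.vprojT_spec T (GolyTc (M.ctrT T) k)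
    (M.elemCurl k T (v.vT T) v.vF v.vFc v.vE).1 hz
  rw [hM.elemDiv_curlh, ZeroMemClass.coe_zero, map_zero, LinearMap.zero_apply, neg_zero, zero_add,
    map_add, hM.elemCurl_grad k T _ _ _ _ hr]
  exact congrArg _ h1.symm

/-! ### Commutation of the curl and of the divergence with the extensions -/

/-- The edge term in the definition of the extension cancels the one in the face curl and leaves the
degree-0 curl. -/
theorem faceCurl_extRolyF (hM : M.IsPolyhedralMesh Ω) (k : ℕ) (v : M.XCurl 0) (F : Fin M.nF) :
    M.faceCurl k F (M.extRolyF k v F) (M.inclE k v) =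
      Submodule.inclusion (PolS_mono 2 (by simp)) (M.faceCurl 0 F (v.vF F) v.vE) := by
  refine theSol_eq (hM.existsUnique_faceCurl k F _ _) ((hM.isFaceCurl_iff k F _ _ _).2 ?_)
  intro r hr
  have h := (hM.isExtRolyF_iff k v F (M.extRolyF k v F)).1
    (theSol_spec ((hM.extensionsWellPosed k).extRolyF v F)) r hr
  have h2 : ∀ E, (M.inclE k v E).1 = (v.vE E).1 := fun E => by
    rw [inclE, Submodule.coe_inclusion]
  simp only [h2]
  rw [h, Submodule.coe_inclusion, add_sub_cancel_right]

/-- Both sides, tested against gradients, reduce to boundary sums of face curls, and these agree by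
`faceCurl_extRolyF`. -/
theorem extGolyT_curlh (hM : M.IsPolyhedralMesh Ω) (k : ℕ) (v : M.XCurl 0) (T : Fin M.nT) :
    M.extGolyT k (M.curlh 0 v) T = (M.curlh k (M.extCurl k v)).wT T := by
  refine theSol_eq ((hM.extensionsWellPosed k).extGolyT _ T) ((hM.isExtGolyT_iff k _ T _).2 ?_)
  intro r hr
  have h1 := hM.vprojT_spec T (GolyT ((k : ℤ) - 1))
    (M.elemCurl k T (M.extRolyT k v T) (M.extRolyF k v) (M.extRolyFc k v) (M.inclE k v)).1
    (grad_mem_GolyT hr)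
  rw [hM.elemCurl_grad k T _ _ _ _ (PolS_mono 3 (by linarith) hr)] at h1
  simp only [hM.faceCurl_extRolyF, Submodule.coe_inclusion] at h1
  rw [hM.elemDiv_curlh, ZeroMemClass.coe_zero, map_zero, LinearMap.zero_apply, neg_zero, zero_add]
  exact h1

/-- The degree-0 potential is the degree-0 element curl; the tangential terms in the definitions of
`extRolyT` and of the degree-`k` curl cancel. -/
theorem extGolyTc_curlh (hM : M.IsPolyhedralMesh Ω) (k : ℕ) (v : M.XCurl 0) (T : Fin M.nT) :
    M.extGolyTc k (M.curlh 0 v) T = (M.curlh k (M.extCurl k v)).wTc T := by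
  unfold extGolyTc
  rw [hM.potDiv_curlh]
  refine hM.vprojT_congr T _ fun w hw => ?_
  have h : dotForm (hM.IT T) (M.extRolyT k v T).1 (curl w) = _ := (hM.isExtRolyT_iff k v T _).1
    (theSol_spec ((hM.extensionsWellPosed k).extRolyT v T)) w hw
  have h1 := hM.elemCurl_spec k T (M.extRolyT k v T) (M.extRolyF k v) (M.extRolyFc k v)
    (M.inclE k v) (GolyTc_le _ hw)
  rw [h, sub_add_cancel] at h1
  exact h1.symm

theorem curlh_extCurl (hM : M.IsPolyhedralMesh Ω) (k : ℕ) (v : M.XCurl 0) :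
    M.curlh k (M.extCurl k v) = M.extDiv k (M.curlh 0 v) :=
  XDiv.ext (funext fun T => (hM.extGolyT_curlh k v T).symm)
    (funext fun T => (hM.extGolyTc_curlh k v T).symm)
    (funext fun F => hM.faceCurl_extRolyF k v F)

theorem divh_extDiv (hM : M.IsPolyhedralMesh Ω) (k : ℕ) (w : M.XDiv 0) :
    M.divh k (M.extDiv k w) = M.inclT k (M.divh 0 w) := by
  funext T
  refine theSol_eq (hM.existsUnique_elemDiv k T _ _) ((hM.isElemDiv_iff k T _ _ _).2 ?_)
  intro r hr
  have h : dotForm (hM.IT T) (M.extGolyT k w T).1 (grad 3 r) = _ := (hM.isExtGolyT_iff k w T _).1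
    (theSol_spec ((hM.extensionsWellPosed k).extGolyT w T)) r hr
  simp only [extDiv, inclT, divh, Submodule.coe_inclusion]
  rw [h]
  ring

/-! ### Constants -/

/-- With `bdT_C`, the reason why gradients of constants vanish: the boundary term cancels the
interior one by the divergence theorem. -/
theorem bdN_C (hM : M.IsPolyhedralMesh Ω) (F : Fin M.nF) (a : ℝ) (v : VPol 2) :
    M.bdN F (fun _ => Polynomial.C a) v = mulForm (hM.IF F) (C a) (vdiv v) := by
  rw [bdN_apply, mulForm_apply, C_mul', map_smul, hM.green, smul_eq_mul, Finset.mul_sum]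
  refine Finset.sum_congr rfl fun E _ => ?_
  rw [← Polynomial.smul_eq_C_mul, map_smul, smul_eq_mul, mul_left_comm]

theorem bdT_C (hM : M.IsPolyhedralMesh Ω) (T : Fin M.nT) (a : ℝ) (w : VPol 3) :
    hM.bdT T (fun _ => C a) w = mulForm (hM.IT T) (C a) (vdiv w) := by
  rw [bdT_apply, mulForm_apply, C_mul', map_smul, hM.gauss, smul_eq_mul, Finset.mul_sum]
  refine Finset.sum_congr rfl fun E _ => ?_
  rw [mulForm_apply, C_mul', map_smul, smul_eq_mul, mul_left_comm]

theorem interp_qE_spec (hM : M.IsPolyhedralMesh Ω) (k : ℕ) (a : ℝ) (E : Fin M.nE)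
    {r : Polynomial ℝ} (hr : r ∈ PolE ((k : ℤ) - 1)) :
    mulForm (M.IE E) ((M.interp k fun _ => a).qE E).1 r =
      mulForm (M.IE E) (Polynomial.C a) r := by
  have h := theSol_spec (hM.existsUnique_projE E ((k : ℤ) - 1)
    (continuous_const : Continuous fun _ : ℝ => a)) ⟨r, hr⟩
  rw [intE_mul] at h
  rw [← intE_mul E (Polynomial.C a)]
  simp only [Polynomial.eval_C]
  exact h

theorem interp_qF_spec (hM : M.IsPolyhedralMesh Ω) (k : ℕ) (a : ℝ) (F : Fin M.nF)
    {r : SPol 2} (hr : r ∈ PolS 2 ((k : ℤ) - 1)) :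
    mulForm (hM.IF F) ((M.interp k fun _ => a).qF F).1 r = mulForm (hM.IF F) (C a) r := by
  have h := theSol_spec (hM.existsUnique_projF F ((k : ℤ) - 1)
    (continuous_const : Continuous fun _ : R2 => a)) ⟨r, hr⟩
  rw [hM.intF_mul] at h
  rw [← hM.intF_mul F (C a)]
  simp only [eval_C]
  exact h

theorem interp_qT_spec (hM : M.IsPolyhedralMesh Ω) (k : ℕ) (a : ℝ) (T : Fin M.nT)
    {r : SPol 3} (hr : r ∈ PolS 3 ((k : ℤ) - 1)) :
    mulForm (hM.IT T) ((M.interp k fun _ => a).qT T).1 r = mulForm (hM.IT T) (C a) r := by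
  have h := theSol_spec (hM.existsUnique_projT T ((k : ℤ) - 1)
    (continuous_const : Continuous fun _ : R3 => a)) ⟨r, hr⟩
  rw [hM.intT_mul] at h
  rw [← hM.intT_mul T (C a)]
  simp only [eval_C]
  exact h

/-- Derivatives of degree-`k` polynomials have degree at most `k - 1`, so the projection acts on
them as the constant itself. -/
theorem interp_qE_derivative (hM : M.IsPolyhedralMesh Ω) (k : ℕ) (a : ℝ) (E : Fin M.nE)
    {r : Polynomial ℝ} (hr : r ∈ PolE (k : ℤ)) :
    mulForm (M.IE E) ((M.interp k fun _ => a).qE E).1 (Polynomial.derivative r) =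
      a * r.eval (M.len E) - a * r.eval 0 := by
  rw [hM.interp_qE_spec k a E (derivative_mem hr), mulE_by_parts, Polynomial.derivative_C,
    map_zero, LinearMap.zero_apply, Polynomial.eval_C, Polynomial.eval_C, neg_zero, zero_add]

theorem edgeGrad_interp (hM : M.IsPolyhedralMesh Ω) (k : ℕ) (a : ℝ) (E : Fin M.nE) :
    M.edgeGrad k E ((M.interp k fun _ => a).qE E) (fun _ => a) = 0 := by
  refine theSol_eq (hM.existsUnique_edgeGrad k E _ _) ((isEdgeGrad_iff k E _ _ _).2 ?_)
  intro r hr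
  rw [hM.interp_qE_derivative k a E hr, ZeroMemClass.coe_zero, map_zero, LinearMap.zero_apply]
  ring

theorem edgeTrace_interp (hM : M.IsPolyhedralMesh Ω) (k : ℕ) (a : ℝ) (E : Fin M.nE) :
    (M.edgeTrace k E ((M.interp k fun _ => a).qE E) (fun _ => a)).1 = Polynomial.C a := by
  have h := theSol_eq (x := ⟨Polynomial.C a, C_mem_PolE (by positivity) a⟩)
    (hM.existsUnique_edgeTrace k E ((M.interp k fun _ => a).qE E) (fun _ => a))
    ((hM.isEdgeTrace_iff k E _ _ _).2 ⟨Polynomial.eval_C, by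
      rw [hM.edgeGrad_interp]; exact Polynomial.derivative_C⟩)
  exact congrArg Subtype.val h

theorem faceGrad_interp (hM : M.IsPolyhedralMesh Ω) (k : ℕ) (a : ℝ) (F : Fin M.nF) :
    M.faceGrad k F ((M.interp k fun _ => a).qF F) (M.interp k fun _ => a).qE (fun _ => a) = 0 := by
  refine theSol_eq (hM.existsUnique_faceGrad k F _ _ _) ((hM.isFaceGrad_iff k F _ _ _ _).2 ?_)
  intro v hv
  simp only [hM.edgeTrace_interp]
  rw [hM.interp_qF_spec k a F (vdiv_mem hv), hM.bdN_C, ZeroMemClass.coe_zero, map_zero,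
    LinearMap.zero_apply, neg_add_cancel]

theorem faceTrace_interp (hM : M.IsPolyhedralMesh Ω) (k : ℕ) (a : ℝ) (F : Fin M.nF) :
    (M.faceTrace k F ((M.interp k fun _ => a).qF F) (M.interp k fun _ => a).qE
      (fun _ => a)).1 = C a := by
  have h := theSol_eq (x := ⟨C a, C_mem_PolS a (by positivity)⟩)
    (hM.existsUnique_faceTrace k F ((M.interp k fun _ => a).qF F) (M.interp k fun _ => a).qE
      (fun _ => a)) ((hM.isFaceTrace_iff k F _ _ _ _).2 fun v _ => by
        simp only [hM.edgeTrace_interp]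
        rw [hM.faceGrad_interp, hM.bdN_C, ZeroMemClass.coe_zero, map_zero, LinearMap.zero_apply,
          neg_zero, zero_add])
  exact congrArg Subtype.val h

theorem elemGrad_interp (hM : M.IsPolyhedralMesh Ω) (k : ℕ) (a : ℝ) (T : Fin M.nT) :
    M.elemGrad k T ((M.interp k fun _ => a).qT T) (M.interp k fun _ => a).qF
      (M.interp k fun _ => a).qE (fun _ => a) = 0 := by
  refine theSol_eq (hM.existsUnique_elemGrad k T _ _ _ _) ((hM.isElemGrad_iff k T _ _ _ _ _).2 ?_)
  intro v hv
  simp only [hM.faceTrace_interp]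
  rw [hM.interp_qT_spec k a T (vdiv_mem hv), hM.bdT_C, ZeroMemClass.coe_zero, map_zero,
    LinearMap.zero_apply, neg_add_cancel]

/-- The degree-0 gradient of a constant is zero, so the extension problem is solved by the
projection of the constant. The face and element cases follow the same pattern. -/
theorem extPolE_interp (hM : M.IsPolyhedralMesh Ω) (k : ℕ) (a : ℝ) :
    M.extPolE k (M.interp 0 fun _ => a) = (M.interp k fun _ => a).qE := by
  funext E
  refine theSol_eq ((hM.extensionsWellPosed k).extPolE _ E) ((isExtPolE_iff k _ E _).2 ?_)
  intro r hr
  have h : M.edgeGrad 0 E ((M.interp 0 fun _ => a).qE E) (M.interp 0 fun _ => a).qV = 0 :=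
    hM.edgeGrad_interp 0 a E
  rw [hM.interp_qE_derivative k a E hr, h, ZeroMemClass.coe_zero, map_zero, LinearMap.zero_apply,
    neg_zero, zero_add]
  rfl

theorem extPolF_interp (hM : M.IsPolyhedralMesh Ω) (k : ℕ) (a : ℝ) :
    M.extPolF k (M.interp 0 fun _ => a) = (M.interp k fun _ => a).qF := by
  funext F
  refine theSol_eq ((hM.extensionsWellPosed k).extPolF _ F) ((hM.isExtPolF_iff k _ F _).2 ?_)
  intro v hv
  have h : M.faceGrad 0 F ((M.interp 0 fun _ => a).qF F) (M.interp 0 fun _ => a).qE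
    (M.interp 0 fun _ => a).qV = 0 := hM.faceGrad_interp 0 a F
  have h2 : ∀ E, (M.edgeTrace k E ((M.interp k fun _ => a).qE E)
    (M.interp 0 fun _ => a).qV).1 = Polynomial.C a := hM.edgeTrace_interp k a
  simp only [hM.extPolE_interp, h, h2]
  rw [hM.interp_qF_spec k a F (vdiv_mem (RolyFc_le hv)), hM.bdN_C, ZeroMemClass.coe_zero, map_zero,
    LinearMap.zero_apply, neg_zero, zero_add]

theorem extPolT_interp (hM : M.IsPolyhedralMesh Ω) (k : ℕ) (a : ℝ) :
    M.extPolT k (M.interp 0 fun _ => a) = (M.interp k fun _ => a).qT := by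
  funext T
  refine theSol_eq ((hM.extensionsWellPosed k).extPolT _ T) ((hM.isExtPolT_iff k _ T _).2 ?_)
  intro v hv
  have h : M.elemGrad 0 T ((M.interp 0 fun _ => a).qT T) (M.interp 0 fun _ => a).qF
    (M.interp 0 fun _ => a).qE (M.interp 0 fun _ => a).qV = 0 := hM.elemGrad_interp 0 a T
  have h2 : ∀ F, (M.faceTrace k F ((M.interp k fun _ => a).qF F) (M.interp k fun _ => a).qE
    (M.interp 0 fun _ => a).qV).1 = C a := hM.faceTrace_interp k a
  simp only [hM.extPolE_interp, hM.extPolF_interp, h, h2]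
  rw [hM.interp_qT_spec k a T (vdiv_mem (RolyTc_le _ hv)), hM.bdT_C, ZeroMemClass.coe_zero,
    map_zero, LinearMap.zero_apply, neg_zero, zero_add]

theorem interp_const (hM : M.IsPolyhedralMesh Ω) (k : ℕ) (a : ℝ) :
    M.interp k (fun _ => a) = M.extGrad k (M.interp 0 fun _ => a) :=
  XGrad.ext (hM.extPolT_interp k a).symm (hM.extPolF_interp k a).symm
    (hM.extPolE_interp k a).symm rfl

end IsPolyhedralMesh

end MeshData

end DDR

theorem mainTheorem6 (Ω : Set DDR.R3) (M : DDR.MeshData) (hM : M.IsPolyhedralMesh Ω) (k : ℕ) :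
    (M.OperatorsWellPosed 0 ∧ M.OperatorsWellPosed k ∧ M.ExtensionsWellPosed k) ∧
    (∀ C : ℝ, M.interp k (fun _ => C) = M.extGrad k (M.interp 0 (fun _ => C))) ∧
    (∀ q : M.XGrad 0, M.gradh k (M.extGrad k q) = M.extCurl k (M.gradh 0 q)) ∧
    (∀ v : M.XCurl 0, M.curlh k (M.extCurl k v) = M.extDiv k (M.curlh 0 v)) ∧
    (∀ w : M.XDiv 0, M.divh k (M.extDiv k w) = M.inclT k (M.divh 0 w)) :=
  ⟨⟨hM.operatorsWellPosed 0, hM.operatorsWellPosed k, hM.extensionsWellPosed k⟩,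
    hM.interp_const k, hM.gradh_extGrad k, hM.curlh_extCurl k, hM.divh_extDiv k⟩
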